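/- **Setting.** Let $n\ge 3$ and let $f=f(u,r)$ be defined for $u\ge 0$, $r>0$. Set $m(l)=\frac{2}{l-2}$ and $g(y,s;l)=f(ye^{-m(l)s},e^s)\,e^{(m(l)+2)s}$. Assume: * $\boldsymbol{F0}$: $f$ is locally Lipschitz on $[0,\infty)\times(0,\infty)$, $f(0,r)=0$, $f(u,r)>0$ for $u>0$, $f$ is nondecreasing in $u$, and for every $u\ge0$ there is $C(u)>0$ with $f(u,r)r^2\le C(u)$ for $0<r\le 1$. * $\boldsymbol{Fu}$: there is $l_u>\frac{2(n-1)}{n-2}$ such that (a) as $s\to-\infty$, $g(\cdot,s;l_u)$ converges, uniformly on compact subsets of $(0,\infty)$, to a locally Lipschitz function $g_\infty\not\equiv0$ that is differentiable on $(0,\infty)$ with $g_\infty'$ strictly increasing, $g_\infty(y)/y\to0$ as $y\to0^+$ and $g_\infty(y)/y\to+\infty$ as $y\to+\infty$; (b) there is $\varpi>0$ with $e^{-\varpi s}\partial_s g(y,s;l_u)\to 0$ as $s\to-\infty$ for every $y>0$ (along the points where the derivative exists); (c) if $l_u=\frac{2n}{n-2}$, there is $M>0$ such that $s\mapsto g(y,s;l_u)$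 is monotone on $(-\infty,-M)$ for every $y>0$; (d) there are $D,\delta_u>0$ with $\partial_y g(y,s;l_u)\le D\,y^{\delta_u}$ for $0<y<1$, $s\le0$, wherever the derivative exists. * $\boldsymbol{Fs}$: there are $\ell\ge0$, $\delta>0$, $C>0$, $\varepsilon>0$ with $|f(u,r)-f(u+h,r)|\le C\,h\,(u+h)^{\delta}r^{\ell}$ for $r\ge1$, $0\le u\le1$, $0\le h\le\varepsilon$; if $\ell=0$, moreover $f(\cdot,r)$ is Lipschitz on every $[0,M]$, uniformly in $r\ge1$. Fix $0\le\nu<m(l_u)$ and let $w(x)=|x|^\nu$ for $|x|\le1$, $w(x)=|x|^{\ell/\delta}$ for $|x|\ge1$. Let $\phi\ge0$ be continuous on $\mathbb R^n\setminus\{0\}$ with $\phi w$ bounded. With $e^{t\Delta}$ the heat semigroup, put $$F_\phi(u)(x,t)=e^{t\Delta}\phi(x)+\int_0^t e^{(t-s)\Delta}f(u(\cdot,s),|\cdot|)(x)\,ds .$$ For $0<T\le\infty$, a $C_S$-mild solution (upper solution, lower solution) of $u_t=\Delta u+f(u,|x|)$, $u(\cdot,0)=\phi$, on $(\mathbb R^n\setminus\{0\})\times[0,T)$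 is a function $u\ge0$ such that, for every $0<T'<T$, $u$ is continuous and $uw$ is bounded on $(\mathbb R^n\setminus\{0\})\times[0,T']$, and such that $u=F_\phi(u)$ (respectively $u\ge F_\phi(u)$, $u\le F_\phi(u)$) on $(\mathbb R^n\setminus\{0\})\times[0,T)$. $\phi$ is a continuous weak (c.w.) upper solution (lower solution, solution) of $\Delta\phi+f(\phi,|x|)=0$ if $\int_{\mathbb R^n}(\phi\,\Delta\eta+f(\phi,|x|)\,\eta)\,dx\le0$ (respectively $\ge0$, $=0$) for all $0\le\eta\in C^2_c(\mathbb R^n\setminus\{0\})$. **Theorem 3.8.** There are $T_\phi\in(0,\infty]$ and a $C_S$-mild solution $u$ on $(\mathbb R^n\setminus\{0\})\times[0,T_\phi)$ such that every $C_S$-mild solution $v$ with datum $\phi$, on some $(\mathbb R^n\setminus\{0\})\times[0,T)$, satisfies $T\le T_\phi$ and $v=u$ for $t<T$. Moreover, for all $x\neq0$: * **(i)** If $\bar u$ and $\underline u$ are $C_S$-mild upper and lower solutions with datum $\phi$ on $(\mathbb R^n\setminus\{0\})\times[0,T)$, then $T_\phi\ge T$ and $\underline u\le u\le\bar u$ (in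 particular $\bar u\ge\underline u$) on $(\mathbb R^n\setminus\{0\})\times[0,T)$. * **(ii)** If $\phi$ is a c.w. upper (lower) solution of $\Delta\phi+f(\phi,|x|)=0$, then $t\mapsto u(x,t)$ is nonincreasing (nondecreasing) on $[0,T_\phi)$. * **(iii)** If $\phi$ is radial, then $u(\cdot,t)$ is radial for every $t\in[0,T_\phi)$. * **(iv)** If $\phi$ is a c.w. upper (lower) solution but not a c.w. solution of $\Delta\phi+f(\phi,|x|)=0$, then $u_t(x,t)$ exists and $u_t(x,t)<0$ ($>0$) for all $t\in(0,T_\phi)$. -/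

import Mathlib

open Filter Topology MeasureTheory Set

noncomputable section

/-- The Fowler exponent `m(l) = 2 / (l - 2)`; it is only used for `l > 2`. -/
def fowlerM (l : ℝ) : ℝ := 2 / (l - 2)

/-- The Fowler transform of the nonlinearity `f = f(u, r)`:
`g(y, s; l) = f(y e^{-m(l) s}, e^s) e^{(m(l) + 2) s}`, where `s = log r`. -/
def fowlerG (f : ℝ → ℝ → ℝ) (l y s : ℝ) : ℝ :=
  f (y * Real.exp (-(fowlerM l * s))) (Real.exp s) * Real.exp ((fowlerM l + 2) * s)

/-- The standing assumption `F0` on `f = f(u, r)`, a function of `u ≥ 0` and `r > 0`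
(values of `f` outside this range play no role anywhere). -/
structure HypF0 (f : ℝ → ℝ → ℝ) : Prop where
  locLip : LocallyLipschitzOn (Ici (0 : ℝ) ×ˢ Ioi (0 : ℝ)) (fun p : ℝ × ℝ => f p.1 p.2)
  zero : ∀ r > 0, f 0 r = 0
  pos : ∀ u > 0, ∀ r > 0, 0 < f u r
  mono : ∀ r > 0, MonotoneOn (fun u => f u r) (Ici 0)
  bound : ∀ u ≥ 0, ∃ C > 0, ∀ r ∈ Ioc (0 : ℝ) 1, f u r * r ^ 2 ≤ C

/-- The assumption `G0` on an autonomous (`s`-independent) function `g = g(y)`, `y > 0`. -/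
structure HypG0 (g : ℝ → ℝ) : Prop where
  diff : ∀ y > 0, DifferentiableAt ℝ g y
  deriv_strictMono : StrictMonoOn (deriv g) (Ioi 0)
  lim_zero : Tendsto (fun y => g y / y) (𝓝[>] 0) (𝓝 0)
  lim_top : Tendsto (fun y => g y / y) atTop atTop

/-- The assumption `Gu` in dimension `n`, with parameter `lu > 2_* = 2 (n - 1) / (n - 2)`.
Since `f` is only locally Lipschitz, `s ↦ g(y, s; lu)` is differentiable almost everywhere, and
the limit of its derivative is taken along the points of differentiability. -/
structure HypGu (n : ℕ) (f : ℝ → ℝ → ℝ) (lu : ℝ) : Prop where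
  lu_gt : 2 * ((n : ℝ) - 1) / ((n : ℝ) - 2) < lu
  limit : ∃ gInf : ℝ → ℝ,
    (∀ K : Set ℝ, IsCompact K → K ⊆ Ioi 0 →
      TendstoUniformlyOn (fun s y => fowlerG f lu y s) gInf atBot K) ∧
    LocallyLipschitzOn (Ioi 0) gInf ∧ (∃ y > 0, gInf y ≠ 0) ∧ HypG0 gInf
  deriv_limit : ∃ ϖ > 0, ∀ y > 0,
    Tendsto (fun s => Real.exp (-(ϖ * s)) * deriv (fun σ => fowlerG f lu y σ) s)
      (atBot ⊓ 𝓟 {s | DifferentiableAt ℝ (fun σ => fowlerG f lu y σ) s}) (𝓝 0)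
  critical : lu = 2 * (n : ℝ) / ((n : ℝ) - 2) → ∃ M > 0, ∀ y > 0,
    MonotoneOn (fun s => fowlerG f lu y s) (Iio (-M)) ∨
      AntitoneOn (fun s => fowlerG f lu y s) (Iio (-M))

/-- The assumption `Fu`: `Gu` holds and `∂g/∂y (y, s; lu) ≤ D y ^ δ` for `0 ≤ y ≤ 1` and `s ≤ 0`
(that is `0 < r ≤ 1`), at every point where this derivative exists; it exists for almost
every `y`, because `f` is locally Lipschitz. -/
structure HypFu (n : ℕ) (f : ℝ → ℝ → ℝ) (lu : ℝ) : Prop where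
  gu : HypGu n f lu
  bound : ∃ D > 0, ∃ δ > 0, ∀ y ∈ Ioo (0 : ℝ) 1, ∀ s ≤ 0, ∀ d : ℝ,
    HasDerivAt (fun η => fowlerG f lu η s) d y → d ≤ D * y ^ δ

/-- The assumption `Fs` with parameters `ℓ ≥ 0`, `δ > 0`. -/
structure HypFs (f : ℝ → ℝ → ℝ) (ℓ δ : ℝ) : Prop where
  ell_nonneg : 0 ≤ ℓ
  delta_pos : 0 < δ
  bound : ∃ C > 0, ∃ ε > 0, ∀ r ≥ 1, ∀ u ∈ Icc (0 : ℝ) 1, ∀ h ∈ Icc (0 : ℝ) ε,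
    |f u r - f (u + h) r| ≤ C * h * (u + h) ^ δ * r ^ ℓ
  /-- If `ℓ = 0` the weight does not decay at infinity and values `u > 1` occur there. -/
  bound_zero : ℓ = 0 → ∀ M > 0, ∃ C > 0, ∀ r ≥ 1, ∀ u ∈ Icc 0 M, ∀ v ∈ Icc 0 M,
    |f u r - f v r| ≤ C * |u - v|

variable {n : ℕ}

/-- The weight `w(x) = |x|^ν` for `|x| ≤ 1` and `w(x) = |x|^(ℓ/δ)` for `|x| ≥ 1`. -/
def weight (ν ℓ δ : ℝ) (x : EuclideanSpace ℝ (Fin n)) : ℝ :=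
  if ‖x‖ ≤ 1 then ‖x‖ ^ ν else ‖x‖ ^ (ℓ / δ)

/-- `φ ≥ 0` belongs to `C_S(ℝⁿ) = C(ℝⁿ \ {0}) ∩ L^∞_w(ℝⁿ)`. For functions continuous
outside the origin the essential supremum of `|φ| w` is its supremum outside the origin. -/
structure InCS (w φ : EuclideanSpace ℝ (Fin n) → ℝ) : Prop where
  cont : ContinuousOn φ {0}ᶜ
  nonneg : ∀ x ≠ 0, 0 ≤ φ x
  bdd : ∃ B : ℝ, ∀ x ≠ 0, |φ x| * w x ≤ B

/-- `u ≥ 0` is defined on `(ℝⁿ \ {0}) × [0, T)` and belongs to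
`C_S(ℝⁿ × [0, T']) = C((ℝⁿ \ {0}) × [0, T']) ∩ L^∞([0, T'], L^∞_w(ℝⁿ))` for all `0 < T' < T`. -/
structure InCSTime (w : EuclideanSpace ℝ (Fin n) → ℝ) (T : EReal)
    (u : EuclideanSpace ℝ (Fin n) → ℝ → ℝ) : Prop where
  cont : ∀ T' : ℝ, 0 < T' → (T' : EReal) < T →
    ContinuousOn (fun p : EuclideanSpace ℝ (Fin n) × ℝ => u p.1 p.2) ({0}ᶜ ×ˢ Icc 0 T')
  nonneg : ∀ x ≠ 0, ∀ t : ℝ, 0 ≤ t → (t : EReal) < T → 0 ≤ u x t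
  bdd : ∀ T' : ℝ, 0 < T' → (T' : EReal) < T →
    ∃ B : ℝ, ∀ x ≠ 0, ∀ t ∈ Icc 0 T', |u x t| * w x ≤ B

/-- The heat semigroup `e^{tΔ} ψ`, with `e^{0Δ} ψ = ψ`. -/
def heatSemigroup (t : ℝ) (ψ : EuclideanSpace ℝ (Fin n) → ℝ) (x : EuclideanSpace ℝ (Fin n)) : ℝ :=
  if 0 < t then
    (4 * Real.pi * t) ^ (-((n : ℝ) / 2)) * ∫ y, Real.exp (-(‖x - y‖ ^ 2 / (4 * t))) * ψ y
  else ψ x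

/-- The Duhamel operator
`F_φ(u)(x, t) = e^{tΔ} φ (x) + ∫_0^t e^{(t - s)Δ} f(u(·, s), |·|) (x) ds`. -/
def duhamel (f : ℝ → ℝ → ℝ) (φ : EuclideanSpace ℝ (Fin n) → ℝ)
    (u : EuclideanSpace ℝ (Fin n) → ℝ → ℝ) (x : EuclideanSpace ℝ (Fin n)) (t : ℝ) : ℝ :=
  heatSemigroup t φ x + ∫ s in (0 : ℝ)..t, heatSemigroup (t - s) (fun y => f (u y s) ‖y‖) x

/-- `u` is a (nonnegative) `C_S`-mild solution on `(ℝⁿ \ {0}) × [0, T)` with datum `φ`. -/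
structure IsMildSolution (f : ℝ → ℝ → ℝ) (w φ : EuclideanSpace ℝ (Fin n) → ℝ) (T : EReal)
    (u : EuclideanSpace ℝ (Fin n) → ℝ → ℝ) : Prop where
  mem : InCSTime w T u
  eq : ∀ x ≠ 0, ∀ t : ℝ, 0 ≤ t → (t : EReal) < T → u x t = duhamel f φ u x t

/-- `u` is a (nonnegative) `C_S`-mild upper solution: `u ≥ F_φ(u)`. -/
structure IsMildUpper (f : ℝ → ℝ → ℝ) (w φ : EuclideanSpace ℝ (Fin n) → ℝ) (T : EReal)
    (u : EuclideanSpace ℝ (Fin n) → ℝ → ℝ) : Prop where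
  mem : InCSTime w T u
  ge : ∀ x ≠ 0, ∀ t : ℝ, 0 ≤ t → (t : EReal) < T → duhamel f φ u x t ≤ u x t

/-- `u` is a (nonnegative) `C_S`-mild lower solution: `u ≤ F_φ(u)`. -/
structure IsMildLower (f : ℝ → ℝ → ℝ) (w φ : EuclideanSpace ℝ (Fin n) → ℝ) (T : EReal)
    (u : EuclideanSpace ℝ (Fin n) → ℝ → ℝ) : Prop where
  mem : InCSTime w T u
  le : ∀ x ≠ 0, ∀ t : ℝ, 0 ≤ t → (t : EReal) < T → u x t ≤ duhamel f φ u x t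

/-- `u`, on `(ℝⁿ \ {0}) × [0, Tφ)`, is the unique `C_S`-mild solution with datum `φ` and `Tφ` is
its maximal existence time: every other `C_S`-mild solution lives on a shorter time interval and
is the restriction of `u`. -/
structure IsUniqueMaximalSolution (f : ℝ → ℝ → ℝ) (w φ : EuclideanSpace ℝ (Fin n) → ℝ)
    (Tφ : EReal) (u : EuclideanSpace ℝ (Fin n) → ℝ → ℝ) : Prop where
  pos : 0 < Tφ
  sol : IsMildSolution f w φ Tφ u
  unique : ∀ (T : EReal) (v : EuclideanSpace ℝ (Fin n) → ℝ → ℝ), IsMildSolution f w φ T v →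
    T ≤ Tφ ∧ ∀ x ≠ 0, ∀ t : ℝ, 0 ≤ t → (t : EReal) < T → v x t = u x t

/-- Nonnegative `C²` test functions with compact support in `ℝⁿ \ {0}`. -/
structure IsTest (η : EuclideanSpace ℝ (Fin n) → ℝ) : Prop where
  smooth : ContDiff ℝ 2 η
  compact : HasCompactSupport η
  zero_notMem : (0 : EuclideanSpace ℝ (Fin n)) ∉ tsupport η
  nonneg : ∀ x, 0 ≤ η x

/-- The pairing `∫ (φ Δη + f(φ, |x|) η) dx` of `Δφ + f(φ, |x|)` with a test function `η`. -/
def ellipticPairing (f : ℝ → ℝ → ℝ) (φ η : EuclideanSpace ℝ (Fin n) → ℝ) : ℝ :=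
  ∫ x, (φ x * Laplacian.laplacian η x + f (φ x) ‖x‖ * η x)

/-- `φ` is a continuous weak upper solution of `Δφ + f(φ, |x|) = 0` in `ℝⁿ \ {0}`. -/
def IsWeakUpper (f : ℝ → ℝ → ℝ) (φ : EuclideanSpace ℝ (Fin n) → ℝ) : Prop :=
  ContinuousOn φ {0}ᶜ ∧ ∀ η, IsTest η → ellipticPairing f φ η ≤ 0

/-- `φ` is a continuous weak lower solution of `Δφ + f(φ, |x|) = 0` in `ℝⁿ \ {0}`. -/
def IsWeakLower (f : ℝ → ℝ → ℝ) (φ : EuclideanSpace ℝ (Fin n) → ℝ) : Prop :=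
  ContinuousOn φ {0}ᶜ ∧ ∀ η, IsTest η → 0 ≤ ellipticPairing f φ η

/-- `φ` is a continuous weak solution of `Δφ + f(φ, |x|) = 0` in `ℝⁿ \ {0}`. -/
def IsWeakSol (f : ℝ → ℝ → ℝ) (φ : EuclideanSpace ℝ (Fin n) → ℝ) : Prop :=
  ContinuousOn φ {0}ᶜ ∧ ∀ η, IsTest η → ellipticPairing f φ η = 0

end

/-! The weight `w` is replaced by the comparable reciprocal profile `P(r) = r^(-ν) (1 + r)^(ν - k)`,
`k = ℓ/δ`. On `0 ≤ u ≤ v ≤ B P` the hypotheses give `f(v, r) - f(u, r) ≤ K (1 + r^(θ-2)) (v - u)`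
with `0 < θ ≤ 1` (`exists_lipschitz_profile`). Near the origin the gain `r^θ` over the critical
power `r^(-2)` comes from `ν < m(lu)`; at infinity the decay `r^(-ℓ/δ)` exactly compensates the
growth of `f`.

The condition `lu > 2(n-1)/(n-2)` means `m(lu) + 2 < n`, so `r^(-2) P` is locally integrable.
Gaussian estimates then show that, for bounded `τ`, `e^{τΔ}` sends `(1 + r^(θ-2)) P` below `C
τ^(θ/2-1) P` (`Admissible.exists_integral_heatKernel_profile_le`, `HeatConst`). This time
singularity is integrable, so the Duhamel operator is well behaved on functions bounded by multiples
of `P`.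

Comparison (`ProfBddOn.comparison`) is a contraction argument in the norm weighted by `e^{λt}`.
Since `f` is nondecreasing in `u`, a one-sided bound on `u - v` is enough. Under an upper solution
the iteration `u_{j+1} = F_φ(u_j)` from `u_0 = 0` increases to a solution
(`iSup_duhamelIterate_spec`), and a large multiple of `P` is an upper solution for a short time.
Uniqueness glues all solutions into the maximal one, and invariance under reflections gives radial
symmetry.

For monotonicity in time, the weak inequality for `φ` is tested with the heat kernel, cut off at the
origin and at infinity on a logarithmic scale, so that the cutoff error vanishes
(`tendsto_ellipticPairing_heatKernel`). This determines the sign of the increments of `e^{tΔ}φ +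
∫_0^t e^{rΔ} f(φ) dr`, and comparing `u` with its time translates gives `u(t+h) ≤ u(t) + increment`
for upper solutions, with the reverse inequality for lower ones (`ProfBddOn.le_add_heatIncrement`,
`ProfBddOn.add_heatIncrement_le`). If `φ` is not a weak solution, some test function detects
strictness. A multiple of the positive heat kernel dominates it, so the increment has size at least
`c h` at every point (`exists_mul_parabolicRate_le_neg`). Differentiability in time holds because
the source is Hölder continuous in time (`SourceBdd.differentiableAt_duhamelIntegral`), and the
derivative inherits the strict sign. -/

noncomputable section

/-! ### Weights, profiles and the one-sided Lipschitz estimate -/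

/-- A Lipschitz function whose derivative, where it exists, is at most `c` grows at most with
speed `c`. -/
lemma sub_le_of_lipschitzOnWith_of_hasDerivAt_le {g : ℝ → ℝ} {a b c : ℝ} {K : NNReal}
    (hab : a ≤ b) (hc : 0 ≤ c) (hg : LipschitzOnWith K g (Icc a b))
    (hd : ∀ y ∈ Ioo a b, ∀ d, HasDerivAt g d y → d ≤ c) : g b - g a ≤ c * (b - a) := by
  have hac : AbsolutelyContinuousOnInterval g a b :=
    LipschitzOnWith.absolutelyContinuousOnInterval (K := K) (by rwa [uIcc_of_le hab])
  rw [← hac.integral_deriv_eq_sub]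
  have h1 : ∫ x in a..b, deriv g x ≤ ∫ _x in a..b, c := by
    refine intervalIntegral.integral_mono_on_of_le_Ioo hab hac.intervalIntegrable_deriv
      intervalIntegrable_const fun x hx => ?_
    by_cases hx' : DifferentiableAt ℝ g x
    · exact hd x hx _ hx'.hasDerivAt
    -- At the other points `deriv` takes the default value `0`; this is where `0 ≤ c` enters.
    · rw [deriv_zero_of_not_differentiableAt hx']
      exact hc
  refine h1.trans (le_of_eq ?_)
  simp [mul_comm]

/-- The profile `r^(-ν) (1 + r)^(ν - k)`, which is comparable with the reciprocal of the weight. -/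
def profile (ν k r : ℝ) : ℝ := r ^ (-ν) * (1 + r) ^ (ν - k)

lemma profile_pos {ν k r : ℝ} (hr : 0 < r) : 0 < profile ν k r := by
  unfold profile; positivity

lemma rpow_mem_of_mem_Icc {t b : ℝ} (h1 : 1 ≤ t) (h2 : t ≤ 2) :
    (2 : ℝ) ^ (-|b|) ≤ t ^ b ∧ t ^ b ≤ 2 ^ |b| := by
  have h0 : 0 < t := by linarith
  constructor
  · calc (2 : ℝ) ^ (-|b|) ≤ t ^ (-|b|) :=
          Real.rpow_le_rpow_of_nonpos h0 h2 (by simp)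
      _ ≤ t ^ b := Real.rpow_le_rpow_of_exponent_le h1 (neg_abs_le b)
  · calc t ^ b ≤ t ^ |b| := Real.rpow_le_rpow_of_exponent_le h1 (le_abs_self b)
      _ ≤ 2 ^ |b| := Real.rpow_le_rpow h0.le h2 (abs_nonneg b)

lemma profile_le_near {ν k r : ℝ} (hr : 0 < r) (hr1 : r ≤ 1) :
    profile ν k r ≤ 2 ^ |ν - k| * r ^ (-ν) := by
  unfold profile
  rw [mul_comm]
  gcongr
  exact (rpow_mem_of_mem_Icc (by linarith) (by linarith)).2

/-- This form exhibits the decay `r^(-k)`: for `r ≥ 1` the base `(1 + r) / r` lies in `[1, 2]`. -/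
lemma profile_eq_far {ν k r : ℝ} (hr : 0 < r) :
    profile ν k r = ((1 + r) / r) ^ (ν - k) * r ^ (-k) := by
  unfold profile
  rw [Real.div_rpow (by positivity) hr.le, div_mul_eq_mul_div, eq_div_iff (by positivity),
    mul_right_comm, ← Real.rpow_add hr, mul_comm]
  ring_nf

lemma profile_le_far {ν k r : ℝ} (hr1 : 1 ≤ r) :
    profile ν k r ≤ 2 ^ |ν - k| * r ^ (-k) := by
  have hr : 0 < r := by linarith
  rw [profile_eq_far hr]
  gcongr
  refine (rpow_mem_of_mem_Icc ?_ ?_).2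
  · rw [le_div_iff₀ hr]; linarith
  · rw [div_le_iff₀ hr]; linarith

/-- On each side of `|x| = 1` the product is a power of a number in `[1, 2]`, namely of `1 + |x|`
inside and of `(1 + |x|) / |x|` outside. -/
lemma weight_mul_profile {n : ℕ} (ν ℓ δ : ℝ) (x : EuclideanSpace ℝ (Fin n)) (hx : x ≠ 0) :
    2 ^ (-|ν - ℓ / δ|) ≤ weight ν ℓ δ x * profile ν (ℓ / δ) ‖x‖ ∧
      weight ν ℓ δ x * profile ν (ℓ / δ) ‖x‖ ≤ 2 ^ |ν - ℓ / δ| := by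
  have hr : 0 < ‖x‖ := norm_pos_iff.2 hx
  unfold weight
  split_ifs with h
  · have : ‖x‖ ^ ν * profile ν (ℓ / δ) ‖x‖ = (1 + ‖x‖) ^ (ν - ℓ / δ) := by
      unfold profile
      rw [← mul_assoc, ← Real.rpow_add hr]; simp
    rw [this]
    exact rpow_mem_of_mem_Icc (by linarith) (by linarith)
  · push Not at h
    have : ‖x‖ ^ (ℓ / δ) * profile ν (ℓ / δ) ‖x‖ = ((1 + ‖x‖) / ‖x‖) ^ (ν - ℓ / δ) := by
      rw [profile_eq_far hr, mul_left_comm, ← Real.rpow_add hr]; simp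
    rw [this]
    refine rpow_mem_of_mem_Icc ?_ ?_
    · rw [le_div_iff₀ hr]; linarith
    · rw [div_le_iff₀ hr]; linarith

lemma weight_nonneg {n : ℕ} (ν ℓ δ : ℝ) (x : EuclideanSpace ℝ (Fin n)) :
    0 ≤ weight ν ℓ δ x := by
  unfold weight; split_ifs <;> positivity

/-- Bounds against the weight are bounds by multiples of the profile. -/
lemma le_profile_of_mul_weight_le {n : ℕ} {ν ℓ δ B a : ℝ} {x : EuclideanSpace ℝ (Fin n)}
    (hx : x ≠ 0) (h : |a| * weight ν ℓ δ x ≤ B) :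
    |a| ≤ (2 ^ |ν - ℓ / δ| * B) * profile ν (ℓ / δ) ‖x‖ := by
  have hr : 0 < ‖x‖ := norm_pos_iff.2 hx
  have hp := profile_pos (ν := ν) (k := ℓ / δ) hr
  have h1 := (weight_mul_profile ν ℓ δ x hx).1
  have h2 : (0 : ℝ) < 2 ^ |ν - ℓ / δ| := by positivity
  rw [Real.rpow_neg (by norm_num)] at h1
  have h3 : 1 ≤ 2 ^ |ν - ℓ / δ| * (weight ν ℓ δ x * profile ν (ℓ / δ) ‖x‖) := by
    rwa [inv_le_iff_one_le_mul₀' h2] at h1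
  calc |a| = |a| * 1 := (mul_one _).symm
    _ ≤ |a| * (2 ^ |ν - ℓ / δ| * (weight ν ℓ δ x * profile ν (ℓ / δ) ‖x‖)) := by gcongr
    _ = (2 ^ |ν - ℓ / δ| * (|a| * weight ν ℓ δ x)) * profile ν (ℓ / δ) ‖x‖ := by ring
    _ ≤ _ := by gcongr

lemma mul_weight_le_of_le_profile {n : ℕ} {ν ℓ δ B a : ℝ} {x : EuclideanSpace ℝ (Fin n)}
    (hx : x ≠ 0) (hB : 0 ≤ B) (h : |a| ≤ B * profile ν (ℓ / δ) ‖x‖) :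
    |a| * weight ν ℓ δ x ≤ B * 2 ^ |ν - ℓ / δ| := by
  calc |a| * weight ν ℓ δ x ≤ B * profile ν (ℓ / δ) ‖x‖ * weight ν ℓ δ x := by
        gcongr; exact weight_nonneg _ _ _ _
    _ = B * (weight ν ℓ δ x * profile ν (ℓ / δ) ‖x‖) := by ring
    _ ≤ _ := by gcongr; exact (weight_mul_profile ν ℓ δ x hx).2

lemma HypF0.exists_lipschitzOnWith {f : ℝ → ℝ → ℝ} (hf : HypF0 f) {a b M : ℝ} (ha : 0 < a) :
    ∃ K : NNReal, ∀ r ∈ Icc a b, LipschitzOnWith K (fun u => f u r) (Icc 0 M) := by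
  have hc : IsCompact (Icc (0 : ℝ) M ×ˢ Icc a b) := isCompact_Icc.prod isCompact_Icc
  have hl : LocallyLipschitzOn (Icc (0 : ℝ) M ×ˢ Icc a b) (fun p : ℝ × ℝ => f p.1 p.2) :=
    hf.locLip.mono (prod_mono Icc_subset_Ici_self fun r hr => lt_of_lt_of_le ha hr.1)
  obtain ⟨K, hK⟩ := hl.exists_lipschitzOnWith_of_compact hc
  refine ⟨K, fun r hr => LipschitzOnWith.of_dist_le_mul fun u hu v hv => ?_⟩
  have := hK.dist_le_mul (u, r) ⟨hu, hr⟩ (v, r) ⟨hv, hr⟩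
  simpa [Prod.dist_eq] using this

/-- The derivative bound near the singularity in the original variables, with a real exponent. -/
lemma HypFu.deriv_le {n : ℕ} {f : ℝ → ℝ → ℝ} {lu : ℝ} (hFu : HypFu n f lu) :
    ∃ D > 0, ∃ δ : ℝ, 0 < δ ∧ ∀ r ∈ Ioc (0 : ℝ) 1, ∀ u > 0, u * r ^ fowlerM lu < 1 →
      ∀ d, HasDerivAt (fun v => f v r) d u → d ≤ D * (u * r ^ fowlerM lu) ^ δ * r ^ (-2 : ℝ) := by
  obtain ⟨D, hD, δ, hδ, h⟩ := hFu.bound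
  refine ⟨D, hD, δ, by exact_mod_cast hδ, fun r hr u hu hur d hd => ?_⟩
  set m := fowlerM lu
  have hr0 : 0 < r := hr.1
  -- With `s = log r` and `y = u r^m` the chain rule gives `∂_y g = r^(-m) r^(m+2) ∂_u f = r² ∂_u
  -- f`.
  have key := h (u * r ^ m) ⟨by positivity, hur⟩ (Real.log r) (Real.log_nonpos hr.1.le hr.2)
    (d * r ^ (2 : ℝ)) ?_
  · rw [Real.rpow_neg hr0.le, ← div_eq_mul_inv, le_div_iff₀ (by positivity)]
    exact_mod_cast key
  · have e1 : Real.exp (-(m * Real.log r)) = r ^ (-m) := by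
      rw [Real.rpow_def_of_pos hr0]; ring_nf
    have e2 : Real.exp ((m + 2) * Real.log r) = r ^ (m + 2) := by
      rw [Real.rpow_def_of_pos hr0]; ring_nf
    simp only [fowlerG]
    change HasDerivAt (fun η => f (η * Real.exp (-(m * Real.log r))) (Real.exp (Real.log r)) *
      Real.exp ((m + 2) * Real.log r)) _ _
    rw [e1, e2, Real.exp_log hr0]
    have hu' : u * r ^ m * r ^ (-m) = u := by
      rw [mul_assoc, ← Real.rpow_add hr0]; simp
    have h1 : HasDerivAt (fun η : ℝ => η * r ^ (-m)) (r ^ (-m)) (u * r ^ m) := by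
      simpa using (hasDerivAt_id (u * r ^ m)).mul_const (r ^ (-m))
    have hd' : HasDerivAt (fun v => f v r) d ((fun η : ℝ => η * r ^ (-m)) (u * r ^ m)) := by
      simpa only [hu'] using hd
    have h2 := (HasDerivAt.comp (u * r ^ m) hd' h1).mul_const (r ^ (m + 2))
    refine h2.congr_deriv ?_
    rw [mul_assoc, ← Real.rpow_add hr0]
    ring_nf

/-- If `u ≤ B r^(-ν)` then `u r^m ≤ B r^(m-ν)`, which is below `1` for small `r`, so the derivative
bound applies and gives `∂_u f ≤ D B^δ r^((m-ν)δ-2)`. Hence `θ = min ((m-ν)δ) 1`, independent of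
`B`. -/
lemma exists_lipschitz_near {n : ℕ} {f : ℝ → ℝ → ℝ} {lu ν : ℝ} (hF0 : HypF0 f)
    (hFu : HypFu n f lu) (hν : ν < fowlerM lu) :
    ∃ θ ∈ Ioc (0 : ℝ) 1, ∀ B > 0, ∃ r₀ ∈ Ioc (0 : ℝ) 1, ∃ K > 0, ∀ r ∈ Ioc 0 r₀, ∀ u v, 0 ≤ u →
      u ≤ v → v ≤ B * r ^ (-ν) → f v r - f u r ≤ K * r ^ (θ - 2) * (v - u) := by
  obtain ⟨D, hD, δ, hδ, h⟩ := hFu.deriv_le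
  set m := fowlerM lu
  have hmν : 0 < m - ν := by linarith
  refine ⟨min ((m - ν) * δ) 1, ⟨by positivity, min_le_right _ _⟩, fun B hB => ?_⟩
  set θ := min ((m - ν) * δ) 1
  have hlim : Tendsto (fun r : ℝ => B * r ^ (m - ν)) (𝓝[>] 0) (𝓝 0) := by
    have : Tendsto (fun r : ℝ => B * r ^ (m - ν)) (𝓝 0) (𝓝 (B * 0 ^ (m - ν))) :=
      ((Real.continuousAt_rpow_const 0 (m - ν) (Or.inr hmν.le)).tendsto).const_mul B
    rw [Real.zero_rpow hmν.ne', mul_zero] at this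
    exact this.mono_left nhdsWithin_le_nhds
  have hev : ∀ᶠ r in 𝓝[>] (0 : ℝ), B * r ^ (m - ν) < 1 := hlim.eventually (gt_mem_nhds one_pos)
  obtain ⟨r₁, hr₁, hr₁'⟩ := mem_nhdsGT_iff_exists_Ioc_subset.1 hev
  refine ⟨min r₁ 1, ⟨lt_min hr₁ one_pos, min_le_right _ _⟩, D * B ^ δ, by positivity,
    fun r hr u v hu huv hv => ?_⟩
  have hr0 : 0 < r := hr.1
  have hr1 : r ≤ 1 := hr.2.trans (min_le_right _ _)
  have hlt : B * r ^ (m - ν) < 1 := hr₁' ⟨hr.1, hr.2.trans (min_le_left _ _)⟩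
  obtain ⟨K, hK⟩ := hF0.exists_lipschitzOnWith (a := r) (b := r) (M := v) hr0
  refine sub_le_of_lipschitzOnWith_of_hasDerivAt_le huv (by positivity)
    ((hK r ⟨le_rfl, le_rfl⟩).mono (Icc_subset_Icc_left hu)) fun y hy d hd => ?_
  have hy0 : 0 < y := lt_of_le_of_lt hu hy.1
  have hyB : y * r ^ m ≤ B * r ^ (m - ν) := by
    calc y * r ^ m ≤ B * r ^ (-ν) * r ^ m := by gcongr; exact hy.2.le.trans hv
      _ = B * r ^ (m - ν) := by rw [mul_assoc, ← Real.rpow_add hr0]; ring_nf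
  calc d ≤ D * (y * r ^ m) ^ δ * r ^ (-2 : ℝ) := h r ⟨hr0, hr1⟩ y hy0 (hyB.trans_lt hlt) d hd
    _ ≤ D * (B * r ^ (m - ν)) ^ δ * r ^ (-2 : ℝ) := by gcongr
    _ = D * B ^ δ * r ^ ((m - ν) * δ - 2) := by
      rw [Real.mul_rpow hB.le (by positivity), ← Real.rpow_mul hr0.le, sub_eq_add_neg _ (2 : ℝ),
        Real.rpow_add hr0]
      ring
    _ ≤ D * B ^ δ * r ^ (θ - 2) := by
      gcongr ?_ * ?_
      exact Real.rpow_le_rpow_of_exponent_ge hr0 hr1 (by linarith [min_le_left ((m - ν) * δ) 1])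

/-- The local Lipschitz constant is `C v^δ r^ℓ`, and `v ≤ B r^(-ℓ/δ)` turns it into `C B^δ`. If `ℓ >
0`, this decay also brings `v` into the range allowed by `HypFs.bound` for large `r`; if `ℓ = 0`
there is no decay and `HypFs.bound_zero` takes over. -/
lemma HypFs.exists_lipschitz_far {f : ℝ → ℝ → ℝ} {ℓ δ : ℝ} (hFs : HypFs f ℓ δ) {B : ℝ}
    (hB : 0 < B) :
    ∃ R ≥ 1, ∃ K > 0, ∀ r ≥ R, ∀ u v, 0 ≤ u → u ≤ v → v ≤ B * r ^ (-(ℓ / δ)) →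
      f v r - f u r ≤ K * (v - u) := by
  have hδ := hFs.delta_pos
  rcases hFs.ell_nonneg.eq_or_lt with h0 | hpos
  · obtain ⟨C, hC, h⟩ := hFs.bound_zero h0.symm B hB
    refine ⟨1, le_rfl, C, hC, fun r hr u v hu huv hv => ?_⟩
    rw [← h0] at hv
    simp only [zero_div, neg_zero, Real.rpow_zero, mul_one] at hv
    have := h r hr v ⟨hu.trans huv, hv⟩ u ⟨hu, huv.trans hv⟩
    rw [abs_of_nonneg (sub_nonneg.2 huv)] at this
    exact (le_abs_self _).trans this
  · obtain ⟨C, hC, ε, hε, h⟩ := hFs.bound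
    have hk : 0 < ℓ / δ := by positivity
    have hlim : Tendsto (fun r : ℝ => B * r ^ (-(ℓ / δ))) atTop (𝓝 0) := by
      simpa using (tendsto_rpow_neg_atTop hk).const_mul B
    have hev := hlim.eventually (gt_mem_nhds (lt_min one_pos hε))
    obtain ⟨R, hR⟩ := eventually_atTop.1 hev
    refine ⟨max R 1, le_max_right _ _, C * B ^ δ, by positivity, fun r hr u v hu huv hv => ?_⟩
    have hr1 : 1 ≤ r := (le_max_right _ _).trans hr
    have hr0 : 0 < r := by linarith
    have hlt := lt_min_iff.1 (hR r ((le_max_left _ _).trans hr))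
    have := h r hr1 u ⟨hu, by linarith⟩ (v - u) ⟨by linarith, by linarith⟩
    rw [add_sub_cancel, abs_sub_comm] at this
    have hv0 : 0 ≤ v := hu.trans huv
    calc f v r - f u r ≤ C * (v - u) * v ^ δ * r ^ ℓ := (le_abs_self _).trans this
      _ ≤ C * (v - u) * (B * r ^ (-(ℓ / δ))) ^ δ * r ^ ℓ := by
        have := sub_nonneg.2 huv
        gcongr
      _ = C * (v - u) * B ^ δ * (r ^ (-(ℓ / δ) * δ) * r ^ ℓ) := by
        rw [Real.mul_rpow hB.le (by positivity), ← Real.rpow_mul hr0.le]; ring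
      _ = C * B ^ δ * (v - u) := by
        rw [← Real.rpow_add hr0, neg_mul, div_mul_cancel₀ _ hδ.ne', neg_add_cancel,
          Real.rpow_zero]
        ring

/-- The one-sided Lipschitz estimate for the nonlinearity on bounded sets of the weighted space. -/
theorem exists_lipschitz_profile {n : ℕ} {f : ℝ → ℝ → ℝ} {lu ν ℓ δ : ℝ} (hF0 : HypF0 f)
    (hFu : HypFu n f lu) (hFs : HypFs f ℓ δ) (hν0 : 0 ≤ ν) (hν : ν < fowlerM lu) :
    ∃ θ ∈ Ioc (0 : ℝ) 1, ∀ B > 0, ∃ K > 0, ∀ r > 0, ∀ u v, 0 ≤ u → u ≤ v →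
      v ≤ B * profile ν (ℓ / δ) r → f v r - f u r ≤ K * (1 + r ^ (θ - 2)) * (v - u) := by
  obtain ⟨θ, hθ, hnear⟩ := exists_lipschitz_near hF0 hFu hν
  refine ⟨θ, hθ, fun B hB => ?_⟩
  set d : ℝ := 2 ^ |ν - ℓ / δ|
  have hd : 0 < d := by positivity
  obtain ⟨r₀, hr₀, K₁, hK₁, h₁⟩ := hnear (B * d) (by positivity)
  obtain ⟨R, hR, K₂, hK₂, h₂⟩ := hFs.exists_lipschitz_far (B := B * d) (by positivity)
  -- Intermediate radii form a compact set. As `r₀ ≤ 1` and `ν ≥ 0`, the number `B d r₀^(-ν)` bounds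
  -- `B` times the profile on all of `[r₀, R]`.
  obtain ⟨K₃, h₃⟩ := hF0.exists_lipschitzOnWith (a := r₀) (b := R)
    (M := B * (d * r₀ ^ (-ν))) hr₀.1
  refine ⟨K₁ + K₂ + K₃, by positivity, fun r hr u v hu huv hv => ?_⟩
  have hvu := sub_nonneg.2 huv
  have hrp : 0 < r ^ (θ - 2) := Real.rpow_pos_of_pos hr _
  rcases le_or_gt r r₀ with h | h
  · have hv' : v ≤ B * d * r ^ (-ν) := by
      refine hv.trans ?_
      rw [mul_assoc]
      gcongr
      exact profile_le_near hr (h.trans hr₀.2)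
    refine (h₁ r ⟨hr, h⟩ u v hu huv hv').trans ?_
    gcongr
    · linarith [K₃.coe_nonneg]
    · linarith
  rcases le_or_gt R r with h' | h'
  · have hv' : v ≤ B * d * r ^ (-(ℓ / δ)) := by
      refine hv.trans ?_
      rw [mul_assoc]
      gcongr
      exact profile_le_far (hR.trans h')
    refine (h₂ r h' u v hu huv hv').trans ?_
    gcongr
    nlinarith [K₃.coe_nonneg]
  · have hv' : v ≤ B * (d * r₀ ^ (-ν)) := by
      refine hv.trans ?_
      have hr₀' : (1 : ℝ) ≤ r₀ ^ (-ν) :=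
        Real.one_le_rpow_of_pos_of_le_one_of_nonpos hr₀.1 hr₀.2 (by linarith)
      gcongr
      rcases le_total r 1 with h1 | h1
      · refine (profile_le_near hr h1).trans ?_
        gcongr ?_ * ?_
        exact Real.rpow_le_rpow_of_nonpos hr₀.1 h.le (by linarith)
      · refine (profile_le_far h1).trans ?_
        gcongr ?_ * ?_
        have : 0 ≤ ℓ / δ := div_nonneg hFs.ell_nonneg hFs.delta_pos.le
        exact (Real.rpow_le_one_of_one_le_of_nonpos h1 (by linarith)).trans hr₀'
    have := (h₃ r ⟨h.le, h'.le⟩).dist_le_mul v ⟨hu.trans huv, hv'⟩ u ⟨hu, huv.trans hv'⟩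
    rw [Real.dist_eq, Real.dist_eq, abs_of_nonneg hvu] at this
    refine (le_abs_self _).trans (this.trans ?_)
    gcongr
    nlinarith [K₃.coe_nonneg]

/-! ### Pointwise and integral estimates for the heat kernel -/

/-- The heat kernel `(4πτ)^(-n/2) exp(-|z|² / (4τ))`. -/
def heatKernel {n : ℕ} (τ : ℝ) (z : EuclideanSpace ℝ (Fin n)) : ℝ :=
  (4 * Real.pi * τ) ^ (-((n : ℝ) / 2)) * Real.exp (-(‖z‖ ^ 2 / (4 * τ)))

section Kernel

variable {n : ℕ}

lemma heatSemigroup_of_pos {τ : ℝ} (hτ : 0 < τ) (ψ : EuclideanSpace ℝ (Fin n) → ℝ)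
    (x : EuclideanSpace ℝ (Fin n)) :
    heatSemigroup τ ψ x = ∫ y, heatKernel τ (x - y) * ψ y := by
  rw [heatSemigroup, if_pos hτ, ← integral_const_mul]
  simp only [heatKernel, mul_assoc]

lemma heatSemigroup_zero (ψ : EuclideanSpace ℝ (Fin n) → ℝ) (x : EuclideanSpace ℝ (Fin n)) :
    heatSemigroup 0 ψ x = ψ x := by
  rw [heatSemigroup, if_neg (lt_irrefl _)]

lemma heatKernel_pos {τ : ℝ} (hτ : 0 < τ) (z : EuclideanSpace ℝ (Fin n)) :
    0 < heatKernel τ z := by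
  unfold heatKernel; positivity

lemma heatKernel_nonneg {τ : ℝ} (hτ : 0 < τ) (z : EuclideanSpace ℝ (Fin n)) :
    0 ≤ heatKernel τ z := (heatKernel_pos hτ z).le

lemma heatKernel_le {τ : ℝ} (hτ : 0 < τ) (z : EuclideanSpace ℝ (Fin n)) :
    heatKernel τ z ≤ (4 * Real.pi * τ) ^ (-((n : ℝ) / 2)) := by
  unfold heatKernel
  refine mul_le_of_le_one_right (by positivity) (Real.exp_le_one_iff.2 ?_)
  rw [neg_nonpos]; positivity

@[fun_prop]
lemma continuous_heatKernel (τ : ℝ) :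
    Continuous (heatKernel (n := n) τ) := by
  unfold heatKernel; fun_prop

lemma integral_heatKernel {τ : ℝ} (hτ : 0 < τ) :
    ∫ z : EuclideanSpace ℝ (Fin n), heatKernel τ z = 1 := by
  have h := GaussianFourier.integral_rexp_neg_mul_sq_norm (V := EuclideanSpace ℝ (Fin n))
    (b := 1 / (4 * τ)) (by positivity)
  simp only [finrank_euclideanSpace, Fintype.card_fin] at h
  have h2 : ∀ z : EuclideanSpace ℝ (Fin n), heatKernel τ z =
      (4 * Real.pi * τ) ^ (-((n : ℝ) / 2)) * Real.exp (-(1 / (4 * τ)) * ‖z‖ ^ 2) := by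
    intro z
    unfold heatKernel
    congr 2
    ring
  simp_rw [h2]
  rw [integral_const_mul, h]
  have : Real.pi / (1 / (4 * τ)) = 4 * Real.pi * τ := by field_simp
  rw [this, ← Real.rpow_add (by positivity)]
  simp

lemma integrable_heatKernel {τ : ℝ} (hτ : 0 < τ) :
    Integrable (heatKernel (n := n) τ) := by
  -- A non-integrable function has integral `0` by convention, whereas this integral is `1`.
  by_contra h
  have := integral_heatKernel (n := n) hτ
  rw [integral_undef h] at this
  norm_num at this

lemma integral_heatKernel_sub {τ : ℝ} (hτ : 0 < τ) (x : EuclideanSpace ℝ (Fin n)) :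
    ∫ y, heatKernel τ (x - y) = 1 := by
  rw [integral_sub_left_eq_self (heatKernel τ) volume x, integral_heatKernel hτ]

lemma integrable_heatKernel_sub {τ : ℝ} (hτ : 0 < τ) (x : EuclideanSpace ℝ (Fin n)) :
    Integrable fun y => heatKernel τ (x - y) :=
  (integrable_heatKernel hτ).comp_sub_left x

lemma exists_rpow_le_exp {q : ℝ} (hq : 0 ≤ q) :
    ∃ C > 0, ∀ y : ℝ, 0 ≤ y → y ^ q ≤ C * Real.exp y := by
  refine ⟨1 + (⌈q⌉₊.factorial : ℝ), by positivity, fun y hy => ?_⟩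
  have h1 : y ^ q ≤ 1 + y ^ ⌈q⌉₊ := by
    rcases le_total y 1 with h | h
    · have := Real.rpow_le_one hy h hq
      have : 0 ≤ y ^ ⌈q⌉₊ := by positivity
      linarith
    · have : y ^ q ≤ y ^ (⌈q⌉₊ : ℝ) := Real.rpow_le_rpow_of_exponent_le h (Nat.le_ceil q)
      rw [Real.rpow_natCast] at this
      linarith
  have h2 := Real.pow_div_factorial_le_exp y hy ⌈q⌉₊
  rw [div_le_iff₀ (by positivity)] at h2
  have h3 : 1 ≤ Real.exp y := Real.one_le_exp hy
  nlinarith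

/-- Doubling the time frees half of the Gaussian exponent; the freed factor absorbs powers of `|z| /
√τ`. -/
lemma heatKernel_eq_two_mul {τ : ℝ} (hτ : 0 < τ) (z : EuclideanSpace ℝ (Fin n)) :
    heatKernel τ z =
      2 ^ ((n : ℝ) / 2) * Real.exp (-(‖z‖ ^ 2 / (8 * τ))) * heatKernel (2 * τ) z := by
  unfold heatKernel
  have h1 : 4 * Real.pi * (2 * τ) = 2 * (4 * Real.pi * τ) := by ring
  have h2 : -(‖z‖ ^ 2 / (4 * τ)) = -(‖z‖ ^ 2 / (8 * τ)) + -(‖z‖ ^ 2 / (4 * (2 * τ))) := by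
    field_simp; ring
  rw [h1, h2, Real.exp_add, Real.mul_rpow (x := 2) (by norm_num) (by positivity),
    Real.rpow_neg (x := 2) (by norm_num)]
  field_simp

/-- Powers of the space variable are absorbed by the heat kernel at a later time. -/
lemma exists_norm_rpow_mul_heatKernel_le (n : ℕ) {p : ℝ} (hp : 0 ≤ p) :
    ∃ C > 0, ∀ τ > 0, ∀ z : EuclideanSpace ℝ (Fin n),
      ‖z‖ ^ p * heatKernel τ z ≤ C * τ ^ (p / 2) * heatKernel (2 * τ) z := by
  obtain ⟨C, hC, h⟩ := exists_rpow_le_exp (q := p / 2) (by positivity)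
  refine ⟨C * 8 ^ (p / 2) * 2 ^ ((n : ℝ) / 2), by positivity, fun τ hτ z => ?_⟩
  have hy : 0 ≤ ‖z‖ ^ 2 / (8 * τ) := by positivity
  have h1 := h _ hy
  have h2 : ‖z‖ ^ p = (8 * τ) ^ (p / 2) * (‖z‖ ^ 2 / (8 * τ)) ^ (p / 2) := by
    rw [← Real.mul_rpow (by positivity) hy, mul_div_cancel₀ _ (by positivity),
      ← Real.rpow_natCast, ← Real.rpow_mul (norm_nonneg _)]
    congr 1; push_cast; ring
  rw [h2, heatKernel_eq_two_mul hτ, Real.mul_rpow (by norm_num) hτ.le]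
  have hK := heatKernel_nonneg (n := n) (τ := 2 * τ) (by positivity) z
  calc _ ≤ 8 ^ (p / 2) * τ ^ (p / 2) * (C * Real.exp (‖z‖ ^ 2 / (8 * τ))) *
        (2 ^ ((n : ℝ) / 2) * Real.exp (-(‖z‖ ^ 2 / (8 * τ))) * heatKernel (2 * τ) z) := by
        gcongr
    _ = (Real.exp (‖z‖ ^ 2 / (8 * τ)) * Real.exp (-(‖z‖ ^ 2 / (8 * τ)))) *
        (C * 8 ^ (p / 2) * 2 ^ ((n : ℝ) / 2) * τ ^ (p / 2) * heatKernel (2 * τ) z) := by ring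
    _ = _ := by rw [← Real.exp_add, add_neg_cancel, Real.exp_zero, one_mul]

lemma add_rpow_le_two_rpow {s t p : ℝ} (hs : 0 ≤ s) (ht : 0 ≤ t) (hp : 0 ≤ p) :
    (s + t) ^ p ≤ 2 ^ p * (s ^ p + t ^ p) := by
  have h1 : s + t ≤ 2 * max s t := by
    linarith [le_max_left s t, le_max_right s t]
  have h2 : (max s t) ^ p ≤ s ^ p + t ^ p := by
    rcases max_cases s t with ⟨h, -⟩ | ⟨h, -⟩ <;> rw [h]
    · have : 0 ≤ t ^ p := by positivity
      linarith
    · have : 0 ≤ s ^ p := by positivity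
      linarith
  calc (s + t) ^ p ≤ (2 * max s t) ^ p := by gcongr
    _ = 2 ^ p * (max s t) ^ p := by
      rw [Real.mul_rpow (by norm_num) (le_max_of_le_left hs)]
    _ ≤ _ := by gcongr

lemma exists_one_add_rpow_mul_heatKernel_le (n : ℕ) {p : ℝ} (hp : 0 ≤ p) (T : ℝ) :
    ∃ C > 0, ∀ τ ∈ Ioc 0 T, ∀ z : EuclideanSpace ℝ (Fin n),
      (1 + ‖z‖) ^ p * heatKernel τ z ≤ C * heatKernel (2 * τ) z := by
  obtain ⟨C, hC, h⟩ := exists_norm_rpow_mul_heatKernel_le n hp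
  refine ⟨2 ^ p * (2 ^ ((n : ℝ) / 2) + C * |T| ^ (p / 2)), by positivity, fun τ hτ z => ?_⟩
  have hτ0 : 0 < τ := hτ.1
  have hK := heatKernel_nonneg (n := n) (τ := 2 * τ) (by positivity) z
  have hK' := heatKernel_nonneg (n := n) (τ := τ) (by positivity) z
  have h1 : heatKernel τ z ≤ 2 ^ ((n : ℝ) / 2) * heatKernel (2 * τ) z := by
    rw [heatKernel_eq_two_mul hτ.1]
    gcongr
    refine mul_le_of_le_one_right (by positivity) (Real.exp_le_one_iff.2 ?_)
    rw [neg_nonpos]; positivity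
  calc (1 + ‖z‖) ^ p * heatKernel τ z ≤ 2 ^ p * (1 ^ p + ‖z‖ ^ p) * heatKernel τ z := by
        gcongr; exact add_rpow_le_two_rpow zero_le_one (norm_nonneg _) hp
    _ = 2 ^ p * (heatKernel τ z + ‖z‖ ^ p * heatKernel τ z) := by rw [Real.one_rpow]; ring
    _ ≤ 2 ^ p * (2 ^ ((n : ℝ) / 2) * heatKernel (2 * τ) z +
        C * |T| ^ (p / 2) * heatKernel (2 * τ) z) := by
        gcongr _ * (?_ + ?_)
        refine (h τ hτ.1 z).trans ?_
        gcongr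
        exact hτ.2.trans (le_abs_self T)
    _ = _ := by ring

lemma integrableOn_ball_norm_rpow [NeZero n] {a : ℝ} (ha : a < n) (R : ℝ) :
    IntegrableOn (fun y : EuclideanSpace ℝ (Fin n) => ‖y‖ ^ (-a)) (Metric.ball 0 R) := by
  have : Nontrivial (EuclideanSpace ℝ (Fin n)) :=
    Module.nontrivial_of_finrank_pos (R := ℝ) (by simpa using Nat.pos_of_ne_zero (NeZero.ne n))
  rw [integrableOn_fun_norm_addHaar volume (f := fun r : ℝ => r ^ (-a))]
  simp only [finrank_euclideanSpace, Fintype.card_fin, smul_eq_mul]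
  have hn : 1 ≤ n := NeZero.one_le
  rcases le_or_gt R 0 with hR | hR
  · rw [Ioo_eq_empty (by simpa using hR)]; exact integrableOn_empty
  have h : IntegrableOn (fun r : ℝ => r ^ ((n : ℝ) - 1 - a)) (Ioo 0 R) := by
    have := intervalIntegral.intervalIntegrable_rpow' (a := 0) (b := R)
      (r := (n : ℝ) - 1 - a) (by linarith)
    rw [intervalIntegrable_iff_integrableOn_Ioo_of_le hR.le] at this
    exact this
  refine h.congr_fun (fun r hr => ?_) measurableSet_Ioo
  simp only
  rw [← Real.rpow_natCast, ← Real.rpow_add hr.1]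
  congr 1
  push_cast [Nat.cast_sub hn]
  ring

lemma setIntegral_ball_norm_rpow {a R : ℝ} (hR : 0 < R) :
    ∫ y in Metric.ball (0 : EuclideanSpace ℝ (Fin n)) R, ‖y‖ ^ (-a) =
      R ^ ((n : ℝ) - a) * ∫ y in Metric.ball (0 : EuclideanSpace ℝ (Fin n)) 1, ‖y‖ ^ (-a) := by
  have h := Measure.setIntegral_comp_smul_of_pos (E := EuclideanSpace ℝ (Fin n)) volume
    (fun y => ‖y‖ ^ (-a)) (Metric.ball 0 1) hR
  rw [smul_unitBall_of_pos hR] at h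
  simp only [norm_smul, Real.norm_eq_abs, abs_of_pos hR, finrank_euclideanSpace, Fintype.card_fin,
    smul_eq_mul] at h
  simp_rw [Real.mul_rpow hR.le (norm_nonneg _)] at h
  rw [integral_const_mul] at h
  rw [sub_eq_add_neg, Real.rpow_add hR, Real.rpow_natCast, mul_assoc, h]
  field_simp

/-- The heat flow of `|y|^(-a)` is bounded by a multiple of `τ^(-a/2)`. -/
lemma exists_integral_heatKernel_norm_rpow_le [NeZero n] {a : ℝ} (ha0 : 0 ≤ a) (ha : a < n) :
    ∃ C > 0, ∀ τ > 0, ∀ x : EuclideanSpace ℝ (Fin n),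
      Integrable (fun y => heatKernel τ (x - y) * ‖y‖ ^ (-a)) ∧
        ∫ y, heatKernel τ (x - y) * ‖y‖ ^ (-a) ≤ C * τ ^ (-(a / 2)) := by
  set I := ∫ y in Metric.ball (0 : EuclideanSpace ℝ (Fin n)) 1, ‖y‖ ^ (-a)
  have hI : 0 ≤ I := integral_nonneg fun y => by positivity
  refine ⟨1 + (4 * Real.pi) ^ (-((n : ℝ) / 2)) * I, by positivity, fun τ hτ x => ?_⟩
  set B := Metric.ball (0 : EuclideanSpace ℝ (Fin n)) (√τ)
  have hs : 0 < √τ := Real.sqrt_pos.2 hτ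
  -- Split at the parabolic radius `√τ`. Outside the ball `|y|^(-a) ≤ τ^(-a/2)` and the kernel has
  -- mass one; inside, the kernel is at most `(4πτ)^(-n/2)` and the integral of `|y|^(-a)` scales
  -- like `τ^((n-a)/2)`.
  set F : EuclideanSpace ℝ (Fin n) → ℝ := fun y => τ ^ (-(a / 2)) * heatKernel τ (x - y) +
    (4 * Real.pi * τ) ^ (-((n : ℝ) / 2)) * B.indicator (fun y => ‖y‖ ^ (-a)) y
  have hind : Integrable (B.indicator fun y => ‖y‖ ^ (-a)) :=
    (integrable_indicator_iff Metric.isOpen_ball.measurableSet).2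
      (integrableOn_ball_norm_rpow ha _)
  have hF : Integrable F :=
    ((integrable_heatKernel_sub hτ x).const_mul _).add (hind.const_mul _)
  have hle : ∀ y, heatKernel τ (x - y) * ‖y‖ ^ (-a) ≤ F y := by
    intro y
    have hK := heatKernel_nonneg hτ (x - y)
    by_cases hy : y ∈ B
    · simp only [F, indicator_of_mem hy]
      have h1 : 0 ≤ τ ^ (-(a / 2)) * heatKernel τ (x - y) := by positivity
      have h2 := heatKernel_le hτ (x - y)
      have h3 : 0 ≤ ‖y‖ ^ (-a) := by positivity
      nlinarith
    · simp only [F, indicator_of_notMem hy, mul_zero, add_zero]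
      rw [mul_comm]
      gcongr
      have hy' : √τ ≤ ‖y‖ := by simpa [B] using hy
      calc ‖y‖ ^ (-a) ≤ √τ ^ (-a) := Real.rpow_le_rpow_of_nonpos hs hy' (by linarith)
        _ = τ ^ (-(a / 2)) := by
          rw [Real.sqrt_eq_rpow, ← Real.rpow_mul hτ.le]; ring_nf
  have hmeas : AEStronglyMeasurable (fun y => heatKernel τ (x - y) * ‖y‖ ^ (-a)) volume := by
    have : Measurable fun y => heatKernel τ (x - y) := by
      have := continuous_heatKernel (n := n) τ
      fun_prop
    exact (this.mul (by fun_prop)).aestronglyMeasurable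
  have hint : Integrable (fun y => heatKernel τ (x - y) * ‖y‖ ^ (-a)) := by
    refine hF.mono' hmeas (ae_of_all _ fun y => ?_)
    have hK := heatKernel_nonneg hτ (x - y)
    rw [Real.norm_of_nonneg (by positivity)]
    exact hle y
  refine ⟨hint, (integral_mono hint hF hle).trans (le_of_eq ?_)⟩
  simp only [F]
  rw [integral_add ((integrable_heatKernel_sub hτ x).const_mul _) (hind.const_mul _),
    integral_const_mul, integral_const_mul, integral_heatKernel_sub hτ,
    integral_indicator Metric.isOpen_ball.measurableSet, setIntegral_ball_norm_rpow hs,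
    Real.mul_rpow (by positivity) hτ.le, Real.sqrt_eq_rpow, ← Real.rpow_mul hτ.le]
  have : τ ^ (-((n : ℝ) / 2)) * τ ^ (1 / 2 * ((n : ℝ) - a)) = τ ^ (-(a / 2)) := by
    rw [← Real.rpow_add hτ]; ring_nf
  linear_combination ((4 * Real.pi) ^ (-((n : ℝ) / 2)) * I) * this

/-- Peetre's inequality. For negative `b` the triangle inequality is used with `x` and `y`
exchanged. -/
lemma one_add_norm_rpow_le (b : ℝ) (x y : EuclideanSpace ℝ (Fin n)) :
    (1 + ‖y‖) ^ b ≤ (1 + ‖x‖) ^ b * (1 + ‖x - y‖) ^ |b| := by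
  have key : ∀ x y : EuclideanSpace ℝ (Fin n), 1 + ‖y‖ ≤ (1 + ‖x‖) * (1 + ‖x - y‖) := by
    intro x y
    have h1 : ‖y‖ ≤ ‖x‖ + ‖x - y‖ := by
      have := norm_sub_le x (x - y)
      rwa [sub_sub_cancel] at this
    have := norm_nonneg x
    have := norm_nonneg (x - y)
    nlinarith
  rcases le_total 0 b with hb | hb
  · rw [abs_of_nonneg hb, ← Real.mul_rpow (by positivity) (by positivity)]
    exact Real.rpow_le_rpow (by positivity) (key x y) hb
  · rw [abs_of_nonpos hb]
    have h1 := key y x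
    rw [norm_sub_rev] at h1
    have h2 : (1 + ‖x‖) ^ (-b) ≤ (1 + ‖y‖) ^ (-b) * (1 + ‖x - y‖) ^ (-b) := by
      rw [← Real.mul_rpow (by positivity) (by positivity)]
      exact Real.rpow_le_rpow (by positivity) h1 (by linarith)
    rw [Real.rpow_neg (by positivity) b, Real.rpow_neg (x := 1 + ‖y‖) (by positivity) b] at h2
    have hx : 0 < (1 + ‖x‖) ^ b := by positivity
    have hy : 0 < (1 + ‖y‖) ^ b := by positivity
    rw [inv_mul_eq_div, le_div_iff₀ hy, inv_mul_eq_div, div_le_iff₀ hx] at h2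
    linarith

/-- The heat flow of `|y|^(-a) (1 + |y|)^b` is bounded by a multiple of
`τ^(-(a - ν)/2) |x|^(-ν) (1 + |x|)^b`. -/
lemma exists_integral_heatKernel_weight_le [NeZero n] {a ν : ℝ} (b : ℝ) (hν : 0 ≤ ν)
    (hνa : ν ≤ a) (ha : a < n) (T : ℝ) :
    ∃ C > 0, ∀ τ ∈ Ioc 0 T, ∀ x : EuclideanSpace ℝ (Fin n), x ≠ 0 →
      Integrable (fun y => heatKernel τ (x - y) * (‖y‖ ^ (-a) * (1 + ‖y‖) ^ b)) ∧
        ∫ y, heatKernel τ (x - y) * (‖y‖ ^ (-a) * (1 + ‖y‖) ^ b) ≤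
          C * τ ^ (-((a - ν) / 2)) * (‖x‖ ^ (-ν) * (1 + ‖x‖) ^ b) := by
  obtain ⟨C₁, hC₁, h₁⟩ := exists_one_add_rpow_mul_heatKernel_le n (abs_nonneg b) T
  obtain ⟨C₂, hC₂, h₂⟩ := exists_norm_rpow_mul_heatKernel_le n hν
  obtain ⟨C₃, hC₃, h₃⟩ := exists_integral_heatKernel_norm_rpow_le (n := n) (hν.trans hνa) ha
  obtain ⟨C₄, hC₄, h₄⟩ := exists_integral_heatKernel_norm_rpow_le (n := n) (a := a - ν)
    (by linarith) (by linarith)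
  set D := 2 ^ ν * C₁ * (C₂ * 2 ^ (ν / 2) * (C₃ * 4 ^ (-(a / 2))) + C₄ * 2 ^ (-((a - ν) / 2)))
  refine ⟨D, by positivity, fun τ hτ x hx => ?_⟩
  have hτ0 : 0 < τ := hτ.1
  have hx0 : 0 < ‖x‖ := norm_pos_iff.2 hx
  set P := ‖x‖ ^ (-ν) * (1 + ‖x‖) ^ b
  have hP : 0 < P := by positivity
  -- The factor `|x|^(-ν)` is produced by inserting `1 ≤ |x|^(-ν) 2^ν (|x-y|^ν + |y|^ν)`. The kernel
  -- absorbs `|x-y|^ν` at the price of a second doubling of time, while `|y|^ν` lowers the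
  -- singularity to `|y|^(-(a-ν))`; both terms scale like `τ^(-(a-ν)/2)`.
  set F : EuclideanSpace ℝ (Fin n) → ℝ := fun y => P * (2 ^ ν * C₁) *
    (C₂ * (2 * τ) ^ (ν / 2) * (heatKernel (2 * (2 * τ)) (x - y) * ‖y‖ ^ (-a)) +
      heatKernel (2 * τ) (x - y) * ‖y‖ ^ (-(a - ν)))
  have i₃ := h₃ (2 * (2 * τ)) (by positivity) x
  have i₄ := h₄ (2 * τ) (by positivity) x
  have hF : Integrable F := ((i₃.1.const_mul _).add i₄.1).const_mul _
  have hle : ∀ y ≠ 0, heatKernel τ (x - y) * (‖y‖ ^ (-a) * (1 + ‖y‖) ^ b) ≤ F y := by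
    intro y hy
    have hy0 : 0 < ‖y‖ := norm_pos_iff.2 hy
    have hK := heatKernel_nonneg hτ0 (x - y)
    have hK2 := heatKernel_nonneg (n := n) (τ := 2 * τ) (by positivity) (x - y)
    have e1 : ‖x‖ ^ ν ≤ 2 ^ ν * (‖x - y‖ ^ ν + ‖y‖ ^ ν) := by
      refine le_trans ?_ (add_rpow_le_two_rpow (norm_nonneg _) (norm_nonneg _) hν)
      refine Real.rpow_le_rpow (norm_nonneg _) ?_ hν
      simpa using norm_add_le (x - y) y
    have e2 : 1 ≤ ‖x‖ ^ (-ν) * (2 ^ ν * (‖x - y‖ ^ ν + ‖y‖ ^ ν)) := by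
      rw [Real.rpow_neg hx0.le, inv_mul_eq_div, le_div_iff₀ (by positivity), one_mul]
      exact e1
    have e3 : ‖y‖ ^ ν * ‖y‖ ^ (-a) = ‖y‖ ^ (-(a - ν)) := by
      rw [← Real.rpow_add hy0]; ring_nf
    calc heatKernel τ (x - y) * (‖y‖ ^ (-a) * (1 + ‖y‖) ^ b)
        ≤ heatKernel τ (x - y) * (‖y‖ ^ (-a) * ((1 + ‖x‖) ^ b * (1 + ‖x - y‖) ^ |b|)) := by
          gcongr; exact one_add_norm_rpow_le b x y
      _ = (1 + ‖x‖) ^ b * ‖y‖ ^ (-a) * ((1 + ‖x - y‖) ^ |b| * heatKernel τ (x - y)) := by ring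
      _ ≤ (1 + ‖x‖) ^ b * ‖y‖ ^ (-a) * (C₁ * heatKernel (2 * τ) (x - y)) := by
          gcongr _ * ?_; exact h₁ τ hτ _
      _ = (1 + ‖x‖) ^ b * ‖y‖ ^ (-a) * (C₁ * heatKernel (2 * τ) (x - y)) * 1 := by ring
      _ ≤ (1 + ‖x‖) ^ b * ‖y‖ ^ (-a) * (C₁ * heatKernel (2 * τ) (x - y)) *
          (‖x‖ ^ (-ν) * (2 ^ ν * (‖x - y‖ ^ ν + ‖y‖ ^ ν))) := by gcongr
      _ = P * (2 ^ ν * C₁) * (‖x - y‖ ^ ν * heatKernel (2 * τ) (x - y) * ‖y‖ ^ (-a) +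
          heatKernel (2 * τ) (x - y) * (‖y‖ ^ ν * ‖y‖ ^ (-a))) := by simp only [P]; ring
      _ ≤ F y := by
          simp only [F]
          rw [e3]
          gcongr _ * (?_ + _)
          rw [← mul_assoc]
          gcongr ?_ * _
          exact h₂ (2 * τ) (by positivity) _
  have hmeas : AEStronglyMeasurable
      (fun y => heatKernel τ (x - y) * (‖y‖ ^ (-a) * (1 + ‖y‖) ^ b)) volume := by
    have : Measurable fun y => heatKernel τ (x - y) := by
      have := continuous_heatKernel (n := n) τ
      fun_prop
    exact (this.mul (by fun_prop)).aestronglyMeasurable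
  have h0 : ∀ᵐ y : EuclideanSpace ℝ (Fin n), y ≠ 0 := by
    have : Nontrivial (EuclideanSpace ℝ (Fin n)) := nontrivial_of_ne x 0 hx
    exact Measure.ae_ne volume 0
  have hint : Integrable (fun y => heatKernel τ (x - y) * (‖y‖ ^ (-a) * (1 + ‖y‖) ^ b)) := by
    refine hF.mono' hmeas (h0.mono fun y hy => ?_)
    have hK := heatKernel_nonneg hτ0 (x - y)
    rw [Real.norm_of_nonneg (by positivity)]
    exact hle y hy
  refine ⟨hint, (integral_mono_ae hint hF (h0.mono hle)).trans ?_⟩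
  simp only [F]
  rw [integral_const_mul, integral_add (i₃.1.const_mul _) i₄.1, integral_const_mul]
  calc _ ≤ P * (2 ^ ν * C₁) * (C₂ * (2 * τ) ^ (ν / 2) * (C₃ * (2 * (2 * τ)) ^ (-(a / 2))) +
        C₄ * (2 * τ) ^ (-((a - ν) / 2))) := by
        gcongr
        · exact i₃.2
        · exact i₄.2
    _ = _ := by
        have e4 : τ ^ (ν / 2) * τ ^ (-(a / 2)) = τ ^ (-((a - ν) / 2)) := by
          rw [← Real.rpow_add hτ0]; ring_nf
        rw [← mul_assoc 2 2 τ, Real.mul_rpow (by norm_num) hτ0.le,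
          Real.mul_rpow (by norm_num) hτ0.le, Real.mul_rpow (by norm_num) hτ0.le]
        norm_num only
        linear_combination (P * (2 ^ ν * C₁) * C₂ * 2 ^ (ν / 2) * C₃ * 4 ^ (-(a / 2))) * e4

/-- The profile of the nonlinearity evaluated on functions bounded by `profile`. -/
def singProfile (ν k θ r : ℝ) : ℝ := (1 + r ^ (θ - 2)) * profile ν k r

lemma singProfile_pos {ν k θ r : ℝ} (hr : 0 < r) : 0 < singProfile ν k θ r := by
  have := profile_pos (ν := ν) (k := k) hr
  unfold singProfile; positivity

lemma profile_le_singProfile {ν k θ r : ℝ} (hr : 0 < r) :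
    profile ν k r ≤ singProfile ν k θ r := by
  have := profile_pos (ν := ν) (k := k) hr
  have : 0 < r ^ (θ - 2) := by positivity
  unfold singProfile; nlinarith

@[fun_prop]
lemma measurable_profile (ν k : ℝ) : Measurable (profile ν k) := by
  unfold profile; fun_prop

@[fun_prop]
lemma measurable_singProfile (ν k θ : ℝ) : Measurable (singProfile ν k θ) := by
  unfold singProfile; fun_prop

/-- Admissible exponents: the profile and its product with `|x|^(-2)` are integrable at the
origin of `ℝⁿ`. -/
structure Admissible (n : ℕ) (ν θ : ℝ) : Prop where
  nonneg : 0 ≤ ν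
  lt : ν + 2 < n
  pos : 0 < θ
  le_one : θ ≤ 1

/-- The heat semigroup on the weighted spaces. -/
lemma Admissible.exists_integral_heatKernel_profile_le {ν θ : ℝ} (h : Admissible n ν θ)
    (k T : ℝ) :
    ∃ C > 0, ∀ τ ∈ Ioc 0 T, ∀ x : EuclideanSpace ℝ (Fin n), x ≠ 0 →
      (Integrable (fun y => heatKernel τ (x - y) * profile ν k ‖y‖) ∧
        ∫ y, heatKernel τ (x - y) * profile ν k ‖y‖ ≤ C * profile ν k ‖x‖) ∧
      (Integrable (fun y => heatKernel τ (x - y) * singProfile ν k θ ‖y‖) ∧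
        ∫ y, heatKernel τ (x - y) * singProfile ν k θ ‖y‖ ≤
          C * τ ^ (θ / 2 - 1) * profile ν k ‖x‖ ∧
        ∫ y, heatKernel τ (x - y) * singProfile ν k θ ‖y‖ ≤ C * singProfile ν k θ ‖x‖) := by
  have hn : NeZero n := ⟨by
    rintro rfl
    have := h.lt
    have := h.nonneg
    norm_num at *
    linarith⟩
  have := h.lt
  have := h.pos
  have := h.le_one
  obtain ⟨C₁, hC₁, h₁⟩ := exists_integral_heatKernel_weight_le (n := n) (a := ν) (ν := ν) (ν - k)
    h.nonneg le_rfl (by linarith) T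
  obtain ⟨C₂, hC₂, h₂⟩ := exists_integral_heatKernel_weight_le (n := n) (a := ν + (2 - θ))
    (ν := ν) (ν - k) h.nonneg (by linarith) (by linarith) T
  obtain ⟨C₃, hC₃, h₃⟩ := exists_integral_heatKernel_weight_le (n := n) (a := ν + (2 - θ))
    (ν := ν + (2 - θ)) (ν - k) (by linarith [h.nonneg]) (by linarith) (by linarith) T
  have hT1 : 0 ≤ |T| ^ (1 - θ / 2) := by positivity
  refine ⟨C₁ + C₁ * |T| ^ (1 - θ / 2) + C₂ + C₃, by positivity, fun τ hτ x hx => ?_⟩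
  have hτ0 : 0 < τ := hτ.1
  have hp := profile_pos (ν := ν) (k := k) (norm_pos_iff.2 hx)
  have i₁ := h₁ τ hτ x hx
  have i₂ := h₂ τ hτ x hx
  have i₃ := h₃ τ hτ x hx
  simp only [sub_self, zero_div, neg_zero, Real.rpow_zero, mul_one] at i₁ i₃
  have e₀ : (-((ν + (2 - θ) - ν) / 2)) = θ / 2 - 1 := by ring
  rw [e₀] at i₂
  refine ⟨⟨i₁.1, i₁.2.trans ?_⟩, ?_⟩
  · change C₁ * profile ν k ‖x‖ ≤ _
    gcongr
    have : 0 ≤ C₁ * |T| ^ (1 - θ / 2) := by positivity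
    linarith
  have hne : ∀ᵐ y : EuclideanSpace ℝ (Fin n), y ≠ 0 := by
    have : Nontrivial (EuclideanSpace ℝ (Fin n)) := nontrivial_of_ne x 0 hx
    exact Measure.ae_ne volume 0
  have hsum : ∀ y : EuclideanSpace ℝ (Fin n), y ≠ 0 → singProfile ν k θ ‖y‖ =
      ‖y‖ ^ (-ν) * (1 + ‖y‖) ^ (ν - k) + ‖y‖ ^ (-(ν + (2 - θ))) * (1 + ‖y‖) ^ (ν - k) := by
    intro y hy
    have hy0 : 0 < ‖y‖ := norm_pos_iff.2 hy
    have : ‖y‖ ^ (-(ν + (2 - θ))) = ‖y‖ ^ (θ - 2) * ‖y‖ ^ (-ν) := by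
      rw [← Real.rpow_add hy0]; ring_nf
    rw [this]
    unfold singProfile profile
    ring
  have hae : (fun y => heatKernel τ (x - y) * singProfile ν k θ ‖y‖) =ᵐ[volume]
      fun y => heatKernel τ (x - y) * (‖y‖ ^ (-ν) * (1 + ‖y‖) ^ (ν - k)) +
        heatKernel τ (x - y) * (‖y‖ ^ (-(ν + (2 - θ))) * (1 + ‖y‖) ^ (ν - k)) := by
    filter_upwards [hne] with y hy
    rw [hsum y hy, mul_add]
  refine ⟨(i₁.1.add i₂.1).congr hae.symm, ?_⟩
  rw [integral_congr_ae hae, integral_add i₁.1 i₂.1]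
  have hx0 : 0 < ‖x‖ := norm_pos_iff.2 hx
  refine ⟨?_, ?_⟩
  swap
  · have e1 : 0 < ‖x‖ ^ (-ν) * (1 + ‖x‖) ^ (ν - k) := by positivity
    have e2 : 0 < ‖x‖ ^ (-(ν + (2 - θ))) * (1 + ‖x‖) ^ (ν - k) := by positivity
    rw [hsum x hx]
    calc _ ≤ _ := add_le_add i₁.2 i₃.2
      _ ≤ (C₁ + C₁ * |T| ^ (1 - θ / 2) + C₂ + C₃) * (‖x‖ ^ (-ν) * (1 + ‖x‖) ^ (ν - k)) +
          (C₁ + C₁ * |T| ^ (1 - θ / 2) + C₂ + C₃) *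
            (‖x‖ ^ (-(ν + (2 - θ))) * (1 + ‖x‖) ^ (ν - k)) := by
          have : 0 ≤ C₁ * |T| ^ (1 - θ / 2) := by positivity
          gcongr <;> linarith
      _ = _ := by ring
  -- The regular part of the singular profile has a bounded heat flow relative to the profile; on
  -- `(0, T]` constants are dominated by the negative power of `τ`.
  have hτT : 1 ≤ |T| ^ (1 - θ / 2) * τ ^ (θ / 2 - 1) := by
    have e : τ ^ (θ / 2 - 1) = (τ ^ (1 - θ / 2))⁻¹ := by
      rw [← Real.rpow_neg hτ0.le]; ring_nf
    rw [e, ← div_eq_mul_inv, le_div_iff₀ (by positivity), one_mul]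
    exact Real.rpow_le_rpow hτ0.le (hτ.2.trans (le_abs_self T)) (by linarith)
  have hpos : 0 ≤ τ ^ (θ / 2 - 1) := by positivity
  calc _ ≤ C₁ * profile ν k ‖x‖ + C₂ * τ ^ (θ / 2 - 1) * profile ν k ‖x‖ := add_le_add i₁.2 i₂.2
    _ ≤ C₁ * (|T| ^ (1 - θ / 2) * τ ^ (θ / 2 - 1)) * profile ν k ‖x‖ +
        C₂ * τ ^ (θ / 2 - 1) * profile ν k ‖x‖ := by
        gcongr
        exact le_mul_of_one_le_right hC₁.le hτT
    _ ≤ _ := by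
        have : 0 ≤ C₁ * τ ^ (θ / 2 - 1) * profile ν k ‖x‖ := by positivity
        have : 0 ≤ C₃ * τ ^ (θ / 2 - 1) * profile ν k ‖x‖ := by positivity
        linarith

/-- The Gaussian factor increases with time, so only the ratio of the normalizations is lost. -/
lemma heatKernel_le_of_le {σ ρ : ℝ} (hσ : 0 < σ) (h : σ ≤ ρ) (z : EuclideanSpace ℝ (Fin n)) :
    heatKernel σ z ≤ (ρ / σ) ^ ((n : ℝ) / 2) * heatKernel ρ z := by
  have hρ : 0 < ρ := hσ.trans_le h
  have e : (4 * Real.pi * σ) ^ (-((n : ℝ) / 2)) =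
      (ρ / σ) ^ ((n : ℝ) / 2) * (4 * Real.pi * ρ) ^ (-((n : ℝ) / 2)) := by
    rw [Real.rpow_neg (by positivity), Real.rpow_neg (by positivity),
      Real.mul_rpow (by positivity) hσ.le, Real.mul_rpow (by positivity) hρ.le,
      Real.div_rpow hρ.le hσ.le]
    have := (Real.rpow_pos_of_pos hρ ((n : ℝ) / 2)).ne'
    field_simp
  unfold heatKernel
  rw [e, mul_assoc]
  gcongr

/-- The time derivative of the heat kernel. -/
def heatKernelDeriv (τ : ℝ) (z : EuclideanSpace ℝ (Fin n)) : ℝ :=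
  heatKernel τ z * (‖z‖ ^ 2 / (4 * τ ^ 2) - n / (2 * τ))

lemma hasDerivAt_heatKernel {τ : ℝ} (hτ : 0 < τ) (z : EuclideanSpace ℝ (Fin n)) :
    HasDerivAt (fun σ => heatKernel σ z) (heatKernelDeriv τ z) τ := by
  have h1 : HasDerivAt (fun σ : ℝ => (4 * Real.pi * σ) ^ (-((n : ℝ) / 2)))
      (4 * Real.pi * (-((n : ℝ) / 2)) * (4 * Real.pi * τ) ^ (-((n : ℝ) / 2) - 1)) τ := by
    have := ((hasDerivAt_id τ).const_mul (4 * Real.pi)).rpow_const (p := -((n : ℝ) / 2))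
      (Or.inl (by simp only [id]; positivity))
    simpa using this
  have h2 : HasDerivAt (fun σ : ℝ => Real.exp (-(‖z‖ ^ 2 / (4 * σ))))
      (Real.exp (-(‖z‖ ^ 2 / (4 * τ))) * (‖z‖ ^ 2 / (4 * τ ^ 2))) τ := by
    have h3 : HasDerivAt (fun σ : ℝ => -(‖z‖ ^ 2 / (4 * σ))) (‖z‖ ^ 2 / (4 * τ ^ 2)) τ := by
      have := (((hasDerivAt_id τ).const_mul 4).inv (by simp only [id]; positivity)).const_mul
        (-(‖z‖ ^ 2))
      refine (this.congr_deriv ?_).congr_of_eventuallyEq (Eventually.of_forall fun σ => ?_)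
      · simp only [id]; field_simp
      · simp [div_eq_mul_inv]
    exact h3.exp
  refine (h1.mul h2).congr_deriv ?_
  unfold heatKernelDeriv heatKernel
  rw [Real.rpow_sub_one (by positivity)]
  field_simp
  ring

/-- In the factor `|z|²/(4τ²)` the power `|z|²` is absorbed into the kernel at time `2τ` for a
factor `τ`, which leaves `τ⁻¹`. -/
lemma exists_abs_heatKernelDeriv_le (n : ℕ) :
    ∃ C > 0, ∀ τ > 0, ∀ z : EuclideanSpace ℝ (Fin n),
      |heatKernelDeriv τ z| ≤ C * τ⁻¹ * heatKernel (2 * τ) z := by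
  obtain ⟨C, hC, h⟩ := exists_norm_rpow_mul_heatKernel_le n (p := 2) zero_le_two
  refine ⟨C + n / 2 * 2 ^ ((n : ℝ) / 2), by positivity, fun τ hτ z => ?_⟩
  have hK := heatKernel_nonneg hτ z
  have h1 := h τ hτ z
  have h2 := heatKernel_le_of_le hτ (by linarith : τ ≤ 2 * τ) z
  rw [mul_div_cancel_right₀ _ hτ.ne'] at h2
  simp only [Real.rpow_two, div_self (two_ne_zero' ℝ), Real.rpow_one] at h1
  have hK2 := heatKernel_nonneg (n := n) (τ := 2 * τ) (by positivity) z
  calc |heatKernelDeriv τ z|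
      ≤ heatKernel τ z * (‖z‖ ^ 2 / (4 * τ ^ 2)) + heatKernel τ z * (n / (2 * τ)) := by
        unfold heatKernelDeriv
        rw [abs_mul, abs_of_nonneg hK, ← mul_add]
        gcongr
        refine (abs_sub _ _).trans (le_of_eq ?_)
        rw [abs_of_nonneg (by positivity), abs_of_nonneg (by positivity)]
    _ = (‖z‖ ^ 2 * heatKernel τ z) / (4 * τ ^ 2) + (n / (2 * τ)) * heatKernel τ z := by ring
    _ ≤ (C * τ * heatKernel (2 * τ) z) / (4 * τ ^ 2) +
        (n / (2 * τ)) * (2 ^ ((n : ℝ) / 2) * heatKernel (2 * τ) z) := by gcongr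
    _ = (C / 4 + n / 2 * 2 ^ ((n : ℝ) / 2)) * τ⁻¹ * heatKernel (2 * τ) z := by
        field_simp
    _ ≤ _ := by gcongr; linarith

/-- Locally uniform domination of the heat kernel. -/
lemma exists_heatKernel_sub_le {τ₀ : ℝ} (hτ₀ : 0 < τ₀) :
    ∃ C > 0, ∀ τ ∈ Icc (τ₀ / 2) (2 * τ₀), ∀ x₀ x y : EuclideanSpace ℝ (Fin n), ‖x - x₀‖ ≤ 1 →
      heatKernel τ (x - y) ≤ C * heatKernel (4 * τ₀) (x₀ - y) := by
  refine ⟨(4 * Real.pi * (τ₀ / 2)) ^ (-((n : ℝ) / 2)) * Real.exp (1 / (2 * τ₀)) *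
    ((4 * Real.pi * (4 * τ₀)) ^ (-((n : ℝ) / 2)))⁻¹, by positivity, fun τ hτ x₀ x y hx => ?_⟩
  have hτ0 : 0 < τ := by linarith [hτ.1]
  unfold heatKernel
  have h1 : (4 * Real.pi * τ) ^ (-((n : ℝ) / 2)) ≤
      (4 * Real.pi * (τ₀ / 2)) ^ (-((n : ℝ) / 2)) := by
    refine Real.rpow_le_rpow_of_nonpos (by positivity) ?_ ?_
    · gcongr; exact hτ.1
    · rw [neg_nonpos]; positivity
  have h2 : Real.exp (-(‖x - y‖ ^ 2 / (4 * τ))) ≤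
      Real.exp (1 / (2 * τ₀)) * Real.exp (-(‖x₀ - y‖ ^ 2 / (4 * (4 * τ₀)))) := by
    rw [← Real.exp_add, Real.exp_le_exp]
    have e1 : ‖x₀ - y‖ ≤ ‖x - y‖ + 1 := by
      have : x₀ - y = (x - y) - (x - x₀) := by abel
      rw [this]
      exact (norm_sub_le _ _).trans (by linarith)
    -- Moving the centre costs a factor `2` in the square and `τ ≤ 2 τ₀` costs another; hence the
    -- time `4 τ₀`.
    have e2 : ‖x₀ - y‖ ^ 2 ≤ 2 * ‖x - y‖ ^ 2 + 2 := by
      have : ‖x₀ - y‖ ^ 2 ≤ (‖x - y‖ + 1) ^ 2 := by gcongr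
      nlinarith [sq_nonneg (‖x - y‖ - 1)]
    have e3 : ‖x - y‖ ^ 2 / (8 * τ₀) ≤ ‖x - y‖ ^ 2 / (4 * τ) := by
      refine div_le_div_of_nonneg_left (by positivity) (by positivity) ?_
      linarith [hτ.2]
    have e4 : ‖x₀ - y‖ ^ 2 / (4 * (4 * τ₀)) ≤ (2 * ‖x - y‖ ^ 2 + 2) / (4 * (4 * τ₀)) := by
      gcongr
    have e5 : (2 * ‖x - y‖ ^ 2 + 2) / (4 * (4 * τ₀)) = ‖x - y‖ ^ 2 / (8 * τ₀) + 1 / (8 * τ₀) := by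
      field_simp; ring
    have e6 : 1 / (8 * τ₀) ≤ 1 / (2 * τ₀) := by gcongr; norm_num
    linarith
  calc _ ≤ (4 * Real.pi * (τ₀ / 2)) ^ (-((n : ℝ) / 2)) *
        (Real.exp (1 / (2 * τ₀)) * Real.exp (-(‖x₀ - y‖ ^ 2 / (4 * (4 * τ₀))))) := by
        gcongr
    _ = _ := by
        have : (4 * Real.pi * (4 * τ₀)) ^ (-((n : ℝ) / 2)) ≠ 0 := by positivity
        field_simp

end Kernel

/-! ### The heat semigroup on weighted spaces: bounds, time derivative, continuity -/

/-- Measurable functions bounded by `A` times the singular profile. -/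
structure SingBdd {n : ℕ} (ν k θ A : ℝ) (ψ : EuclideanSpace ℝ (Fin n) → ℝ) : Prop where
  meas : AEStronglyMeasurable ψ volume
  bound : ∀ y ≠ 0, |ψ y| ≤ A * singProfile ν k θ ‖y‖

/-- Measurable functions bounded by `A` times the profile. -/
structure ProfBdd {n : ℕ} (ν k A : ℝ) (ψ : EuclideanSpace ℝ (Fin n) → ℝ) : Prop where
  meas : AEStronglyMeasurable ψ volume
  bound : ∀ y ≠ 0, |ψ y| ≤ A * profile ν k ‖y‖

section Heat

variable {n : ℕ} {ν k θ A : ℝ}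

lemma ProfBdd.singBdd {ψ : EuclideanSpace ℝ (Fin n) → ℝ} (hA : 0 ≤ A) (h : ProfBdd ν k A ψ) :
    SingBdd ν k θ A ψ :=
  ⟨h.meas, fun y hy => (h.bound y hy).trans
    (mul_le_mul_of_nonneg_left (profile_le_singProfile (norm_pos_iff.2 hy)) hA)⟩

lemma SingBdd.sub {B : ℝ} {ψ χ : EuclideanSpace ℝ (Fin n) → ℝ} (h : SingBdd ν k θ A ψ)
    (h' : SingBdd ν k θ B χ) : SingBdd ν k θ (A + B) (fun y => ψ y - χ y) :=
  ⟨h.meas.sub h'.meas, fun y hy => by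
    have := h.bound y hy
    have := h'.bound y hy
    rw [add_mul]
    exact (abs_sub _ _).trans (by linarith)⟩

/-- The point `x ≠ 0` only excludes dimension zero, where the origin is not a null set. -/
lemma ae_ne_zero {x : EuclideanSpace ℝ (Fin n)} (hx : x ≠ 0) :
    ∀ᵐ y : EuclideanSpace ℝ (Fin n), y ≠ 0 := by
  have : Nontrivial (EuclideanSpace ℝ (Fin n)) := nontrivial_of_ne x 0 hx
  exact Measure.ae_ne volume 0

lemma aestronglyMeasurable_of_continuousOn {φ : EuclideanSpace ℝ (Fin n) → ℝ}
    {x : EuclideanSpace ℝ (Fin n)} (hx : x ≠ 0) (h : ContinuousOn φ {0}ᶜ) :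
    AEStronglyMeasurable φ volume := by
  have : Nontrivial (EuclideanSpace ℝ (Fin n)) := nontrivial_of_ne x 0 hx
  have h1 := h.aestronglyMeasurable (μ := volume) (measurableSet_singleton _).compl
  rwa [restrict_compl_singleton] at h1

lemma continuousAt_profile {r : ℝ} (hr : 0 < r) : ContinuousAt (profile ν k) r := by
  unfold profile
  have h1 : ContinuousAt (fun r : ℝ => r ^ (-ν)) r := Real.continuousAt_rpow_const _ _ (Or.inl hr.ne')
  have h2 : ContinuousAt (fun r : ℝ => (1 + r) ^ (ν - k)) r :=
    ContinuousAt.rpow_const (by fun_prop) (Or.inl (by positivity))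
  exact h1.mul h2

lemma continuousOn_profile_norm :
    ContinuousOn (fun x : EuclideanSpace ℝ (Fin n) => profile ν k ‖x‖) {0}ᶜ := fun _ hx =>
  ((continuousAt_profile (norm_pos_iff.2 hx)).comp
    (f := fun x : EuclideanSpace ℝ (Fin n) => ‖x‖) continuous_norm.continuousAt).continuousWithinAt

lemma eventually_profile_le {x : EuclideanSpace ℝ (Fin n)} (hx : x ≠ 0) :
    ∀ᶠ y in 𝓝 x, y ≠ 0 ∧ profile ν k ‖y‖ ≤ profile ν k ‖x‖ + 1 := by
  have h1 : ContinuousAt (fun x : EuclideanSpace ℝ (Fin n) => profile ν k ‖x‖) x :=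
    continuousOn_profile_norm.continuousAt (isOpen_compl_singleton.mem_nhds hx)
  filter_upwards [isOpen_compl_singleton.mem_nhds hx,
    h1.eventually (ge_mem_nhds (lt_add_one _))] with y hy hy'
  exact ⟨hy, hy'⟩

lemma aestronglyMeasurable_heatKernel_mul {τ : ℝ} {ψ : EuclideanSpace ℝ (Fin n) → ℝ}
    (hψ : AEStronglyMeasurable ψ volume) (x : EuclideanSpace ℝ (Fin n)) :
    AEStronglyMeasurable (fun y => heatKernel τ (x - y) * ψ y) volume := by
  have : Continuous fun y => heatKernel τ (x - y) := by fun_prop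
  exact this.aestronglyMeasurable.mul hψ

lemma SingBdd.integrable (hn : Admissible n ν θ) {ψ : EuclideanSpace ℝ (Fin n) → ℝ}
    (h : SingBdd ν k θ A ψ) {τ : ℝ} (hτ : 0 < τ) {x : EuclideanSpace ℝ (Fin n)} (hx : x ≠ 0) :
    Integrable (fun y => heatKernel τ (x - y) * ψ y) := by
  obtain ⟨C, hC, hb⟩ := hn.exists_integral_heatKernel_profile_le k τ
  refine ((hb τ ⟨hτ, le_rfl⟩ x hx).2.1.const_mul A).mono'
    (aestronglyMeasurable_heatKernel_mul h.meas x) ((ae_ne_zero hx).mono fun y hy => ?_)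
  have hK := heatKernel_nonneg hτ (x - y)
  rw [norm_mul, Real.norm_of_nonneg hK, Real.norm_eq_abs]
  calc _ ≤ heatKernel τ (x - y) * (A * singProfile ν k θ ‖y‖) := by
        gcongr; exact h.bound y hy
    _ = _ := by ring

lemma SingBdd.abs_heatSemigroup_le (hn : Admissible n ν θ) {ψ : EuclideanSpace ℝ (Fin n) → ℝ}
    (h : SingBdd ν k θ A ψ) {τ : ℝ} (hτ : 0 < τ) {x : EuclideanSpace ℝ (Fin n)} (hx : x ≠ 0) :
    |heatSemigroup τ ψ x| ≤ A * ∫ y, heatKernel τ (x - y) * singProfile ν k θ ‖y‖ := by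
  obtain ⟨C, hC, hb⟩ := hn.exists_integral_heatKernel_profile_le k τ
  rw [heatSemigroup_of_pos hτ, ← integral_const_mul, ← Real.norm_eq_abs]
  refine norm_integral_le_of_norm_le ((hb τ ⟨hτ, le_rfl⟩ x hx).2.1.const_mul A)
    ((ae_ne_zero hx).mono fun y hy => ?_)
  have hK := heatKernel_nonneg hτ (x - y)
  rw [norm_mul, Real.norm_of_nonneg hK, Real.norm_eq_abs]
  calc _ ≤ heatKernel τ (x - y) * (A * singProfile ν k θ ‖y‖) := by
        gcongr; exact h.bound y hy
    _ = _ := by ring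

lemma ProfBdd.abs_heatSemigroup_le (hn : Admissible n ν θ) {ψ : EuclideanSpace ℝ (Fin n) → ℝ}
    (h : ProfBdd ν k A ψ) {τ : ℝ} (hτ : 0 < τ) {x : EuclideanSpace ℝ (Fin n)} (hx : x ≠ 0) :
    |heatSemigroup τ ψ x| ≤ A * ∫ y, heatKernel τ (x - y) * profile ν k ‖y‖ := by
  obtain ⟨C, hC, hb⟩ := hn.exists_integral_heatKernel_profile_le k τ
  rw [heatSemigroup_of_pos hτ, ← integral_const_mul, ← Real.norm_eq_abs]
  refine norm_integral_le_of_norm_le ((hb τ ⟨hτ, le_rfl⟩ x hx).1.1.const_mul A)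
    ((ae_ne_zero hx).mono fun y hy => ?_)
  have hK := heatKernel_nonneg hτ (x - y)
  rw [norm_mul, Real.norm_of_nonneg hK, Real.norm_eq_abs]
  calc _ ≤ heatKernel τ (x - y) * (A * profile ν k ‖y‖) := by
        gcongr; exact h.bound y hy
    _ = _ := by ring

/-- A dominating function, uniform for times near `τ`, for differentiation under the integral. The
time `3τ` bounds `2σ`. -/
lemma heatKernelDeriv_le_of_mem {τ : ℝ} (hτ : 0 < τ) :
    ∃ C > 0, ∀ σ ∈ Ioo (τ / 2) (3 * τ / 2), ∀ z : EuclideanSpace ℝ (Fin n),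
      |heatKernelDeriv σ z| ≤ C * heatKernel (3 * τ) z := by
  obtain ⟨C, hC, h⟩ := exists_abs_heatKernelDeriv_le n
  refine ⟨C * (τ / 2)⁻¹ * (3 : ℝ) ^ ((n : ℝ) / 2), by positivity, fun σ hσ z => ?_⟩
  have hσ0 : 0 < σ := by linarith [hσ.1]
  have h1 := heatKernel_le_of_le (σ := 2 * σ) (ρ := 3 * τ) (by linarith) (by linarith [hσ.2]) z
  have hK := heatKernel_nonneg (n := n) (τ := 3 * τ) (by positivity) z
  calc |heatKernelDeriv σ z| ≤ C * σ⁻¹ * heatKernel (2 * σ) z := h σ hσ0 z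
    _ ≤ C * (τ / 2)⁻¹ * ((3 * τ / (2 * σ)) ^ ((n : ℝ) / 2) * heatKernel (3 * τ) z) := by
        refine mul_le_mul ?_ h1 (heatKernel_nonneg (by positivity) _) (by positivity)
        gcongr
        exact hσ.1.le
    _ ≤ C * (τ / 2)⁻¹ * ((3 : ℝ) ^ ((n : ℝ) / 2) * heatKernel (3 * τ) z) := by
        gcongr
        rw [div_le_iff₀ (by positivity)]
        linarith [hσ.1]
    _ = _ := by ring

/-- Differentiability in time of the heat flow. -/
lemma SingBdd.hasDerivAt_heatSemigroup (hn : Admissible n ν θ)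
    {ψ : EuclideanSpace ℝ (Fin n) → ℝ} (h : SingBdd ν k θ A ψ) {τ : ℝ} (hτ : 0 < τ)
    {x : EuclideanSpace ℝ (Fin n)} (hx : x ≠ 0) :
    Integrable (fun y => heatKernelDeriv τ (x - y) * ψ y) ∧
    HasDerivAt (fun σ => heatSemigroup σ ψ x) (∫ y, heatKernelDeriv τ (x - y) * ψ y) τ := by
  obtain ⟨C, hC, hd⟩ := heatKernelDeriv_le_of_mem (n := n) hτ
  have hs : Ioo (τ / 2) (3 * τ / 2) ∈ 𝓝 τ := Ioo_mem_nhds (by linarith) (by linarith)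
  have hcont : Continuous fun y : EuclideanSpace ℝ (Fin n) => heatKernelDeriv τ (x - y) := by
    unfold heatKernelDeriv; fun_prop
  have key := hasDerivAt_integral_of_dominated_loc_of_deriv_le (μ := volume) (𝕜 := ℝ)
    (F := fun σ y => heatKernel σ (x - y) * ψ y) (x₀ := τ)
    (F' := fun σ y => heatKernelDeriv σ (x - y) * ψ y)
    (bound := fun y => C * ‖heatKernel (3 * τ) (x - y) * ψ y‖) hs
    (Eventually.of_forall fun σ => aestronglyMeasurable_heatKernel_mul h.meas x)
    (h.integrable hn hτ hx) (hcont.aestronglyMeasurable.mul h.meas)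
    (ae_of_all _ fun y σ hσ => ?_)
    ((h.integrable hn (by positivity) hx).norm.const_mul C) (ae_of_all _ fun y σ hσ => ?_)
  · refine ⟨key.1, key.2.congr_of_eventuallyEq ?_⟩
    filter_upwards [lt_mem_nhds hτ] with σ hσ
    exact heatSemigroup_of_pos hσ ψ x
  · have hK := heatKernel_nonneg (n := n) (τ := 3 * τ) (by positivity) (x - y)
    rw [norm_mul, norm_mul, Real.norm_of_nonneg hK, ← mul_assoc]
    gcongr
    exact hd σ hσ _
  · have hσ0 : 0 < σ := by linarith [hσ.1]
    exact (hasDerivAt_heatKernel hσ0 (x - y)).mul_const _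

/-- Bounds for the heat flow and its time derivative on a bounded time interval. -/
structure HeatConst (n : ℕ) (ν k θ T C : ℝ) : Prop where
  pos : 0 < C
  sing : ∀ A ≥ 0, ∀ ψ : EuclideanSpace ℝ (Fin n) → ℝ, SingBdd ν k θ A ψ → ∀ τ ∈ Ioc 0 T, ∀ x ≠ 0,
    |heatSemigroup τ ψ x| ≤ C * A * profile ν k ‖x‖ * τ ^ (θ / 2 - 1)
  prof : ∀ A ≥ 0, ∀ ψ : EuclideanSpace ℝ (Fin n) → ℝ, ProfBdd ν k A ψ → ∀ τ ∈ Ioc 0 T, ∀ x ≠ 0,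
    |heatSemigroup τ ψ x| ≤ C * A * profile ν k ‖x‖
  deriv_sing : ∀ A ≥ 0, ∀ ψ : EuclideanSpace ℝ (Fin n) → ℝ, SingBdd ν k θ A ψ →
    ∀ τ ∈ Ioc 0 T, ∀ x ≠ 0,
    |∫ y, heatKernelDeriv τ (x - y) * ψ y| ≤ C * A * profile ν k ‖x‖ * τ ^ (θ / 2 - 2)
  sing_sing : ∀ A ≥ 0, ∀ ψ : EuclideanSpace ℝ (Fin n) → ℝ, SingBdd ν k θ A ψ →
    ∀ τ ∈ Ioc 0 T, ∀ x ≠ 0, |heatSemigroup τ ψ x| ≤ C * A * singProfile ν k θ ‖x‖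
  deriv_sing_sing : ∀ A ≥ 0, ∀ ψ : EuclideanSpace ℝ (Fin n) → ℝ, SingBdd ν k θ A ψ →
    ∀ τ ∈ Ioc 0 T, ∀ x ≠ 0,
    |∫ y, heatKernelDeriv τ (x - y) * ψ y| ≤ C * A * singProfile ν k θ ‖x‖ * τ⁻¹

lemma SingBdd.abs_integral_heatKernelDeriv_le {C : ℝ} (hC : 0 ≤ C)
    (hd : ∀ τ > 0, ∀ z : EuclideanSpace ℝ (Fin n),
      |heatKernelDeriv τ z| ≤ C * τ⁻¹ * heatKernel (2 * τ) z)
    {ψ : EuclideanSpace ℝ (Fin n) → ℝ} (h : SingBdd ν k θ A ψ) {τ : ℝ} (hτ : 0 < τ)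
    {x : EuclideanSpace ℝ (Fin n)} (hx : x ≠ 0)
    (hi : Integrable (fun y => heatKernel (2 * τ) (x - y) * singProfile ν k θ ‖y‖)) :
    |∫ y, heatKernelDeriv τ (x - y) * ψ y| ≤
      C * A * τ⁻¹ * ∫ y, heatKernel (2 * τ) (x - y) * singProfile ν k θ ‖y‖ := by
  rw [← Real.norm_eq_abs, ← integral_const_mul]
  refine norm_integral_le_of_norm_le (hi.const_mul _) ((ae_ne_zero hx).mono fun y hy => ?_)
  have hK := heatKernel_nonneg (n := n) (τ := 2 * τ) (by positivity) (x - y)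
  rw [norm_mul, Real.norm_eq_abs, Real.norm_eq_abs]
  calc _ ≤ (C * τ⁻¹ * heatKernel (2 * τ) (x - y)) * (A * singProfile ν k θ ‖y‖) := by
        gcongr
        · exact hd τ hτ _
        · exact h.bound y hy
    _ = _ := by ring

/-- All five bounds come from the integral estimates for the two profiles; the derivative bounds
pass through the kernel at time `2τ`, so those estimates are taken up to time `2T`. -/
lemma Admissible.exists_heatConst (hn : Admissible n ν θ) (k T : ℝ) :
    ∃ C, HeatConst n ν k θ T C := by
  obtain ⟨C₁, hC₁, h₁⟩ := hn.exists_integral_heatKernel_profile_le k (2 * T)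
  obtain ⟨C₂, hC₂, h₂⟩ := exists_abs_heatKernelDeriv_le n
  have c1 : 0 ≤ C₂ * C₁ * 2 ^ (θ / 2 - 1) := by positivity
  have c2 : 0 ≤ C₂ * C₁ := by positivity
  refine ⟨C₁ + C₂ * C₁ * 2 ^ (θ / 2 - 1) + C₂ * C₁, by positivity, ?_, ?_, ?_, ?_, ?_⟩ <;>
    intro A hA ψ h τ hτ x hx <;>
    have hτ0 : 0 < τ := hτ.1 <;>
    have hp := profile_pos (ν := ν) (k := k) (norm_pos_iff.2 hx) <;>
    have hsp := singProfile_pos (ν := ν) (k := k) (θ := θ) (norm_pos_iff.2 hx) <;>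
    have i := h₁ τ ⟨hτ.1, by linarith [hτ.2]⟩ x hx <;>
    have i2 := (h₁ (2 * τ) ⟨by linarith, by linarith [hτ.2]⟩ x hx).2
  · calc |heatSemigroup τ ψ x| ≤ A * ∫ y, heatKernel τ (x - y) * singProfile ν k θ ‖y‖ :=
          h.abs_heatSemigroup_le hn hτ0 hx
      _ ≤ A * (C₁ * τ ^ (θ / 2 - 1) * profile ν k ‖x‖) := by
          gcongr
          exact i.2.2.1
      _ = C₁ * A * profile ν k ‖x‖ * τ ^ (θ / 2 - 1) := by ring
      _ ≤ _ := by gcongr; linarith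
  · calc |heatSemigroup τ ψ x| ≤ A * ∫ y, heatKernel τ (x - y) * profile ν k ‖y‖ :=
          h.abs_heatSemigroup_le hn hτ0 hx
      _ ≤ A * (C₁ * profile ν k ‖x‖) := by
          gcongr
          exact i.1.2
      _ = C₁ * A * profile ν k ‖x‖ := by ring
      _ ≤ _ := by gcongr; linarith
  · calc _ ≤ _ := h.abs_integral_heatKernelDeriv_le hC₂.le h₂ hτ0 hx i2.1
      _ ≤ (C₂ * A * τ⁻¹) * (C₁ * (2 * τ) ^ (θ / 2 - 1) * profile ν k ‖x‖) := by
          gcongr; exact i2.2.1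
      _ = (C₂ * C₁ * 2 ^ (θ / 2 - 1)) * A * profile ν k ‖x‖ * τ ^ (θ / 2 - 2) := by
          have e : τ ^ (θ / 2 - 2) = τ⁻¹ * τ ^ (θ / 2 - 1) := by
            rw [← Real.rpow_neg_one, ← Real.rpow_add hτ0]; ring_nf
          rw [e, Real.mul_rpow (by norm_num) hτ0.le]
          ring
      _ ≤ _ := by gcongr; linarith
  · calc |heatSemigroup τ ψ x| ≤ A * ∫ y, heatKernel τ (x - y) * singProfile ν k θ ‖y‖ :=
          h.abs_heatSemigroup_le hn hτ0 hx
      _ ≤ A * (C₁ * singProfile ν k θ ‖x‖) := by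
          gcongr
          exact i.2.2.2
      _ = C₁ * A * singProfile ν k θ ‖x‖ := by ring
      _ ≤ _ := by gcongr; linarith
  · calc _ ≤ _ := h.abs_integral_heatKernelDeriv_le hC₂.le h₂ hτ0 hx i2.1
      _ ≤ (C₂ * A * τ⁻¹) * (C₁ * singProfile ν k θ ‖x‖) := by
          gcongr; exact i2.2.2
      _ = (C₂ * C₁) * A * singProfile ν k θ ‖x‖ * τ⁻¹ := by ring
      _ ≤ _ := by gcongr; linarith

/-- Mean value inequality; the bound on the time derivative decreases with time, so it is evaluated
at the left endpoint. -/
lemma SingBdd.abs_heatSemigroup_sub_le (hn : Admissible n ν θ) {T C : ℝ}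
    (hC : HeatConst n ν k θ T C) (hA : 0 ≤ A) {ψ : EuclideanSpace ℝ (Fin n) → ℝ}
    (h : SingBdd ν k θ A ψ) {σ τ : ℝ} (hσ : 0 < σ) (hστ : σ ≤ τ) (hτ : τ ≤ T)
    {x : EuclideanSpace ℝ (Fin n)} (hx : x ≠ 0) :
    |heatSemigroup τ ψ x - heatSemigroup σ ψ x| ≤
      C * A * profile ν k ‖x‖ * σ ^ (θ / 2 - 2) * (τ - σ) := by
  have hp := profile_pos (ν := ν) (k := k) (norm_pos_iff.2 hx)
  have hC0 := hC.pos
  have hθ := hn.le_one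
  have key := (convex_Icc σ τ).norm_image_sub_le_of_norm_hasDerivWithin_le
    (f := fun s => heatSemigroup s ψ x) (f' := fun s => ∫ y, heatKernelDeriv s (x - y) * ψ y)
    (C := C * A * profile ν k ‖x‖ * σ ^ (θ / 2 - 2)) (x := σ) (y := τ)
    (fun s hs => (h.hasDerivAt_heatSemigroup hn (hσ.trans_le hs.1) hx).2.hasDerivWithinAt)
    (fun s hs => ?_) (left_mem_Icc.2 hστ) (right_mem_Icc.2 hστ)
  · rwa [Real.norm_eq_abs, Real.norm_of_nonneg (sub_nonneg.2 hστ)] at key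
  · rw [Real.norm_eq_abs]
    refine (hC.deriv_sing A hA ψ h s ⟨hσ.trans_le hs.1, hs.2.trans hτ⟩ x hx).trans ?_
    gcongr ?_ * ?_
    exact Real.rpow_le_rpow_of_nonpos hσ hs.1 (by linarith)

/-- At a fixed `x` the singular profile is just a constant. Accepting it on the right improves the
time singularity from `ρ^(θ/2-2)` to `ρ⁻¹`, which any Hölder rate of the source makes integrable. -/
lemma SingBdd.abs_heatSemigroup_sub_le_singProfile (hn : Admissible n ν θ) {T C : ℝ}
    (hC : HeatConst n ν k θ T C) (hA : 0 ≤ A) {ψ : EuclideanSpace ℝ (Fin n) → ℝ}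
    (h : SingBdd ν k θ A ψ) {ρ σ τ : ℝ} (hρ : 0 < ρ) (hσ : σ ∈ Icc ρ T) (hτ : τ ∈ Icc ρ T)
    {x : EuclideanSpace ℝ (Fin n)} (hx : x ≠ 0) :
    |heatSemigroup τ ψ x - heatSemigroup σ ψ x| ≤
      C * A * singProfile ν k θ ‖x‖ * ρ⁻¹ * |τ - σ| := by
  have hp := singProfile_pos (ν := ν) (k := k) (θ := θ) (norm_pos_iff.2 hx)
  have hC0 := hC.pos
  refine (convex_Icc ρ T).norm_image_sub_le_of_norm_hasDerivWithin_le
    (f := fun s => heatSemigroup s ψ x) (f' := fun s => ∫ y, heatKernelDeriv s (x - y) * ψ y)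
    (fun s hs => (h.hasDerivAt_heatSemigroup hn (hρ.trans_le hs.1) hx).2.hasDerivWithinAt)
    (fun s hs => ?_) hσ hτ
  rw [Real.norm_eq_abs]
  refine (hC.deriv_sing_sing A hA ψ h s ⟨hρ.trans_le hs.1, hs.2⟩ x hx).trans ?_
  gcongr
  exact hs.1

/-- Joint continuity of the heat flow at positive times. -/
lemma SingBdd.continuousAt_heatSemigroup (hn : Admissible n ν θ)
    {ψ : EuclideanSpace ℝ (Fin n) → ℝ} (h : SingBdd ν k θ A ψ) {τ : ℝ} (hτ : 0 < τ)
    {x : EuclideanSpace ℝ (Fin n)} (hx : x ≠ 0) :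
    ContinuousAt (fun p : EuclideanSpace ℝ (Fin n) × ℝ => heatSemigroup p.2 ψ p.1) (x, τ) := by
  obtain ⟨C, hC, hd⟩ := exists_heatKernel_sub_le (n := n) hτ
  have key : ContinuousAt (fun p : EuclideanSpace ℝ (Fin n) × ℝ =>
      ∫ y, heatKernel p.2 (p.1 - y) * ψ y) (x, τ) := by
    refine continuousAt_of_dominated (bound := fun y => C * ‖heatKernel (4 * τ) (x - y) * ψ y‖)
      (Eventually.of_forall fun p => aestronglyMeasurable_heatKernel_mul h.meas _) ?_
      ((h.integrable hn (by positivity) hx).norm.const_mul C) (ae_of_all _ fun y => ?_)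
    · have h1 : ∀ᶠ p : EuclideanSpace ℝ (Fin n) × ℝ in 𝓝 (x, τ), p.2 ∈ Ioo (τ / 2) (2 * τ) :=
        continuous_snd.continuousAt (Ioo_mem_nhds (by simp only; linarith)
          (by simp only; linarith))
      have h2 : ∀ᶠ p : EuclideanSpace ℝ (Fin n) × ℝ in 𝓝 (x, τ), p.1 ∈ Metric.ball x 1 :=
        continuous_fst.continuousAt (Metric.ball_mem_nhds x one_pos)
      filter_upwards [h1, h2] with p hp1 hp2
      refine ae_of_all _ fun y => ?_
      have hp0 : 0 < p.2 := by linarith [hp1.1]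
      have hK := heatKernel_nonneg (n := n) (τ := 4 * τ) (by positivity) (x - y)
      rw [norm_mul, norm_mul, Real.norm_of_nonneg hK, ← mul_assoc,
        Real.norm_of_nonneg (heatKernel_nonneg hp0 _)]
      gcongr
      exact hd p.2 ⟨hp1.1.le, hp1.2.le⟩ x p.1 y (by
        rw [← dist_eq_norm]; exact (Metric.mem_ball.1 hp2).le)
    · refine ContinuousAt.mul ?_ continuousAt_const
      unfold heatKernel
      refine ContinuousAt.mul (ContinuousAt.rpow_const (by fun_prop) (Or.inl ?_)) ?_
      · simp only; positivity
      · refine ContinuousAt.rexp (ContinuousAt.neg (ContinuousAt.div (by fun_prop) (by fun_prop) ?_))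
        simp only; positivity
  refine key.congr ?_
  filter_upwards [continuous_snd.continuousAt (lt_mem_nhds (show 0 < (x, τ).2 from hτ))] with p hp
  exact (heatSemigroup_of_pos hp ψ p.1).symm

/-- Away from the diagonal `exp(-a) ≤ 1/a`, applied to the freed half of the exponent, gains a
factor `τ`. -/
lemma heatKernel_le_of_norm_ge {τ δ : ℝ} (hτ : 0 < τ) (hδ : 0 < δ)
    {z : EuclideanSpace ℝ (Fin n)} (hz : δ ≤ ‖z‖) :
    heatKernel τ z ≤ 2 ^ ((n : ℝ) / 2) * (8 * τ / δ ^ 2) * heatKernel (2 * τ) z := by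
  have hK2 := heatKernel_nonneg (n := n) (τ := 2 * τ) (by positivity) z
  rw [heatKernel_eq_two_mul hτ]
  gcongr
  have h1 : δ ^ 2 / (8 * τ) ≤ ‖z‖ ^ 2 / (8 * τ) := by gcongr
  have h2 : 0 < δ ^ 2 / (8 * τ) := by positivity
  have h3 := Real.add_one_le_exp (δ ^ 2 / (8 * τ))
  calc Real.exp (-(‖z‖ ^ 2 / (8 * τ))) ≤ Real.exp (-(δ ^ 2 / (8 * τ))) := by gcongr
    _ = (Real.exp (δ ^ 2 / (8 * τ)))⁻¹ := Real.exp_neg _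
    _ ≤ (δ ^ 2 / (8 * τ))⁻¹ := by gcongr; linarith
    _ = _ := by rw [inv_div]

/-- The approximate identity argument with an explicit rate. Where `|y - x₀| < δ` the oscillation is
at most `ε`; elsewhere `|x - y| ≥ δ/2` and the kernel carries a factor `τ`. The rate is locally
uniform in `x`, which gives joint continuity at time zero. -/
lemma ProfBdd.abs_heatSemigroup_sub_const_le (hn : Admissible n ν θ)
    {φ : EuclideanSpace ℝ (Fin n) → ℝ} (hA : 0 ≤ A) (h : ProfBdd ν k A φ) {τ ε δ c P : ℝ}
    (hτ : 0 < τ) (hδ : 0 < δ) {x x₀ : EuclideanSpace ℝ (Fin n)} (hx : x ≠ 0)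
    (hP : Integrable (fun y => heatKernel (2 * τ) (x - y) * profile ν k ‖y‖))
    (hP' : ∫ y, heatKernel (2 * τ) (x - y) * profile ν k ‖y‖ ≤ P)
    (hφ : ∀ y, dist y x₀ < δ → |φ y - c| ≤ ε) (hxx : dist x x₀ < δ / 2) (hε : 0 ≤ ε) :
    |heatSemigroup τ φ x - c| ≤ ε + τ * (2 ^ ((n : ℝ) / 2) * (8 / (δ / 2) ^ 2) * (A * P + |c|)) := by
  have hint := (h.singBdd (θ := θ) hA).integrable hn hτ hx
  have hint0 := integrable_heatKernel_sub hτ x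
  have hint2 := integrable_heatKernel_sub (n := n) (τ := 2 * τ) (by positivity) x
  obtain ⟨q, hq⟩ : ∃ q : ℝ, q = 2 ^ ((n : ℝ) / 2) * (8 * τ / (δ / 2) ^ 2) := ⟨_, rfl⟩
  have hq0 : 0 ≤ q := by rw [hq]; positivity
  have e1 : heatSemigroup τ φ x - c = ∫ y, heatKernel τ (x - y) * (φ y - c) := by
    simp_rw [mul_sub]
    rw [integral_sub hint (hint0.mul_const _), integral_mul_const, integral_heatKernel_sub hτ,
      one_mul, heatSemigroup_of_pos hτ]
  have hF₂ : Integrable fun y => q * A * (heatKernel (2 * τ) (x - y) * profile ν k ‖y‖) +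
      q * |c| * heatKernel (2 * τ) (x - y) := (hP.const_mul _).add (hint2.const_mul _)
  have hF₁ : Integrable fun y => heatKernel τ (x - y) * ε := hint0.mul_const _
  have hle : ∀ y ≠ 0, ‖heatKernel τ (x - y) * (φ y - c)‖ ≤ heatKernel τ (x - y) * ε +
      (q * A * (heatKernel (2 * τ) (x - y) * profile ν k ‖y‖) +
        q * |c| * heatKernel (2 * τ) (x - y)) := by
    intro y hy
    have hK := heatKernel_nonneg hτ (x - y)
    have hK2 := heatKernel_nonneg (n := n) (τ := 2 * τ) (by positivity) (x - y)
    have hp := profile_pos (ν := ν) (k := k) (norm_pos_iff.2 hy)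
    rw [norm_mul, Real.norm_of_nonneg hK, Real.norm_eq_abs]
    by_cases hd : dist y x₀ < δ
    · have h5 : 0 ≤ q * A * (heatKernel (2 * τ) (x - y) * profile ν k ‖y‖) +
        q * |c| * heatKernel (2 * τ) (x - y) := by positivity
      have := mul_le_mul_of_nonneg_left (hφ y hd) hK
      linarith
    · have h6 : δ / 2 ≤ ‖x - y‖ := by
        rw [← dist_eq_norm]
        have := dist_triangle y x x₀
        rw [dist_comm y x] at this
        linarith
      have h7 := heatKernel_le_of_norm_ge hτ (half_pos hδ) h6
      rw [← hq] at h7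
      have h8 : |φ y - c| ≤ A * profile ν k ‖y‖ + |c| :=
        (abs_sub _ _).trans (by linarith [h.bound y hy])
      have h9 : 0 ≤ heatKernel τ (x - y) * ε := by positivity
      calc heatKernel τ (x - y) * |φ y - c|
          ≤ (q * heatKernel (2 * τ) (x - y)) * (A * profile ν k ‖y‖ + |c|) := by gcongr
        _ ≤ _ := by linarith
  rw [e1, ← Real.norm_eq_abs]
  refine (norm_integral_le_of_norm_le (hF₁.add hF₂) ((ae_ne_zero hx).mono hle)).trans ?_
  rw [integral_add' hF₁ hF₂,
    integral_add (hP.const_mul _) (hint2.const_mul _), integral_mul_const,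
    integral_const_mul, integral_const_mul, integral_heatKernel_sub hτ,
    integral_heatKernel_sub (by positivity)]
  calc _ ≤ 1 * ε + (q * A * P + q * |c| * 1) := by gcongr
    _ = _ := by rw [hq]; ring

/-- Joint continuity of the heat flow down to time zero. -/
lemma ProfBdd.continuousOn_heatSemigroup (hn : Admissible n ν θ)
    {φ : EuclideanSpace ℝ (Fin n) → ℝ} (hA : 0 ≤ A) (h : ProfBdd ν k A φ)
    (hφ : ContinuousOn φ {0}ᶜ) :
    ContinuousOn (fun p : EuclideanSpace ℝ (Fin n) × ℝ => heatSemigroup p.2 φ p.1)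
      ({0}ᶜ ×ˢ Ici 0) := by
  rintro ⟨x₀, t⟩ ⟨hx₀, ht⟩
  simp only [mem_compl_iff, mem_singleton_iff, mem_Ici] at hx₀ ht
  rcases ht.eq_or_lt with rfl | ht
  swap
  · exact ((h.singBdd (θ := θ) hA).continuousAt_heatSemigroup hn ht hx₀).continuousWithinAt
  obtain ⟨C, hC, hb⟩ := hn.exists_integral_heatKernel_profile_le k 2
  have hφ₀ : ContinuousAt φ x₀ := hφ.continuousAt (isOpen_compl_singleton.mem_nhds hx₀)
  rw [ContinuousWithinAt, Metric.tendsto_nhds]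
  intro ε hε
  simp only [heatSemigroup_zero]
  obtain ⟨δ, hδ, hδ'⟩ := Metric.continuousAt_iff.1 hφ₀ (ε / 2) (half_pos hε)
  have hp₀ := profile_pos (ν := ν) (k := k) (norm_pos_iff.2 hx₀)
  obtain ⟨Q, hQ⟩ : ∃ Q : ℝ, Q = 2 ^ ((n : ℝ) / 2) * (8 / (δ / 2) ^ 2) *
    (A * (C * (profile ν k ‖x₀‖ + 1)) + |φ x₀|) := ⟨_, rfl⟩
  have hQ0 : 0 ≤ Q := by rw [hQ]; positivity
  have t1 : Tendsto Prod.fst (𝓝[{0}ᶜ ×ˢ Ici 0] (x₀, (0 : ℝ))) (𝓝 x₀) :=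
    (continuous_fst.tendsto (x₀, (0 : ℝ))).mono_left nhdsWithin_le_nhds
  have t2 : Tendsto Prod.snd (𝓝[{0}ᶜ ×ˢ Ici 0] (x₀, (0 : ℝ))) (𝓝 0) :=
    (continuous_snd.tendsto (x₀, (0 : ℝ))).mono_left nhdsWithin_le_nhds
  have h1 := t1.eventually (eventually_profile_le (ν := ν) (k := k) hx₀)
  have h2 := t1.eventually (Metric.ball_mem_nhds x₀ (half_pos hδ))
  have h3 := t2.eventually (gt_mem_nhds (by positivity : (0 : ℝ) < min 1 (ε / (2 * (Q + 1)))))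
  filter_upwards [h1, h2, h3, self_mem_nhdsWithin] with p hp1 hp2 hp3 hp4
  have hτ0 : 0 ≤ p.2 := hp4.2
  have hxx : dist p.1 x₀ < δ / 2 := hp2
  rcases hτ0.eq_or_lt with hτ | hτ
  · rw [← hτ, heatSemigroup_zero]
    exact (hδ' (by linarith)).trans (half_lt_self hε)
  have hτ1 : p.2 < 1 := hp3.trans_le (min_le_left _ _)
  have hτε : p.2 * (Q + 1) < ε / 2 := by
    have := hp3.trans_le (min_le_right _ _)
    rw [lt_div_iff₀ (by positivity)] at this
    linarith
  have hb' := (hb (2 * p.2) ⟨by positivity, by linarith⟩ p.1 hp1.1).1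
  have key := h.abs_heatSemigroup_sub_const_le hn hA hτ hδ hp1.1 hb'.1
    (P := C * (profile ν k ‖x₀‖ + 1)) (hb'.2.trans (by gcongr; exact hp1.2))
    (c := φ x₀) (ε := ε / 2) (x₀ := x₀)
    (fun y hy => by have := (hδ' hy).le; rwa [Real.dist_eq] at this) hxx (by positivity)
  rw [← hQ] at key
  rw [Real.dist_eq]
  refine key.trans_lt ?_
  linarith

end Heat

/-! ### Duhamel integrals: integrability and joint continuity -/

/-- Time-dependent measurable sources bounded by `A` times the singular profile. -/
structure SourceBdd {n : ℕ} (ν k θ A : ℝ) (v : EuclideanSpace ℝ (Fin n) → ℝ → ℝ) : Prop where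
  meas : Measurable (Function.uncurry v)
  bound : ∀ s, ∀ y ≠ 0, |v y s| ≤ A * singProfile ν k θ ‖y‖

/-- The Duhamel integral `∫_0^t e^{(t-s)Δ} v(s) ds`. -/
def duhamelIntegral {n : ℕ} (v : EuclideanSpace ℝ (Fin n) → ℝ → ℝ) (x : EuclideanSpace ℝ (Fin n))
    (t : ℝ) : ℝ :=
  ∫ s in (0 : ℝ)..t, heatSemigroup (t - s) (fun y => v y s) x

section Duhamel

variable {n : ℕ} {ν k θ A : ℝ} {v : EuclideanSpace ℝ (Fin n) → ℝ → ℝ}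

lemma SourceBdd.singBdd (hv : SourceBdd ν k θ A v) (s : ℝ) :
    SingBdd ν k θ A fun y => v y s :=
  ⟨(hv.meas.comp (by fun_prop : Measurable fun y : EuclideanSpace ℝ (Fin n) =>
    (y, s))).aestronglyMeasurable, fun y hy => hv.bound s y hy⟩

/-- For `s ≥ t` the semigroup is the identity by convention, so the two regimes are treated
separately; the first is an integral of a jointly measurable function. -/
lemma measurable_heatSemigroup_source (hv : Measurable (Function.uncurry v)) (t : ℝ)
    (x : EuclideanSpace ℝ (Fin n)) :
    Measurable fun s => heatSemigroup (t - s) (fun y => v y s) x := by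
  have h1 : (fun s => heatSemigroup (t - s) (fun y => v y s) x) = fun s =>
      if s < t then ∫ y, heatKernel (t - s) (x - y) * v y s else v x s := by
    funext s
    split_ifs with h
    · exact heatSemigroup_of_pos (sub_pos.2 h) _ x
    · rw [heatSemigroup, if_neg (by linarith)]
  rw [h1]
  refine Measurable.ite measurableSet_Iio ?_ (hv.comp (by fun_prop : Measurable fun s : ℝ => (x, s)))
  have h2 : Measurable fun p : ℝ × EuclideanSpace ℝ (Fin n) =>
      heatKernel (t - p.1) (x - p.2) * v p.2 p.1 := by
    refine Measurable.mul ?_ (hv.comp measurable_swap)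
    unfold heatKernel
    fun_prop
  exact (h2.stronglyMeasurable.integral_prod_right').measurable

lemma intervalIntegrable_sub_rpow (hθ : 0 < θ) (a b t : ℝ) :
    IntervalIntegrable (fun s : ℝ => (t - s) ^ (θ - 1)) volume a b := by
  have := (intervalIntegral.intervalIntegrable_rpow' (r := θ - 1) (a := t - a) (b := t - b)
    (by linarith)).comp_sub_left t
  simpa using this

lemma integral_sub_rpow (hθ : 0 < θ) {a t : ℝ} :
    ∫ s in a..t, (t - s) ^ (θ - 1) = (t - a) ^ θ / θ := by
  rw [intervalIntegral.integral_comp_sub_left (fun s => s ^ (θ - 1)), sub_self,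
    integral_rpow (Or.inl (by linarith)), sub_add_cancel, Real.zero_rpow hθ.ne', sub_zero]

lemma SourceBdd.abs_heatSemigroup_le {T C : ℝ} (hC : HeatConst n ν k θ T C)
    (hA : 0 ≤ A) (hv : SourceBdd ν k θ A v) {s t : ℝ} (hst : s < t) (hT : t - s ≤ T)
    {x : EuclideanSpace ℝ (Fin n)} (hx : x ≠ 0) :
    |heatSemigroup (t - s) (fun y => v y s) x| ≤
      C * A * profile ν k ‖x‖ * (t - s) ^ (θ / 2 - 1) :=
  hC.sing A hA _ (hv.singBdd s) (t - s) ⟨sub_pos.2 hst, hT⟩ x hx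

lemma ae_ne_real (t : ℝ) : ∀ᵐ s : ℝ, s ≠ t := Measure.ae_ne volume t

lemma SourceBdd.intervalIntegrable (hn : Admissible n ν θ) (hA : 0 ≤ A)
    (hv : SourceBdd ν k θ A v) {a b t : ℝ} (hab : a ≤ b) (hbt : b ≤ t)
    {x : EuclideanSpace ℝ (Fin n)} (hx : x ≠ 0) :
    IntervalIntegrable (fun s => heatSemigroup (t - s) (fun y => v y s) x) volume a b := by
  obtain ⟨C, hC⟩ := hn.exists_heatConst k (t - a)
  have hb := (intervalIntegrable_sub_rpow (θ := θ / 2) (half_pos hn.pos) a b t).const_mul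
    (C * A * profile ν k ‖x‖)
  refine hb.mono_fun' (measurable_heatSemigroup_source hv.meas t x).aestronglyMeasurable ?_
  rw [uIoc_of_le hab]
  filter_upwards [ae_restrict_mem measurableSet_Ioc, ae_restrict_of_ae (ae_ne_real t)] with s hs hst
  have hst' : s < t := lt_of_le_of_ne (hs.2.trans hbt) hst
  rw [Real.norm_eq_abs]
  exact hv.abs_heatSemigroup_le hC hA hst' (by linarith [hs.1]) hx

lemma SourceBdd.abs_integral_le (hn : Admissible n ν θ) {T C : ℝ} (hC : HeatConst n ν k θ T C)
    (hA : 0 ≤ A) (hv : SourceBdd ν k θ A v) {a t : ℝ} (hat : a ≤ t) (hT : t - a ≤ T)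
    {x : EuclideanSpace ℝ (Fin n)} (hx : x ≠ 0) :
    |∫ s in a..t, heatSemigroup (t - s) (fun y => v y s) x| ≤
      C * A * profile ν k ‖x‖ * ((t - a) ^ (θ / 2) / (θ / 2)) := by
  rw [← integral_sub_rpow (half_pos hn.pos), ← intervalIntegral.integral_const_mul,
    ← Real.norm_eq_abs]
  refine intervalIntegral.norm_integral_le_of_norm_le hat ?_
    ((intervalIntegrable_sub_rpow (half_pos hn.pos) _ _ _).const_mul _)
  filter_upwards [ae_ne_real t] with s hst hs
  have hst' : s < t := lt_of_le_of_ne hs.2 hst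
  rw [Real.norm_eq_abs]
  exact hv.abs_heatSemigroup_le hC hA hst' (by linarith [hs.1]) hx

/-- The Duhamel integral with the last time span of length `ε` removed is continuous. -/
lemma SourceBdd.continuousWithinAt_truncated (hn : Admissible n ν θ) (hA : 0 ≤ A)
    (hv : SourceBdd ν k θ A v) {T ε t₀ : ℝ} (hT : 0 ≤ T) (hε : 0 < ε) (S : Set (EuclideanSpace ℝ (Fin n) × ℝ))
    (hS : ∀ p ∈ S, p.2 ≤ T) {x₀ : EuclideanSpace ℝ (Fin n)} (hx₀ : x₀ ≠ 0) :
    ContinuousWithinAt (fun p : EuclideanSpace ℝ (Fin n) × ℝ => ∫ s in (0 : ℝ)..T,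
      (Iio (p.2 - ε)).indicator (fun s => heatSemigroup (p.2 - s) (fun y => v y s) p.1) s) S
      (x₀, t₀) := by
  obtain ⟨C, hC⟩ := hn.exists_heatConst k T
  have hC0 := hC.pos
  have hp₀ := profile_pos (ν := ν) (k := k) (norm_pos_iff.2 hx₀)
  have t1 : Tendsto Prod.fst (𝓝[S] (x₀, t₀)) (𝓝 x₀) :=
    (continuous_fst.tendsto (x₀, t₀)).mono_left nhdsWithin_le_nhds
  have t2 : Tendsto Prod.snd (𝓝[S] (x₀, t₀)) (𝓝 t₀) :=
    (continuous_snd.tendsto (x₀, t₀)).mono_left nhdsWithin_le_nhds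
  -- The indicator keeps the interval of integration fixed while `t` varies. On its support the
  -- elapsed time exceeds `ε`, whence the constant dominating function.
  refine intervalIntegral.tendsto_integral_filter_of_dominated_convergence
    (fun _ => C * A * (profile ν k ‖x₀‖ + 1) * ε ^ (θ / 2 - 1)) ?_ ?_ intervalIntegrable_const ?_
  · exact Eventually.of_forall fun p => ((measurable_heatSemigroup_source hv.meas p.2 p.1).indicator
      measurableSet_Iio).aestronglyMeasurable
  · filter_upwards [t1.eventually (eventually_profile_le (ν := ν) (k := k) hx₀),
      self_mem_nhdsWithin] with p hp hpS
    refine ae_of_all _ fun s hs => ?_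
    rw [uIoc_of_le hT] at hs
    have := hn.le_one
    rw [Real.norm_eq_abs]
    by_cases hsp : s < p.2 - ε
    · rw [indicator_of_mem (show s ∈ Iio (p.2 - ε) from hsp)]
      refine (hv.abs_heatSemigroup_le hC hA (by linarith) (by linarith [hs.1, hS p hpS])
        hp.1).trans ?_
      have hp2 := hp.2
      have hr := Real.rpow_le_rpow_of_nonpos (z := θ / 2 - 1) hε (by linarith : ε ≤ p.2 - s)
        (by linarith)
      have hr0 : 0 ≤ (p.2 - s) ^ (θ / 2 - 1) := Real.rpow_nonneg (by linarith) _
      gcongr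
    · rw [indicator_of_notMem (show s ∉ Iio (p.2 - ε) from hsp), abs_zero]
      positivity
  · filter_upwards [ae_ne_real (t₀ - ε)] with s hs _
    rcases lt_or_gt_of_ne hs with h | h
    · have h1 : ∀ᶠ p in 𝓝[S] (x₀, t₀), s < p.2 - ε :=
        (t2.sub_const ε).eventually (lt_mem_nhds h)
      rw [indicator_of_mem (show s ∈ Iio (t₀ - ε) from h)]
      have hc := (hv.singBdd s).continuousAt_heatSemigroup hn (τ := t₀ - s) (by linarith) hx₀
      have h2 : Tendsto (fun p : EuclideanSpace ℝ (Fin n) × ℝ => (p.1, p.2 - s)) (𝓝[S] (x₀, t₀))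
          (𝓝 (x₀, t₀ - s)) := t1.prodMk_nhds (t2.sub_const s)
      refine (hc.tendsto.comp h2).congr' ?_
      filter_upwards [h1] with p hp
      rw [indicator_of_mem (show s ∈ Iio (p.2 - ε) from hp)]
      rfl
    · have h1 : ∀ᶠ p in 𝓝[S] (x₀, t₀), p.2 - ε < s :=
        (t2.sub_const ε).eventually (gt_mem_nhds h)
      rw [indicator_of_notMem (show s ∉ Iio (t₀ - ε) from not_lt.2 h.le)]
      refine tendsto_const_nhds.congr' ?_
      filter_upwards [h1] with p hp
      rw [indicator_of_notMem (show s ∉ Iio (p.2 - ε) from not_lt.2 hp.le)]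

/-- Continuity of the Duhamel integral. -/
lemma SourceBdd.continuousOn_duhamelIntegral (hn : Admissible n ν θ) (hA : 0 ≤ A)
    (hv : SourceBdd ν k θ A v) (T : ℝ) :
    ContinuousOn (fun p : EuclideanSpace ℝ (Fin n) × ℝ => duhamelIntegral v p.1 p.2)
      ({0}ᶜ ×ˢ Icc 0 T) := by
  obtain ⟨C, hC⟩ := hn.exists_heatConst k T
  have hC0 := hC.pos
  have hθ := hn.pos
  refine continuousOn_of_locally_uniform_approx_of_continuousWithinAt ?_
  rintro ⟨x₀, t₀⟩ ⟨hx₀, ht₀⟩ u hu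
  obtain ⟨η, hη, hηu⟩ := Metric.mem_uniformity_dist.1 hu
  have hp₀ := profile_pos (ν := ν) (k := k) (norm_pos_iff.2 hx₀)
  have hlim : Tendsto (fun ε : ℝ => C * A * (profile ν k ‖x₀‖ + 1) * (ε ^ (θ / 2) / (θ / 2)))
      (𝓝[>] 0) (𝓝 0) := by
    have h1 : Tendsto (fun ε : ℝ => ε ^ (θ / 2)) (𝓝 0) (𝓝 (0 ^ (θ / 2))) :=
      (Real.continuousAt_rpow_const 0 (θ / 2) (Or.inr (by positivity))).tendsto
    rw [Real.zero_rpow (by positivity)] at h1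
    have := (h1.div_const (θ / 2)).const_mul (C * A * (profile ν k ‖x₀‖ + 1))
    simp only [zero_div, mul_zero] at this
    exact this.mono_left nhdsWithin_le_nhds
  obtain ⟨ε, hεη, hε⟩ := ((hlim.eventually (gt_mem_nhds hη)).and self_mem_nhdsWithin).exists
  have hε0 : 0 < ε := hε
  have t1 : Tendsto Prod.fst (𝓝[{0}ᶜ ×ˢ Icc 0 T] (x₀, t₀)) (𝓝 x₀) :=
    (continuous_fst.tendsto (x₀, t₀)).mono_left nhdsWithin_le_nhds
  refine ⟨_, inter_mem self_mem_nhdsWithin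
    (t1.eventually (eventually_profile_le (ν := ν) (k := k) hx₀)), _,
    hv.continuousWithinAt_truncated hn hA (ht₀.1.trans ht₀.2) hε0 ({0}ᶜ ×ˢ Icc 0 T) (fun p hp => hp.2.2) hx₀, ?_⟩
  rintro ⟨x, t⟩ ⟨⟨hx, ht⟩, hxp⟩
  apply hηu
  simp only [mem_Icc, mem_ofPred_eq] at ht hxp ⊢
  have hT0 : 0 ≤ T := ht.1.trans ht.2
  -- If `t ≤ ε` nothing survives the truncation and the whole integral is the remainder.
  set m := max 0 (t - ε)
  have hm0 : 0 ≤ m := le_max_left _ _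
  have hmt : m ≤ t := max_le ht.1 (by linarith)
  have e1 : ∫ s in (0 : ℝ)..T,
      (Iio (t - ε)).indicator (fun s => heatSemigroup (t - s) (fun y => v y s) x) s =
      ∫ s in (0 : ℝ)..m, heatSemigroup (t - s) (fun y => v y s) x := by
    rw [intervalIntegral.integral_of_le hT0, intervalIntegral.integral_of_le hm0,
      setIntegral_indicator measurableSet_Iio]
    refine setIntegral_congr_set ?_
    filter_upwards [ae_ne_real (t - ε)] with s hs
    refine propext ⟨fun h => ⟨h.1.1, le_max_of_le_right (le_of_lt h.2)⟩, fun h => ?_⟩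
    have h2 : s ≤ t - ε := by
      rcases le_max_iff.1 h.2 with h3 | h3
      · exact absurd h.1 (not_lt.2 h3)
      · exact h3
    exact ⟨⟨h.1, by linarith [ht.2]⟩, lt_of_le_of_ne h2 hs⟩
  have e2 := intervalIntegral.integral_add_adjacent_intervals
    (hv.intervalIntegrable hn hA hm0 hmt hx) (hv.intervalIntegrable hn hA hmt le_rfl hx)
  rw [Real.dist_eq, e1, duhamelIntegral, ← e2, add_sub_cancel_left]
  refine (hv.abs_integral_le hn hC hA hmt (by linarith [ht.2]) hx).trans_lt
    (lt_of_le_of_lt ?_ hεη)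
  have hp := hxp.2
  have hmε : t - m ≤ ε := by linarith [le_max_right 0 (t - ε)]
  have : 0 ≤ t - m := sub_nonneg.2 hmt
  gcongr

end Duhamel

/-! ### Hölder continuity and differentiability in time of Duhamel integrals -/

section TimeRegularity

variable {n : ℕ} {ν k θ A : ℝ} {v : EuclideanSpace ℝ (Fin n) → ℝ → ℝ}

/-- Interpolation between two regimes. For `h ≤ τ` the mean value bound `τ^(θ/2-2) h` is used with
`h^(1-θ/4) ≤ τ^(1-θ/4)`; for `h > τ` both terms are bounded separately. The power `τ^(θ/4-1)`
remains integrable at zero. -/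
lemma SingBdd.abs_heatSemigroup_sub_le_rpow (hn : Admissible n ν θ) {T C : ℝ}
    (hC : HeatConst n ν k θ T C) (hA : 0 ≤ A) {ψ : EuclideanSpace ℝ (Fin n) → ℝ}
    (hψ : SingBdd ν k θ A ψ) {τ h : ℝ} (hτ : 0 < τ) (hh : 0 < h) (hT : τ + h ≤ T)
    {x : EuclideanSpace ℝ (Fin n)} (hx : x ≠ 0) :
    |heatSemigroup (τ + h) ψ x - heatSemigroup τ ψ x| ≤
      2 * (C * A * profile ν k ‖x‖) * h ^ (θ / 4) * τ ^ (θ / 4 - 1) := by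
  have hp := profile_pos (ν := ν) (k := k) (norm_pos_iff.2 hx)
  have hC0 := hC.pos
  have hθ := hn.pos
  have hθ1 := hn.le_one
  rcases le_or_gt h τ with hle | hlt
  · refine (hψ.abs_heatSemigroup_sub_le hn hC hA hτ (by linarith) hT hx).trans ?_
    rw [add_sub_cancel_left, mul_assoc, mul_assoc (2 * _)]
    have e : τ ^ (θ / 2 - 2) * h ≤ h ^ (θ / 4) * τ ^ (θ / 4 - 1) := by
      have e1 : h = h ^ (θ / 4) * h ^ (1 - θ / 4) := by
        rw [← Real.rpow_add hh, add_sub_cancel, Real.rpow_one]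
      have e2 : h ^ (1 - θ / 4) ≤ τ ^ (1 - θ / 4) := Real.rpow_le_rpow hh.le hle (by linarith)
      have e3 : τ ^ (θ / 2 - 2) * τ ^ (1 - θ / 4) = τ ^ (θ / 4 - 1) := by
        rw [← Real.rpow_add hτ]; ring_nf
      calc τ ^ (θ / 2 - 2) * h = h ^ (θ / 4) * (τ ^ (θ / 2 - 2) * h ^ (1 - θ / 4)) := by
            nth_rewrite 1 [e1]; ring
        _ ≤ h ^ (θ / 4) * (τ ^ (θ / 2 - 2) * τ ^ (1 - θ / 4)) := by gcongr
        _ = _ := by rw [e3]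
    have : 0 ≤ C * A * profile ν k ‖x‖ := by positivity
    have e0 : 0 ≤ h ^ (θ / 4) * τ ^ (θ / 4 - 1) := by positivity
    nlinarith
  · have h1 := hC.sing A hA ψ hψ (τ + h) ⟨by positivity, hT⟩ x hx
    have h2 := hC.sing A hA ψ hψ τ ⟨hτ, by linarith⟩ x hx
    have h3 : (τ + h) ^ (θ / 2 - 1) ≤ τ ^ (θ / 2 - 1) :=
      Real.rpow_le_rpow_of_nonpos hτ (by linarith) (by linarith)
    have h4 : τ ^ (θ / 2 - 1) ≤ h ^ (θ / 4) * τ ^ (θ / 4 - 1) := by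
      have e : τ ^ (θ / 2 - 1) = τ ^ (θ / 4) * τ ^ (θ / 4 - 1) := by
        rw [← Real.rpow_add hτ]; ring_nf
      rw [e]
      gcongr
    have hM : 0 ≤ C * A * profile ν k ‖x‖ := by positivity
    have h5 := mul_le_mul_of_nonneg_left (h3.trans h4) hM
    have h6 := mul_le_mul_of_nonneg_left h4 hM
    refine (abs_sub _ _).trans ?_
    linarith

/-- The Duhamel integral of a bounded source is Hölder continuous in time. -/
lemma Admissible.exists_abs_duhamelIntegral_sub_le (hn : Admissible n ν θ) (k T : ℝ) :
    ∃ D > 0, ∀ A ≥ 0, ∀ v : EuclideanSpace ℝ (Fin n) → ℝ → ℝ, SourceBdd ν k θ A v →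
      ∀ t t', 0 ≤ t → t ≤ t' → t' ≤ T → ∀ x ≠ 0,
        |duhamelIntegral v x t' - duhamelIntegral v x t| ≤
          D * A * profile ν k ‖x‖ * (t' - t) ^ (θ / 4) := by
  obtain ⟨C, hC⟩ := hn.exists_heatConst k T
  have hC0 := hC.pos
  have hθ := hn.pos
  set L := |T| ^ (θ / 4)
  have hL : 0 ≤ L := by positivity
  refine ⟨C * (L / (θ / 2)) + 2 * C * (L / (θ / 4)) + 1, by positivity,
    fun A hA v hv t t' ht htt' hT x hx => ?_⟩
  have hp := profile_pos (ν := ν) (k := k) (norm_pos_iff.2 hx)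
  rcases htt'.eq_or_lt with rfl | hlt
  · simp only [sub_self, abs_zero]; positivity
  set h := t' - t
  have hh : 0 < h := sub_pos.2 hlt
  have i1 := hv.intervalIntegrable hn hA ht htt' hx
  have i2 := hv.intervalIntegrable hn hA htt' le_rfl hx
  have i3 := hv.intervalIntegrable hn hA ht le_rfl hx
  have e1 : duhamelIntegral v x t' - duhamelIntegral v x t =
      (∫ s in (0 : ℝ)..t, (heatSemigroup (t' - s) (fun y => v y s) x -
        heatSemigroup (t - s) (fun y => v y s) x)) +
      ∫ s in t..t', heatSemigroup (t' - s) (fun y => v y s) x := by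
    rw [intervalIntegral.integral_sub i1 i3, duhamelIntegral, duhamelIntegral,
      ← intervalIntegral.integral_add_adjacent_intervals i1 i2]
    ring
  have b1 : |∫ s in t..t', heatSemigroup (t' - s) (fun y => v y s) x| ≤
      C * A * profile ν k ‖x‖ * (h ^ (θ / 4) * L / (θ / 2)) := by
    refine (hv.abs_integral_le hn hC hA htt' (by linarith) hx).trans ?_
    have e : h ^ (θ / 2) = h ^ (θ / 4) * h ^ (θ / 4) := by
      rw [← Real.rpow_add hh]; ring_nf
    change C * A * profile ν k ‖x‖ * (h ^ (θ / 2) / (θ / 2)) ≤ _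
    rw [e]
    gcongr
    simp only [L]
    gcongr
    exact (by linarith : h ≤ T).trans (le_abs_self T)
  have b2 : |∫ s in (0 : ℝ)..t, (heatSemigroup (t' - s) (fun y => v y s) x -
        heatSemigroup (t - s) (fun y => v y s) x)| ≤
      2 * (C * A * profile ν k ‖x‖) * h ^ (θ / 4) * (L / (θ / 4)) := by
    have b3 : |∫ s in (0 : ℝ)..t, (heatSemigroup (t' - s) (fun y => v y s) x -
        heatSemigroup (t - s) (fun y => v y s) x)| ≤
        ∫ s in (0 : ℝ)..t, 2 * (C * A * profile ν k ‖x‖) * h ^ (θ / 4) * (t - s) ^ (θ / 4 - 1) := by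
      rw [← Real.norm_eq_abs]
      refine intervalIntegral.norm_integral_le_of_norm_le ht ?_
        ((intervalIntegrable_sub_rpow (by positivity) _ _ _).const_mul _)
      filter_upwards [ae_ne_real t] with s hst hs
      have hst' : s < t := lt_of_le_of_ne hs.2 hst
      rw [Real.norm_eq_abs]
      have := (hv.singBdd s).abs_heatSemigroup_sub_le_rpow hn hC hA (sub_pos.2 hst') hh
        (by simp only [h]; linarith [hs.1]) hx
      rwa [show t - s + h = t' - s by simp only [h]; ring] at this
    refine b3.trans ?_
    rw [intervalIntegral.integral_const_mul, integral_sub_rpow (by positivity), sub_zero]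
    gcongr
    simp only [L]
    gcongr
    exact (by linarith : t ≤ T).trans (le_abs_self T)
  rw [e1]
  refine (abs_add_le _ _).trans ((add_le_add b2 b1).trans ?_)
  have : 0 ≤ A * profile ν k ‖x‖ * h ^ (θ / 4) := by positivity
  calc _ = (C * (L / (θ / 2)) + 2 * C * (L / (θ / 4))) * (A * profile ν k ‖x‖ * h ^ (θ / 4)) := by
        ring
    _ ≤ (C * (L / (θ / 2)) + 2 * C * (L / (θ / 4)) + 1) *
        (A * profile ν k ‖x‖ * h ^ (θ / 4)) :=
        mul_le_mul_of_nonneg_right (by linarith) this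
    _ = _ := by ring

lemma measurable_heatSemigroup_time {ψ : EuclideanSpace ℝ (Fin n) → ℝ} (hψ : Measurable ψ)
    (x : EuclideanSpace ℝ (Fin n)) : Measurable fun σ => heatSemigroup σ ψ x := by
  have h1 := measurable_heatSemigroup_source (v := fun y _ => ψ y)
    (hψ.comp measurable_fst : Measurable fun p : EuclideanSpace ℝ (Fin n) × ℝ => ψ p.1) 0 x
  have h2 := h1.comp measurable_neg
  simpa [Function.comp_def] using h2

/-- The contribution of the distant past to the Duhamel integral is differentiable. -/
lemma SourceBdd.differentiableAt_past (hn : Admissible n ν θ) (hA : 0 ≤ A)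
    (hv : SourceBdd ν k θ A v) {t₀ t : ℝ} (ht₀ : 0 ≤ t₀) (ht : t₀ < t)
    {x : EuclideanSpace ℝ (Fin n)} (hx : x ≠ 0) :
    DifferentiableAt ℝ (fun t' => ∫ s in (0 : ℝ)..t₀, heatSemigroup (t' - s) (fun y => v y s) x)
      t := by
  obtain ⟨C, hC⟩ := hn.exists_heatConst k (t + 1)
  have hC0 := hC.pos
  have hp := singProfile_pos (ν := ν) (k := k) (θ := θ) (norm_pos_iff.2 hx)
  -- For `t' > m` and `s ≤ t₀` the elapsed time stays above `m - t₀ > 0`, so no singularity occurs.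
  set m := (t₀ + t) / 2
  have hm : t₀ < m ∧ m < t := ⟨by simp only [m]; linarith, by simp only [m]; linarith⟩
  have key := intervalIntegral.hasDerivAt_integral_of_dominated_loc_of_deriv_le (𝕜 := ℝ)
    (μ := volume) (a := 0) (b := t₀) (x₀ := t) (s := Ioo m (t + 1))
    (F := fun t' s => heatSemigroup (t' - s) (fun y => v y s) x)
    (F' := fun t' s => ∫ y, heatKernelDeriv (t' - s) (x - y) * v y s)
    (bound := fun _ => C * A * singProfile ν k θ ‖x‖ * (m - t₀)⁻¹)
    (Ioo_mem_nhds hm.2 (by linarith))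
    (Eventually.of_forall fun t' => (measurable_heatSemigroup_source hv.meas t' x).aestronglyMeasurable)
    (hv.intervalIntegrable hn hA ht₀ ht.le hx) ?_ ?_ intervalIntegrable_const ?_
  · exact key.2.differentiableAt
  · have h2 : Measurable fun p : ℝ × EuclideanSpace ℝ (Fin n) =>
        heatKernelDeriv (t - p.1) (x - p.2) * v p.2 p.1 := by
      refine Measurable.mul ?_ (hv.meas.comp measurable_swap)
      unfold heatKernelDeriv heatKernel
      fun_prop
    exact (h2.stronglyMeasurable.integral_prod_right').aestronglyMeasurable
  · refine ae_of_all _ fun s hs t' ht' => ?_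
    rw [uIoc_of_le ht₀] at hs
    have h1 : m - t₀ ≤ t' - s := by linarith [hs.2, ht'.1]
    have h0 : 0 < m - t₀ := by linarith [hm.1]
    rw [Real.norm_eq_abs]
    refine (hC.deriv_sing_sing A hA _ (hv.singBdd s) (t' - s)
      ⟨by linarith, by linarith [hs.1, ht'.2]⟩ x hx).trans ?_
    gcongr
  · refine ae_of_all _ fun s hs t' ht' => ?_
    rw [uIoc_of_le ht₀] at hs
    have h0 : 0 < t' - s := by linarith [hs.2, ht'.1, hm.1]
    have := ((hv.singBdd s).hasDerivAt_heatSemigroup hn h0 hx).2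
    simpa using this.comp_sub_const t' s

/-- The Duhamel integral of a stationary source is differentiable. -/
lemma SingBdd.differentiableAt_stationary (hn : Admissible n ν θ) (hA : 0 ≤ A)
    {ψ : EuclideanSpace ℝ (Fin n) → ℝ} (hψ : Measurable ψ) (h : SingBdd ν k θ A ψ) {t₀ t : ℝ}
    (ht : t₀ < t) {x : EuclideanSpace ℝ (Fin n)} (hx : x ≠ 0) :
    DifferentiableAt ℝ (fun t' => ∫ s in t₀..t', heatSemigroup (t' - s) ψ x) t := by
  have hsrc : SourceBdd ν k θ A fun y _ => ψ y :=
    ⟨(hψ.comp measurable_fst : Measurable fun p : EuclideanSpace ℝ (Fin n) × ℝ => ψ p.1),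
      fun _ => h.bound⟩
  -- After the substitution `σ = t' - s` only the upper limit depends on `t'`, and the fundamental
  -- theorem of calculus applies.
  have hi : IntervalIntegrable (fun σ => heatSemigroup σ ψ x) volume 0 (t - t₀) := by
    have := (hsrc.intervalIntegrable hn hA (a := t₀) ht.le le_rfl hx).comp_sub_left t
    simpa using this.symm
  have hc : ContinuousAt (fun σ => heatSemigroup σ ψ x) (t - t₀) :=
    (h.hasDerivAt_heatSemigroup hn (sub_pos.2 ht) hx).2.continuousAt
  have h1 := intervalIntegral.integral_hasDerivAt_right hi
    ((measurable_heatSemigroup_time hψ x).stronglyMeasurable.stronglyMeasurableAtFilter) hc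
  have h2 : HasDerivAt (fun t' => ∫ σ in (0 : ℝ)..(t' - t₀), heatSemigroup σ ψ x) _ t :=
    h1.comp_sub_const t t₀
  refine h2.differentiableAt.congr_of_eventuallyEq (Eventually.of_forall fun t' => ?_)
  simp only
  rw [intervalIntegral.integral_comp_sub_left (fun σ => heatSemigroup σ ψ x), sub_self]

set_option maxHeartbeats 1000000 in
/-- If the source vanishes at time `t` at a Hölder rate, the recent past contributes a
differentiable term to the Duhamel integral. -/
lemma SourceBdd.differentiableAt_recent (hn : Admissible n ν θ) (hA : 0 ≤ A)
    (hv : SourceBdd ν k θ A v) {t₀ t t₁ α H : ℝ} (h0 : t₀ < t) (h1 : t < t₁) (hα : 0 < α)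
    (hH : 0 ≤ H) (hv' : ∀ s ∈ Icc t₀ t₁, SingBdd ν k θ (H * |s - t| ^ α) fun y => v y s)
    {x : EuclideanSpace ℝ (Fin n)} (hx : x ≠ 0) :
    DifferentiableAt ℝ (fun t' => ∫ s in t₀..t', heatSemigroup (t' - s) (fun y => v y s) x) t := by
  obtain ⟨C, hC⟩ := hn.exists_heatConst k (t₁ - t₀)
  have hC0 := hC.pos
  have hp := singProfile_pos (ν := ν) (k := k) (θ := θ) (norm_pos_iff.2 hx)
  set f : ℝ → ℝ → ℝ := fun t' s => heatSemigroup (t' - s) (fun y => v y s) x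
  have hf : ∀ t', ∀ s ∈ Icc t₀ t₁, s < t' → t' ≤ t₁ →
      |f t' s| ≤ C * (H * |s - t| ^ α) * singProfile ν k θ ‖x‖ := fun t' s hs hst ht' =>
    hC.sing_sing _ (by positivity) _ (hv' s hs) (t' - s) ⟨by linarith, by linarith [hs.1]⟩ x hx
  -- The difference quotient of the integrand, restricted to `s < t - 2|h|`. There both elapsed
  -- times are at least `(t - s)/2`, so the quotient is bounded by a multiple of `(t - s)⁻¹ |s -
  -- t|^α = (t - s)^(α-1)`, uniformly in `h`.
  set g : ℝ → ℝ → ℝ := fun h => (Iio (t - 2 * |h|)).indicator fun s => h⁻¹ * (f (t + h) s - f t s)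
  have hsmall : ∀ᶠ h : ℝ in 𝓝[≠] 0, h ≠ 0 ∧ t₀ < t - 2 * |h| ∧ t + |h| < t₁ := by
    have e1 : Tendsto (fun h : ℝ => t - 2 * |h|) (𝓝 0) (𝓝 (t - 2 * |0|)) :=
      Continuous.tendsto (by fun_prop) 0
    have e2 : Tendsto (fun h : ℝ => t + |h|) (𝓝 0) (𝓝 (t + |0|)) :=
      Continuous.tendsto (by fun_prop) 0
    simp only [abs_zero, mul_zero, sub_zero, add_zero] at e1 e2
    filter_upwards [self_mem_nhdsWithin,
      (e1.eventually (lt_mem_nhds h0)).filter_mono nhdsWithin_le_nhds,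
      (e2.eventually (gt_mem_nhds h1)).filter_mono nhdsWithin_le_nhds] with h a b c
    exact ⟨a, b, c⟩
  have hmeas : ∀ t', Measurable (f t') := fun t' => measurable_heatSemigroup_source hv.meas t' x
  have hlim : Tendsto (fun h => ∫ s in t₀..t, g h s) (𝓝[≠] 0)
      (𝓝 (∫ s in t₀..t, ∫ y, heatKernelDeriv (t - s) (x - y) * v y s)) := by
    refine intervalIntegral.tendsto_integral_filter_of_dominated_convergence
      (fun s => 2 * (C * H * singProfile ν k θ ‖x‖) * (t - s) ^ (α - 1))
      (Eventually.of_forall fun h => ?_) ?_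
      ((intervalIntegrable_sub_rpow hα _ _ _).const_mul _) ?_
    · exact ((((hmeas (t + h)).sub (hmeas t)).const_mul h⁻¹).indicator
        measurableSet_Iio).aestronglyMeasurable
    · filter_upwards [hsmall] with h ⟨hh0, hh1, hh2⟩
      refine ae_of_all _ fun s hs => ?_
      rw [uIoc_of_le h0.le] at hs
      have habs : 0 < |h| := abs_pos.2 hh0
      rw [Real.norm_eq_abs]
      by_cases hsh : s < t - 2 * |h|
      · have hts : 0 < t - s := by linarith
        simp only [g, indicator_of_mem (show s ∈ Iio (t - 2 * |h|) from hsh), f]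
        have hle := neg_abs_le h
        have hle' := le_abs_self h
        have key := (hv' s ⟨hs.1.le, by linarith⟩).abs_heatSemigroup_sub_le_singProfile hn hC
          (by positivity) (ρ := (t - s) / 2) (σ := t - s) (τ := t + h - s) (by linarith)
          ⟨by linarith, by linarith [hs.1]⟩ ⟨by linarith, by linarith [hs.1]⟩ hx
        rw [show t + h - s - (t - s) = h by ring, abs_sub_comm s t, abs_of_pos hts] at key
        rw [abs_mul, abs_inv, inv_mul_le_iff₀ habs]
        refine key.trans (le_of_eq ?_)
        rw [Real.rpow_sub_one hts.ne']
        field_simp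
      · simp only [g, indicator_of_notMem (show s ∉ Iio (t - 2 * |h|) from hsh), abs_zero]
        have : 0 ≤ (t - s) ^ (α - 1) := Real.rpow_nonneg (by linarith [hs.2]) _
        positivity
    · filter_upwards [ae_ne_real t] with s hst hs
      rw [uIoc_of_le h0.le] at hs
      have hts : s < t := lt_of_le_of_ne hs.2 hst
      have hd : HasDerivAt (fun t' => f t' s) (∫ y, heatKernelDeriv (t - s) (x - y) * v y s) t := by
        have := ((hv.singBdd s).hasDerivAt_heatSemigroup hn (sub_pos.2 hts) hx).2
        simpa using this.comp_sub_const t s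
      refine (hasDerivAt_iff_tendsto_slope_zero.1 hd).congr' ?_
      have e1 : Tendsto (fun h : ℝ => t - 2 * |h|) (𝓝 0) (𝓝 (t - 2 * |0|)) :=
        Continuous.tendsto (by fun_prop) 0
      simp only [abs_zero, mul_zero, sub_zero] at e1
      filter_upwards [(e1.eventually (lt_mem_nhds hts)).filter_mono nhdsWithin_le_nhds] with h hh
      simp only [g, indicator_of_mem (show s ∈ Iio (t - 2 * |h|) from hh), smul_eq_mul]
  -- The omitted strips start at `t - 2|h|`, end at `t + h` and at `t`, and have total length at
  -- most `3|h| + 2|h|`. The source has size `(2|h|)^α` there, so after division by `h` they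
  -- contribute `O(|h|^α)`.
  have hrem : ∀ᶠ h : ℝ in 𝓝[≠] 0,
      |h⁻¹ • ((∫ s in t₀..t + h, f (t + h) s) - ∫ s in t₀..t, f t s) - ∫ s in t₀..t, g h s| ≤
        5 * (C * H * singProfile ν k θ ‖x‖) * (2 * |h|) ^ α := by
    filter_upwards [hsmall] with h ⟨hh0, hh1, hh2⟩
    have habs : 0 < |h| := abs_pos.2 hh0
    have hle := neg_abs_le h
    have hle' := le_abs_self h
    set a := t - 2 * |h|
    have hat : a < t := by simp only [a]; linarith
    have hath : a < t + h := by simp only [a]; linarith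
    have i1 := hv.intervalIntegrable hn hA hh1.le hath.le hx
    have i2 := hv.intervalIntegrable hn hA hath.le le_rfl hx
    have i3 := hv.intervalIntegrable hn hA hh1.le hat.le hx
    have i4 := hv.intervalIntegrable hn hA hat.le le_rfl hx
    have e1 : ∫ s in t₀..t, g h s =
        h⁻¹ * ((∫ s in t₀..a, f (t + h) s) - ∫ s in t₀..a, f t s) := by
      rw [← intervalIntegral.integral_sub i1 i3, ← intervalIntegral.integral_const_mul,
        intervalIntegral.integral_of_le h0.le, intervalIntegral.integral_of_le hh1.le,
        setIntegral_indicator measurableSet_Iio]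
      refine setIntegral_congr_set ?_
      filter_upwards [ae_ne_real a] with s hs
      exact propext ⟨fun h => ⟨h.1.1, le_of_lt h.2⟩, fun h =>
        ⟨⟨h.1, h.2.trans hat.le⟩, lt_of_le_of_ne h.2 hs⟩⟩
    have b : ∀ t', a < t' → t' ≤ t + |h| → |∫ s in a..t', f t' s| ≤
        (C * (H * (2 * |h|) ^ α) * singProfile ν k θ ‖x‖) * (t' - a) := by
      intro t' hat' ht'
      have := intervalIntegral.norm_integral_le_of_norm_le_const_ae (f := f t') (a := a) (b := t')
        (C := C * (H * (2 * |h|) ^ α) * singProfile ν k θ ‖x‖) ?_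
      · rwa [Real.norm_eq_abs, abs_of_pos (sub_pos.2 hat')] at this
      · filter_upwards [ae_ne_real t'] with s hst hs
        rw [uIoc_of_le hat'.le] at hs
        have hst' : s < t' := lt_of_le_of_ne hs.2 hst
        rw [Real.norm_eq_abs]
        refine (hf t' s ⟨by linarith [hs.1], by linarith⟩ hst' (by linarith)).trans ?_
        gcongr
        rw [abs_le]
        constructor
        · have := hs.1
          simp only [a] at this
          linarith
        · linarith
    have b1 := b (t + h) hath (by linarith)
    have b2 := b t hat (by linarith)
    have e2 : h⁻¹ • ((∫ s in t₀..t + h, f (t + h) s) - ∫ s in t₀..t, f t s) - ∫ s in t₀..t, g h s =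
        h⁻¹ * ((∫ s in a..t + h, f (t + h) s) - ∫ s in a..t, f t s) := by
      rw [e1, ← intervalIntegral.integral_add_adjacent_intervals i1 i2,
        ← intervalIntegral.integral_add_adjacent_intervals i3 i4, smul_eq_mul]
      ring
    rw [e2, abs_mul, abs_inv, inv_mul_le_iff₀ habs]
    refine (abs_sub _ _).trans ((add_le_add b1 b2).trans ?_)
    rw [← mul_add]
    have h5 : t + h - a + (t - a) ≤ 5 * |h| := by simp only [a]; linarith
    calc _ ≤ (C * (H * (2 * |h|) ^ α) * singProfile ν k θ ‖x‖) * (5 * |h|) := by gcongr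
      _ = _ := by ring
  have hrem0 : Tendsto (fun h : ℝ => 5 * (C * H * singProfile ν k θ ‖x‖) * (2 * |h|) ^ α)
      (𝓝[≠] 0) (𝓝 0) := by
    have e1 : Tendsto (fun h : ℝ => 2 * |h|) (𝓝 0) (𝓝 (2 * |0|)) :=
      Continuous.tendsto (by fun_prop) 0
    rw [abs_zero, mul_zero] at e1
    have e2 := ((Real.continuousAt_rpow_const 0 α (Or.inr hα.le)).tendsto.comp e1).const_mul
      (5 * (C * H * singProfile ν k θ ‖x‖))
    rw [Real.zero_rpow hα.ne', mul_zero] at e2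
    exact e2.mono_left nhdsWithin_le_nhds
  have hfin := (squeeze_zero_norm' hrem hrem0).add hlim
  simp only [sub_add_cancel, zero_add] at hfin
  exact (hasDerivAt_iff_tendsto_slope_zero.2 hfin).differentiableAt

/-- The Duhamel integral of a source that is Hölder continuous in time is differentiable. -/
theorem SourceBdd.differentiableAt_duhamelIntegral (hn : Admissible n ν θ) (hA : 0 ≤ A)
    (hv : SourceBdd ν k θ A v) {t₀ t t₁ α H : ℝ} (ht₀ : 0 ≤ t₀) (h0 : t₀ < t) (h1 : t < t₁)
    (hα : 0 < α) (hH : 0 ≤ H)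
    (hv' : ∀ s ∈ Icc t₀ t₁, ∀ y ≠ 0, |v y s - v y t| ≤ H * |s - t| ^ α * singProfile ν k θ ‖y‖)
    {x : EuclideanSpace ℝ (Fin n)} (hx : x ≠ 0) :
    DifferentiableAt ℝ (duhamelIntegral v x) t := by
  have hvt : Measurable fun y => v y t :=
    hv.meas.comp (by fun_prop : Measurable fun y : EuclideanSpace ℝ (Fin n) => (y, t))
  have hst : SourceBdd ν k θ A fun y _ => v y t :=
    ⟨(hvt.comp measurable_fst : Measurable fun p : EuclideanSpace ℝ (Fin n) × ℝ => v p.1 t),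
      fun _ => hv.bound t⟩
  -- On the recent interval the source is split into its value frozen at time `t` and a remainder
  -- vanishing at `t` at the Hölder rate.
  have hdiff : SourceBdd ν k θ (A + A) fun y s => v y s - v y t :=
    ⟨hv.meas.sub hst.meas, fun s => ((hv.singBdd s).sub (hv.singBdd t)).bound⟩
  have d1 := hv.differentiableAt_past hn hA ht₀ h0 hx
  have d2 := (hv.singBdd t).differentiableAt_stationary hn hA hvt h0 hx
  have d3 := hdiff.differentiableAt_recent hn (by positivity) h0 h1 hα hH
    (fun s hs => ⟨(hdiff.singBdd s).meas, hv' s hs⟩) hx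
  refine ((d1.add d2).add d3).congr_of_eventuallyEq ?_
  filter_upwards [lt_mem_nhds h0] with t' ht'
  have i1 := hv.intervalIntegrable hn hA ht₀ ht'.le hx
  have i2 := hv.intervalIntegrable hn hA ht'.le le_rfl hx
  have i3 := hst.intervalIntegrable hn hA ht'.le le_rfl hx
  have i4 := hdiff.intervalIntegrable hn (by positivity) ht'.le le_rfl hx
  simp only [Pi.add_apply]
  rw [duhamelIntegral, ← intervalIntegral.integral_add_adjacent_intervals i1 i2, add_assoc,
    ← intervalIntegral.integral_add i3 i4]
  congr 1
  refine intervalIntegral.integral_congr_ae ?_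
  filter_upwards [ae_ne_real t'] with s hs hs'
  rw [uIoc_of_le ht'.le] at hs'
  have h0 : 0 < t' - s := sub_pos.2 (lt_of_le_of_ne hs'.2 hs)
  rw [heatSemigroup_of_pos h0, heatSemigroup_of_pos h0, heatSemigroup_of_pos h0,
    ← integral_add ((hst.singBdd s).integrable hn h0 hx) ((hdiff.singBdd s).integrable hn h0 hx)]
  congr 1
  funext y
  ring

end TimeRegularity

/-! ### Sources generated by the nonlinearity and the comparison principle -/

/-- Properties of the nonlinearity `f = f(u, r)` used in the theory of mild solutions. -/
structure Nonlinearity (f : ℝ → ℝ → ℝ) (ν k θ : ℝ) : Prop where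
  cont : ContinuousOn (fun p : ℝ × ℝ => f p.1 p.2) (Ici 0 ×ˢ Ioi 0)
  zero : ∀ r > 0, f 0 r = 0
  mono : ∀ r > 0, MonotoneOn (fun u => f u r) (Ici 0)
  lip : ∀ B > 0, ∃ K > 0, ∀ r > 0, ∀ u v, 0 ≤ u → u ≤ v → v ≤ B * profile ν k r →
    f v r - f u r ≤ K * (1 + r ^ (θ - 2)) * (v - u)

/-- Continuous functions on `(ℝⁿ \ {0}) × [0, T]` with values in `[0, B · profile]`. -/
structure ProfBddOn {n : ℕ} (ν k B T : ℝ) (u : EuclideanSpace ℝ (Fin n) → ℝ → ℝ) : Prop where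
  cont : ContinuousOn (fun p : EuclideanSpace ℝ (Fin n) × ℝ => u p.1 p.2) ({0}ᶜ ×ˢ Icc 0 T)
  nonneg : ∀ x ≠ 0, ∀ t ∈ Icc 0 T, 0 ≤ u x t
  le : ∀ x ≠ 0, ∀ t ∈ Icc 0 T, u x t ≤ B * profile ν k ‖x‖

open Classical in
/-- The source `f(u, |x|)` extended by zero outside `(ℝⁿ \ {0}) × [0, T]`. -/
def truncSource {n : ℕ} (f : ℝ → ℝ → ℝ) (u : EuclideanSpace ℝ (Fin n) → ℝ → ℝ) (T : ℝ)
    (y : EuclideanSpace ℝ (Fin n)) (s : ℝ) : ℝ :=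
  if y ≠ 0 ∧ s ∈ Icc 0 T then f (u y s) ‖y‖ else 0

section Mild

variable {n : ℕ} {ν k θ B K T : ℝ} {f : ℝ → ℝ → ℝ} {u v : EuclideanSpace ℝ (Fin n) → ℝ → ℝ}
  {φ : EuclideanSpace ℝ (Fin n) → ℝ}

lemma truncSource_of_mem {y : EuclideanSpace ℝ (Fin n)} {s : ℝ} (hy : y ≠ 0) (hs : s ∈ Icc 0 T) :
    truncSource f u T y s = f (u y s) ‖y‖ := if_pos ⟨hy, hs⟩

lemma truncSource_of_notMem {y : EuclideanSpace ℝ (Fin n)} {s : ℝ} (h : ¬ (y ≠ 0 ∧ s ∈ Icc 0 T)) :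
    truncSource f u T y s = 0 := if_neg h

lemma Nonlinearity.nonneg (hf : Nonlinearity f ν k θ) {a r : ℝ} (hr : 0 < r) (ha : 0 ≤ a) :
    0 ≤ f a r := by
  rw [← hf.zero r hr]
  exact hf.mono r hr (mem_Ici.2 le_rfl) (mem_Ici.2 ha) ha

/-- The Lipschitz estimate compared with `u = 0`, where `f` vanishes. -/
lemma le_singProfile_of_lip (hf : Nonlinearity f ν k θ) (hK : 0 ≤ K)
    (hlip : ∀ r > 0, ∀ u v, 0 ≤ u → u ≤ v → v ≤ B * profile ν k r →
      f v r - f u r ≤ K * (1 + r ^ (θ - 2)) * (v - u))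
    {a r : ℝ} (hr : 0 < r) (ha : 0 ≤ a) (haB : a ≤ B * profile ν k r) :
    f a r ≤ K * B * singProfile ν k θ r := by
  have h := hlip r hr 0 a le_rfl ha haB
  rw [hf.zero r hr, sub_zero, sub_zero] at h
  refine h.trans ?_
  unfold singProfile
  calc K * (1 + r ^ (θ - 2)) * a ≤ K * (1 + r ^ (θ - 2)) * (B * profile ν k r) := by gcongr
    _ = _ := by ring

lemma ProfBddOn.continuousOn_source (hf : Nonlinearity f ν k θ) (hu : ProfBddOn ν k B T u) :
    ContinuousOn (fun p : EuclideanSpace ℝ (Fin n) × ℝ => f (u p.1 p.2) ‖p.1‖)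
      ({0}ᶜ ×ˢ Icc 0 T) := by
  have h1 : ContinuousOn (fun p : EuclideanSpace ℝ (Fin n) × ℝ => (u p.1 p.2, ‖p.1‖))
      ({0}ᶜ ×ˢ Icc 0 T) := hu.cont.prodMk (by fun_prop)
  exact hf.cont.comp h1 fun p hp => ⟨hu.nonneg p.1 hp.1 p.2 hp.2, norm_pos_iff.2 hp.1⟩

lemma measurable_truncSource_of_continuousOn
    (h : ContinuousOn (fun p : EuclideanSpace ℝ (Fin n) × ℝ => f (u p.1 p.2) ‖p.1‖)
      ({0}ᶜ ×ˢ Icc 0 T)) :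
    Measurable (Function.uncurry (truncSource f u T)) := by
  classical
  have hm : MeasurableSet (({0}ᶜ : Set (EuclideanSpace ℝ (Fin n))) ×ˢ Icc 0 T) :=
    (measurableSet_singleton _).compl.prod measurableSet_Icc
  have := h.measurable_piecewise (g := fun _ => (0 : ℝ)) continuousOn_const hm
  convert this using 1
  funext p
  simp [truncSource, Set.piecewise, Function.uncurry]

lemma abs_truncSource_le (hf : Nonlinearity f ν k θ) (hB : 0 ≤ B) (hK : 0 ≤ K)
    (hlip : ∀ r > 0, ∀ u v, 0 ≤ u → u ≤ v → v ≤ B * profile ν k r →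
      f v r - f u r ≤ K * (1 + r ^ (θ - 2)) * (v - u))
    (h0 : ∀ x ≠ 0, ∀ t ∈ Icc 0 T, 0 ≤ u x t)
    (h1 : ∀ x ≠ 0, ∀ t ∈ Icc 0 T, u x t ≤ B * profile ν k ‖x‖) :
    ∀ s, ∀ y ≠ 0, |truncSource f u T y s| ≤ K * B * singProfile ν k θ ‖y‖ := by
  intro s y hy
  have hr : 0 < ‖y‖ := norm_pos_iff.2 hy
  by_cases hs : s ∈ Icc 0 T
  · rw [truncSource_of_mem hy hs, abs_of_nonneg (hf.nonneg hr (h0 y hy s hs))]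
    exact le_singProfile_of_lip hf hK hlip hr (h0 y hy s hs) (h1 y hy s hs)
  · rw [truncSource_of_notMem fun h => hs h.2, abs_zero]
    have := singProfile_pos (ν := ν) (k := k) (θ := θ) hr
    positivity

lemma ProfBddOn.sourceBdd (hf : Nonlinearity f ν k θ) (hB : 0 ≤ B) (hK : 0 ≤ K)
    (hlip : ∀ r > 0, ∀ u v, 0 ≤ u → u ≤ v → v ≤ B * profile ν k r →
      f v r - f u r ≤ K * (1 + r ^ (θ - 2)) * (v - u)) (hu : ProfBddOn ν k B T u) :
    SourceBdd ν k θ (K * B) (truncSource f u T) :=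
  ⟨measurable_truncSource_of_continuousOn (hu.continuousOn_source hf),
    abs_truncSource_le hf hB hK hlip hu.nonneg hu.le⟩

lemma heatSemigroup_congr {ψ χ : EuclideanSpace ℝ (Fin n) → ℝ} (h : ∀ y ≠ 0, ψ y = χ y) (τ : ℝ)
    {x : EuclideanSpace ℝ (Fin n)} (hx : x ≠ 0) : heatSemigroup τ ψ x = heatSemigroup τ χ x := by
  unfold heatSemigroup
  split_ifs
  · congr 1
    refine integral_congr_ae ((ae_ne_zero hx).mono fun y hy => ?_)
    simp only [h y hy]
  · exact h x hx

lemma heatSemigroup_mono (hn : Admissible n ν θ) {A A' : ℝ}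
    {ψ χ : EuclideanSpace ℝ (Fin n) → ℝ} (hψ : SingBdd ν k θ A ψ) (hχ : SingBdd ν k θ A' χ)
    (h : ∀ y ≠ 0, ψ y ≤ χ y) (τ : ℝ) {x : EuclideanSpace ℝ (Fin n)} (hx : x ≠ 0) :
    heatSemigroup τ ψ x ≤ heatSemigroup τ χ x := by
  by_cases hτ : 0 < τ
  · rw [heatSemigroup_of_pos hτ, heatSemigroup_of_pos hτ]
    refine integral_mono_ae (hψ.integrable hn hτ hx) (hχ.integrable hn hτ hx)
      ((ae_ne_zero hx).mono fun y hy => ?_)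
    have := heatKernel_nonneg hτ (x - y)
    simp only
    gcongr
    exact h y hy
  · rw [heatSemigroup, heatSemigroup, if_neg hτ, if_neg hτ]
    exact h x hx

lemma duhamelIntegral_mono (hn : Admissible n ν θ) {A A' : ℝ} (hA : 0 ≤ A) (hA' : 0 ≤ A')
    (hu : SourceBdd ν k θ A u) (hv : SourceBdd ν k θ A' v) {t : ℝ} (ht : 0 ≤ t)
    (h : ∀ s ∈ Icc 0 t, ∀ y ≠ 0, u y s ≤ v y s) {x : EuclideanSpace ℝ (Fin n)} (hx : x ≠ 0) :
    duhamelIntegral u x t ≤ duhamelIntegral v x t :=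
  intervalIntegral.integral_mono_on ht (hu.intervalIntegrable hn hA ht le_rfl hx)
    (hv.intervalIntegrable hn hA' ht le_rfl hx) fun s hs =>
      heatSemigroup_mono hn (hu.singBdd s) (hv.singBdd s) (h s hs) _ hx

/-- Extension by zero makes the source measurable and bounded on the whole space-time, as
`SourceBdd` requires; the values at the origin do not matter to the heat semigroup evaluated at `x ≠
0`. -/
lemma duhamel_eq {t : ℝ} (ht : t ∈ Icc 0 T) {x : EuclideanSpace ℝ (Fin n)} (hx : x ≠ 0) :
    duhamel f φ u x t = heatSemigroup t φ x + duhamelIntegral (truncSource f u T) x t := by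
  unfold duhamel duhamelIntegral
  congr 1
  refine intervalIntegral.integral_congr fun s hs => ?_
  rw [uIcc_of_le ht.1] at hs
  exact heatSemigroup_congr (fun y hy => (truncSource_of_mem hy ⟨hs.1, hs.2.trans ht.2⟩).symm) _ hx

lemma ProfBddOn.duhamel_mono (hn : Admissible n ν θ) (hf : Nonlinearity f ν k θ) (hB : 0 < B)
    (hu : ProfBddOn ν k B T u) (hv : ProfBddOn ν k B T v) {t : ℝ} (ht : t ∈ Icc 0 T)
    (h : ∀ s ∈ Icc 0 t, ∀ y ≠ 0, u y s ≤ v y s) {x : EuclideanSpace ℝ (Fin n)} (hx : x ≠ 0) :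
    duhamel f φ u x t ≤ duhamel f φ v x t := by
  obtain ⟨K, hK, hlip⟩ := hf.lip B hB
  rw [duhamel_eq ht hx, duhamel_eq ht hx]
  gcongr
  refine duhamelIntegral_mono hn (by positivity) (by positivity) (hu.sourceBdd hf hB.le hK.le hlip)
    (hv.sourceBdd hf hB.le hK.le hlip) ht.1 (fun s hs y hy => ?_) hx
  have hs' : s ∈ Icc 0 T := ⟨hs.1, hs.2.trans ht.2⟩
  rw [truncSource_of_mem hy hs', truncSource_of_mem hy hs']
  exact hf.mono _ (norm_pos_iff.2 hy) (hu.nonneg y hy s hs') (hv.nonneg y hy s hs') (h s hs y hy)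

lemma heatSemigroup_nonneg {ψ : EuclideanSpace ℝ (Fin n) → ℝ} (h : ∀ y ≠ 0, 0 ≤ ψ y) (τ : ℝ)
    {x : EuclideanSpace ℝ (Fin n)} (hx : x ≠ 0) : 0 ≤ heatSemigroup τ ψ x := by
  by_cases hτ : 0 < τ
  · rw [heatSemigroup_of_pos hτ]
    exact integral_nonneg_of_ae ((ae_ne_zero hx).mono fun y hy =>
      mul_nonneg (heatKernel_nonneg hτ _) (h y hy))
  · rw [heatSemigroup, if_neg hτ]
    exact h x hx

lemma continuousOn_duhamel (hn : Admissible n ν θ) {A₀ A : ℝ} (hA₀ : 0 ≤ A₀) (hA : 0 ≤ A)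
    (hφ : ProfBdd ν k A₀ φ) (hφc : ContinuousOn φ {0}ᶜ)
    (hs : SourceBdd ν k θ A (truncSource f u T)) :
    ContinuousOn (fun p : EuclideanSpace ℝ (Fin n) × ℝ => duhamel f φ u p.1 p.2)
      ({0}ᶜ ×ˢ Icc 0 T) := by
  refine (((hφ.continuousOn_heatSemigroup hn hA₀ hφc).mono
    (prod_mono_right Icc_subset_Ici_self)).add
      (hs.continuousOn_duhamelIntegral hn hA T)).congr fun p hp => ?_
  exact duhamel_eq hp.2 hp.1

lemma SourceBdd.of_tendsto {A : ℝ} {V : ℕ → EuclideanSpace ℝ (Fin n) → ℝ → ℝ}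
    (hV : ∀ j, SourceBdd ν k θ A (V j))
    (h : ∀ y s, Tendsto (fun j => V j y s) atTop (𝓝 (v y s))) : SourceBdd ν k θ A v :=
  ⟨measurable_of_tendsto_metrizable (fun j => (hV j).meas)
      (tendsto_pi_nhds.2 fun p => h p.1 p.2),
    fun s y hy => le_of_tendsto (h y s).abs (Eventually.of_forall fun j => (hV j).bound s y hy)⟩

/-- Dominated convergence, in space for each `s < t` and then in time, with the common bound of the
sources. -/
lemma tendsto_duhamelIntegral (hn : Admissible n ν θ) {A : ℝ} (hA : 0 ≤ A)
    {V : ℕ → EuclideanSpace ℝ (Fin n) → ℝ → ℝ}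
    (hV : ∀ j, SourceBdd ν k θ A (V j))
    (h : ∀ y s, Tendsto (fun j => V j y s) atTop (𝓝 (v y s))) {t : ℝ} (ht : 0 ≤ t)
    {x : EuclideanSpace ℝ (Fin n)} (hx : x ≠ 0) :
    Tendsto (fun j => duhamelIntegral (V j) x t) atTop (𝓝 (duhamelIntegral v x t)) := by
  obtain ⟨C, hC⟩ := hn.exists_heatConst k t
  refine intervalIntegral.tendsto_integral_filter_of_dominated_convergence
    (fun s => C * A * profile ν k ‖x‖ * (t - s) ^ (θ / 2 - 1))
    (Eventually.of_forall fun j =>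
      (measurable_heatSemigroup_source (hV j).meas t x).aestronglyMeasurable)
    (Eventually.of_forall fun j => ?_)
    ((intervalIntegrable_sub_rpow (half_pos hn.pos) _ _ _).const_mul _) ?_
  · filter_upwards [ae_ne_real t] with s hst hs
    rw [uIoc_of_le ht] at hs
    rw [Real.norm_eq_abs]
    exact (hV j).abs_heatSemigroup_le hC hA (lt_of_le_of_ne hs.2 hst) (by linarith [hs.1]) hx
  · filter_upwards [ae_ne_real t] with s hst hs
    rw [uIoc_of_le ht] at hs
    have hτ : 0 < t - s := sub_pos.2 (lt_of_le_of_ne hs.2 hst)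
    simp only [heatSemigroup_of_pos hτ]
    obtain ⟨C', _, hb⟩ := hn.exists_integral_heatKernel_profile_le k (t - s)
    refine tendsto_integral_of_dominated_convergence
      (fun y => A * (heatKernel (t - s) (x - y) * singProfile ν k θ ‖y‖))
      (fun j => aestronglyMeasurable_heatKernel_mul ((hV j).singBdd s).meas x)
      ((hb _ ⟨hτ, le_rfl⟩ x hx).2.1.const_mul A) (fun j => ?_)
      (ae_of_all _ fun y => (h y s).const_mul _)
    filter_upwards [ae_ne_zero hx] with y hy
    have hK := heatKernel_nonneg hτ (x - y)
    rw [norm_mul, Real.norm_of_nonneg hK, Real.norm_eq_abs]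
    calc _ ≤ heatKernel (t - s) (x - y) * (A * singProfile ν k θ ‖y‖) := by
          gcongr; exact (hV j).bound s y hy
      _ = _ := by ring

/-- The integral is at most its extension to the half-line, `lam^(-β) Γ(β)`, which tends to zero as
`lam` grows. -/
lemma exists_exp_integral_le {β ε : ℝ} (hβ : 0 < β) (hε : 0 < ε) :
    ∃ lam > 0, ∀ t ≥ 0, ∫ s in (0 : ℝ)..t, Real.exp (-(lam * (t - s))) * (t - s) ^ (β - 1) ≤ ε := by
  have hlim : Tendsto (fun lam : ℝ => lam ^ (-β) * Real.Gamma β) atTop (𝓝 0) := by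
    simpa using (tendsto_rpow_neg_atTop hβ).mul_const (Real.Gamma β)
  obtain ⟨lam, hl, hl0⟩ := ((hlim.eventually (gt_mem_nhds hε)).and (eventually_gt_atTop 0)).exists
  refine ⟨lam, hl0, fun t ht => ?_⟩
  have h1 := Real.integral_rpow_mul_exp_neg_mul_Ioi hβ hl0
  rw [intervalIntegral.integral_comp_sub_left (fun s => Real.exp (-(lam * s)) * s ^ (β - 1)),
    sub_self, sub_zero, intervalIntegral.integral_of_le ht]
  have hint : IntegrableOn (fun s : ℝ => s ^ (β - 1) * Real.exp (-(lam * s))) (Ioi 0) := by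
    by_contra hc
    have hG := Real.Gamma_pos_of_pos hβ
    rw [integral_undef hc] at h1
    have : 0 < (1 / lam) ^ β * Real.Gamma β := by positivity
    linarith
  calc ∫ s in Ioc 0 t, Real.exp (-(lam * s)) * s ^ (β - 1)
      = ∫ s in Ioc 0 t, s ^ (β - 1) * Real.exp (-(lam * s)) := by simp only [mul_comm]
    _ ≤ ∫ s in Ioi 0, s ^ (β - 1) * Real.exp (-(lam * s)) := by
        refine setIntegral_mono_set hint ?_ (ae_of_all _ fun s hs => hs.1)
        filter_upwards [ae_restrict_mem measurableSet_Ioi] with s hs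
        have hs0 : 0 < s := hs
        simp only [Pi.zero_apply]
        positivity
    _ = lam ^ (-β) * Real.Gamma β := by
        rw [h1, one_div, Real.inv_rpow hl0.le, Real.rpow_neg hl0.le]
    _ ≤ ε := hl.le

/-- Comparison principle for mild lower and upper solutions. -/
lemma ProfBddOn.comparison (hn : Admissible n ν θ) (hf : Nonlinearity f ν k θ) (hB : 0 < B)
    (hu : ProfBddOn ν k B T u) (hv : ProfBddOn ν k B T v)
    (hu' : ∀ x ≠ 0, ∀ t ∈ Icc 0 T, u x t ≤ duhamel f φ u x t)
    (hv' : ∀ x ≠ 0, ∀ t ∈ Icc 0 T, duhamel f φ v x t ≤ v x t) :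
    ∀ x ≠ 0, ∀ t ∈ Icc 0 T, u x t ≤ v x t := by
  obtain ⟨K, hK, hlip⟩ := hf.lip B hB
  obtain ⟨C, hC⟩ := hn.exists_heatConst k T
  have hC0 := hC.pos
  obtain ⟨lam, hlam, hexp⟩ := exists_exp_integral_le (β := θ / 2) (ε := 1 / (2 * (C * K)))
    (half_pos hn.pos) (by positivity)
  have hus := hu.sourceBdd hf hB.le hK.le hlip
  have hvs := hv.sourceBdd hf hB.le hK.le hlip
  -- One application of the integral inequality halves the best constant `m`: the Lipschitz estimate
  -- and the heat bound give `C K m P e^{lam t} ∫ e^{-lam (t-s)} (t-s)^(θ/2-1) ds`, and `lam` makes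
  -- the integral at most `1/(2CK)`.
  have step : ∀ m ≥ 0, (∀ x ≠ 0, ∀ t ∈ Icc 0 T,
      u x t - v x t ≤ m * Real.exp (lam * t) * profile ν k ‖x‖) →
      ∀ x ≠ 0, ∀ t ∈ Icc 0 T, u x t - v x t ≤ m / 2 * Real.exp (lam * t) * profile ν k ‖x‖ := by
    intro m hm h x hx t ht
    have hp := profile_pos (ν := ν) (k := k) (norm_pos_iff.2 hx)
    have h1 : u x t - v x t ≤ duhamelIntegral (truncSource f u T) x t -
        duhamelIntegral (truncSource f v T) x t := by
      have e1 := hu' x hx t ht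
      have e2 := hv' x hx t ht
      rw [duhamel_eq ht hx] at e1 e2
      linarith
    refine h1.trans ?_
    have i1 := hus.intervalIntegrable hn (by positivity) ht.1 le_rfl hx
    have i2 := hvs.intervalIntegrable hn (by positivity) ht.1 le_rfl hx
    have hbnd : ∀ s ∈ Ioo 0 t, heatSemigroup (t - s) (fun y => truncSource f u T y s) x -
        heatSemigroup (t - s) (fun y => truncSource f v T y s) x ≤
        (C * K * m * profile ν k ‖x‖ * Real.exp (lam * t)) *
          (Real.exp (-(lam * (t - s))) * (t - s) ^ (θ / 2 - 1)) := by
      intro s hs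
      have hτ : 0 < t - s := sub_pos.2 hs.2
      have hsT : s ∈ Icc 0 T := ⟨hs.1.le, hs.2.le.trans ht.2⟩
      have hV : SingBdd (n := n) ν k θ (K * (m * Real.exp (lam * s)))
          fun y => K * (m * Real.exp (lam * s)) * singProfile ν k θ ‖y‖ := by
        refine ⟨(((measurable_singProfile ν k θ).comp measurable_norm).const_mul
          _).aestronglyMeasurable, fun y hy => ?_⟩
        have := singProfile_pos (ν := ν) (k := k) (θ := θ) (norm_pos_iff.2 hy)
        rw [abs_of_nonneg (by positivity)]
      have e1 : heatSemigroup (t - s) (fun y => truncSource f u T y s) x -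
          heatSemigroup (t - s) (fun y => truncSource f v T y s) x =
          heatSemigroup (t - s) (fun y => truncSource f u T y s - truncSource f v T y s) x := by
        rw [heatSemigroup_of_pos hτ, heatSemigroup_of_pos hτ, heatSemigroup_of_pos hτ,
          ← integral_sub ((hus.singBdd s).integrable hn hτ hx)
            ((hvs.singBdd s).integrable hn hτ hx)]
        simp only [mul_sub]
      rw [e1]
      refine (heatSemigroup_mono hn ((hus.singBdd s).sub (hvs.singBdd s)) hV (fun y hy => ?_)
        (t - s) hx).trans ?_
      · rw [truncSource_of_mem hy hsT, truncSource_of_mem hy hsT]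
        have hr : 0 < ‖y‖ := norm_pos_iff.2 hy
        have hpy := profile_pos (ν := ν) (k := k) hr
        have hrp : 0 < ‖y‖ ^ (θ - 2) := by positivity
        -- Where `u ≤ v`, monotonicity of `f` already makes the difference of the sources
        -- nonpositive, so no lower bound on `u - v` is needed.
        rcases le_total (u y s) (v y s) with h2 | h2
        · have := hf.mono _ hr (hu.nonneg y hy s hsT) (hv.nonneg y hy s hsT) h2
          have hs' := singProfile_pos (ν := ν) (k := k) (θ := θ) hr
          have : 0 ≤ K * (m * Real.exp (lam * s)) * singProfile ν k θ ‖y‖ := by positivity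
          simp only at *
          linarith
        · refine (hlip _ hr _ _ (hv.nonneg y hy s hsT) h2 (hu.le y hy s hsT)).trans ?_
          have := h y hy s hsT
          unfold singProfile
          calc _ ≤ K * (1 + ‖y‖ ^ (θ - 2)) * (m * Real.exp (lam * s) * profile ν k ‖y‖) := by
                gcongr
            _ = _ := by ring
      · refine (le_abs_self _).trans ((hC.sing _ (by positivity) _ hV (t - s)
          ⟨hτ, by linarith [hs.1, ht.2]⟩ x hx).trans (le_of_eq ?_))
        have e2 : Real.exp (lam * s) = Real.exp (lam * t) * Real.exp (-(lam * (t - s))) := by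
          rw [← Real.exp_add]; ring_nf
        rw [e2]
        ring
    have hcont : Continuous fun s : ℝ => Real.exp (-(lam * (t - s))) := by fun_prop
    have i3 : IntervalIntegrable (fun s => (C * K * m * profile ν k ‖x‖ * Real.exp (lam * t)) *
          (Real.exp (-(lam * (t - s))) * (t - s) ^ (θ / 2 - 1))) volume 0 t :=
      ((intervalIntegrable_sub_rpow (half_pos hn.pos) 0 t t).continuousOn_mul
        hcont.continuousOn).const_mul _
    rw [duhamelIntegral, duhamelIntegral, ← intervalIntegral.integral_sub i1 i2]
    refine (intervalIntegral.integral_mono_on_of_le_Ioo ht.1 (i1.sub i2) i3 hbnd).trans ?_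
    rw [intervalIntegral.integral_const_mul]
    calc _ ≤ (C * K * m * profile ν k ‖x‖ * Real.exp (lam * t)) * (1 / (2 * (C * K))) := by
          gcongr; exact hexp t ht.1
      _ = _ := by field_simp
  have iter : ∀ j : ℕ, ∀ x ≠ 0, ∀ t ∈ Icc 0 T,
      u x t - v x t ≤ B / 2 ^ j * Real.exp (lam * t) * profile ν k ‖x‖ := by
    intro j
    induction j with
    | zero =>
      intro x hx t ht
      have hp := profile_pos (ν := ν) (k := k) (norm_pos_iff.2 hx)
      have h1 := hu.le x hx t ht
      have h2 := hv.nonneg x hx t ht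
      have h3 : 1 ≤ Real.exp (lam * t) := Real.one_le_exp (mul_nonneg hlam.le ht.1)
      have h4 : B * profile ν k ‖x‖ * 1 ≤ B * profile ν k ‖x‖ * Real.exp (lam * t) := by gcongr
      simp only [pow_zero, div_one]
      linarith
    | succ j ih =>
      have := step (B / 2 ^ j) (by positivity) ih
      rwa [div_div, ← pow_succ] at this
  intro x hx t ht
  have hlim : Tendsto (fun j : ℕ => B / 2 ^ j * Real.exp (lam * t) * profile ν k ‖x‖) atTop
      (𝓝 0) := by
    have h1 : Tendsto (fun j : ℕ => (2 : ℝ) ^ j) atTop atTop :=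
      tendsto_pow_atTop_atTop_of_one_lt one_lt_two
    simpa using ((tendsto_const_nhds (x := B)).div_atTop h1).mul_const (Real.exp (lam * t))
      |>.mul_const (profile ν k ‖x‖)
  have := ge_of_tendsto hlim (Eventually.of_forall fun j => iter j x hx t ht)
  linarith

end Mild

/-! ### Monotone iteration, maximal solutions and radial symmetry -/

/-- The monotone iteration `u₀ = 0`, `u_{j+1} = F_φ(u_j)`. -/
def duhamelIterate {n : ℕ} (f : ℝ → ℝ → ℝ) (φ : EuclideanSpace ℝ (Fin n) → ℝ) :
    ℕ → EuclideanSpace ℝ (Fin n) → ℝ → ℝ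
  | 0 => fun _ _ => 0
  | j + 1 => duhamel f φ (duhamelIterate f φ j)

section Existence

variable {n : ℕ} {ν ℓ δ θ : ℝ} {f : ℝ → ℝ → ℝ} {φ : EuclideanSpace ℝ (Fin n) → ℝ} {T : EReal}
  {u v : EuclideanSpace ℝ (Fin n) → ℝ → ℝ}

lemma ProfBddOn.mono_const {k B B' S : ℝ} (h : ProfBddOn ν k B S u) (hB : B ≤ B') :
    ProfBddOn ν k B' S u :=
  ⟨h.cont, h.nonneg, fun x hx t ht => (h.le x hx t ht).trans
    (mul_le_mul_of_nonneg_right hB (profile_pos (norm_pos_iff.2 hx)).le)⟩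

/-- Together with `inCSTime_of_profBddOn` this translates between bounds against the weight and
bounds by the profile on compact time intervals. -/
lemma InCSTime.exists_profBddOn (h : InCSTime (weight ν ℓ δ) T u) {S : ℝ} (hS : 0 < S)
    (hST : (S : EReal) < T) : ∃ B > 0, ProfBddOn ν (ℓ / δ) B S u := by
  obtain ⟨B, hB⟩ := h.bdd S hS hST
  refine ⟨max (2 ^ |ν - ℓ / δ| * B) 1, lt_max_of_lt_right one_pos, h.cont S hS hST,
    fun x hx t ht => h.nonneg x hx t ht.1 (lt_of_le_of_lt (EReal.coe_le_coe_iff.2 ht.2) hST),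
    fun x hx t ht => ?_⟩
  have hp := profile_pos (ν := ν) (k := ℓ / δ) (norm_pos_iff.2 hx)
  refine (le_abs_self _).trans ((le_profile_of_mul_weight_le hx (hB x hx t ht)).trans ?_)
  gcongr
  exact le_max_left _ _

lemma inCSTime_of_profBddOn (h : ∀ S : ℝ, 0 < S → (S : EReal) < T →
    ∃ B > 0, ProfBddOn ν (ℓ / δ) B S u) : InCSTime (weight ν ℓ δ) T u := by
  refine ⟨fun S hS hST => (h S hS hST).choose_spec.2.cont, fun x hx t ht htT => ?_,
    fun S hS hST => ?_⟩
  · obtain ⟨S, hS1, hS2⟩ := EReal.lt_iff_exists_real_btwn.1 htT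
    have hS1' : t < S := EReal.coe_lt_coe_iff.1 hS1
    obtain ⟨B, hB, hu⟩ := h S (ht.trans_lt hS1') hS2
    exact hu.nonneg x hx t ⟨ht, hS1'.le⟩
  · obtain ⟨B, hB, hu⟩ := h S hS hST
    refine ⟨_, fun x hx t ht => mul_weight_le_of_le_profile hx hB.le ?_⟩
    rw [abs_of_nonneg (hu.nonneg x hx t ht)]
    exact hu.le x hx t ht

lemma Admissible.exists_ne_zero (hn : Admissible n ν θ) :
    ∃ x : EuclideanSpace ℝ (Fin n), x ≠ 0 := by
  have h1 := hn.lt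
  have h2 := hn.nonneg
  have hpos : 0 < n := by
    have : (0 : ℝ) < n := by linarith
    exact_mod_cast this
  have : Nontrivial (EuclideanSpace ℝ (Fin n)) :=
    Module.nontrivial_of_finrank_pos (R := ℝ) (by simpa using hpos)
  exact exists_ne 0

lemma InCS.exists_profBdd (hn : Admissible n ν θ) (h : InCS (weight ν ℓ δ) φ) :
    ∃ A > 0, ProfBdd ν (ℓ / δ) A φ := by
  obtain ⟨B, hB⟩ := h.bdd
  obtain ⟨x, hx⟩ := hn.exists_ne_zero
  refine ⟨max (2 ^ |ν - ℓ / δ| * B) 1, lt_max_of_lt_right one_pos,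
    aestronglyMeasurable_of_continuousOn hx h.cont, fun x hx => ?_⟩
  have hp := profile_pos (ν := ν) (k := ℓ / δ) (norm_pos_iff.2 hx)
  refine (le_profile_of_mul_weight_le hx (hB x hx)).trans ?_
  gcongr
  exact le_max_left _ _

lemma exists_real_between {t : ℝ} (htT : (t : EReal) < T) : ∃ S : ℝ, t < S ∧ (S : EReal) < T := by
  obtain ⟨S, hS1, hS2⟩ := EReal.lt_iff_exists_real_btwn.1 htT
  exact ⟨S, EReal.coe_lt_coe_iff.1 hS1, hS2⟩

lemma coe_lt_of_mem_Icc {t S : ℝ} (ht : t ∈ Icc 0 S) (hST : (S : EReal) < T) : (t : EReal) < T :=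
  lt_of_le_of_lt (EReal.coe_le_coe_iff.2 ht.2) hST

lemma IsMildSolution.isMildUpper {w : EuclideanSpace ℝ (Fin n) → ℝ}
    (h : IsMildSolution f w φ T u) : IsMildUpper f w φ T u :=
  ⟨h.mem, fun x hx t ht htT => (h.eq x hx t ht htT).ge⟩

lemma IsMildSolution.isMildLower {w : EuclideanSpace ℝ (Fin n) → ℝ}
    (h : IsMildSolution f w φ T u) : IsMildLower f w φ T u :=
  ⟨h.mem, fun x hx t ht htT => (h.eq x hx t ht htT).le⟩

lemma InCSTime.mono {w : EuclideanSpace ℝ (Fin n) → ℝ} {T' : EReal} (h : InCSTime w T u)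
    (hT : T' ≤ T) : InCSTime w T' u :=
  ⟨fun S hS hST => h.cont S hS (hST.trans_le hT),
    fun x hx t ht htT => h.nonneg x hx t ht (htT.trans_le hT),
    fun S hS hST => h.bdd S hS (hST.trans_le hT)⟩

/-- Comparison principle. -/
lemma IsMildLower.le_upper (hn : Admissible n ν θ) (hf : Nonlinearity f ν (ℓ / δ) θ)
    (hu : IsMildLower f (weight ν ℓ δ) φ T u) (hv : IsMildUpper f (weight ν ℓ δ) φ T v) :
    ∀ x ≠ 0, ∀ t : ℝ, 0 ≤ t → (t : EReal) < T → u x t ≤ v x t := by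
  intro x hx t ht htT
  obtain ⟨S, hS1, hS2⟩ := exists_real_between htT
  have hS0 := ht.trans_lt hS1
  obtain ⟨B₁, hB₁, h₁⟩ := hu.mem.exists_profBddOn hS0 hS2
  obtain ⟨B₂, hB₂, h₂⟩ := hv.mem.exists_profBddOn hS0 hS2
  exact ProfBddOn.comparison hn hf (lt_max_of_lt_left hB₁) (h₁.mono_const (le_max_left B₁ B₂))
    (h₂.mono_const (le_max_right B₁ B₂))
    (fun x hx t ht => hu.le x hx t ht.1 (coe_lt_of_mem_Icc ht hS2))
    (fun x hx t ht => hv.ge x hx t ht.1 (coe_lt_of_mem_Icc ht hS2)) x hx t ⟨ht, hS1.le⟩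

lemma duhamel_nonneg {k S : ℝ} (hf : Nonlinearity f ν k θ) (hφ : ∀ x ≠ 0, 0 ≤ φ x)
    (hu : ∀ x ≠ 0, ∀ t ∈ Icc 0 S, 0 ≤ u x t) {t : ℝ} (ht : t ∈ Icc 0 S)
    {x : EuclideanSpace ℝ (Fin n)} (hx : x ≠ 0) : 0 ≤ duhamel f φ u x t := by
  refine add_nonneg (heatSemigroup_nonneg hφ t hx)
    (intervalIntegral.integral_nonneg ht.1 fun s hs => heatSemigroup_nonneg (fun y hy => ?_) _ hx)
  exact hf.nonneg (norm_pos_iff.2 hy) (hu y hy s ⟨hs.1, hs.2.trans ht.2⟩)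

/-- The iterates increase and stay below an upper solution. -/
lemma duhamelIterate_spec {k A₀ B S : ℝ} (hn : Admissible n ν θ) (hf : Nonlinearity f ν k θ)
    (hA₀ : 0 ≤ A₀) (hφ : ProfBdd ν k A₀ φ) (hφc : ContinuousOn φ {0}ᶜ)
    (hφ0 : ∀ x ≠ 0, 0 ≤ φ x) (hB : 0 < B) (hv : ProfBddOn ν k B S v)
    (hv' : ∀ x ≠ 0, ∀ t ∈ Icc 0 S, duhamel f φ v x t ≤ v x t) (j : ℕ) :
    ProfBddOn ν k B S (duhamelIterate f φ j) ∧
      (∀ x ≠ 0, ∀ t ∈ Icc 0 S, duhamelIterate f φ j x t ≤ v x t) ∧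
      (∀ x ≠ 0, ∀ t ∈ Icc 0 S, duhamelIterate f φ j x t ≤ duhamelIterate f φ (j + 1) x t) := by
  obtain ⟨K, hK, hlip⟩ := hf.lip B hB
  induction j with
  | zero =>
    refine ⟨⟨continuousOn_const, fun x hx t ht => le_rfl, fun x hx t ht => ?_⟩,
      fun x hx t ht => hv.nonneg x hx t ht, fun x hx t ht =>
        duhamel_nonneg hf hφ0 (fun x hx t ht => le_rfl) ht hx⟩
    have hp := profile_pos (ν := ν) (k := k) (norm_pos_iff.2 hx)
    simp only [duhamelIterate]
    positivity
  | succ j ih =>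
    obtain ⟨h1, h2, h3⟩ := ih
    have h4 : ∀ x ≠ 0, ∀ t ∈ Icc 0 S, duhamelIterate f φ (j + 1) x t ≤ v x t :=
      fun x hx t ht => (h1.duhamel_mono hn hf hB hv ht
        (fun s hs y hy => h2 y hy s ⟨hs.1, hs.2.trans ht.2⟩) hx).trans (hv' x hx t ht)
    have h5 : ProfBddOn ν k B S (duhamelIterate f φ (j + 1)) :=
      ⟨continuousOn_duhamel hn hA₀ (by positivity) hφ hφc (h1.sourceBdd hf hB.le hK.le hlip),
        fun x hx t ht => duhamel_nonneg hf hφ0 h1.nonneg ht hx,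
        fun x hx t ht => (h4 x hx t ht).trans (hv.le x hx t ht)⟩
    exact ⟨h5, h4, fun x hx t ht => h1.duhamel_mono hn hf hB h5 ht
      (fun s hs y hy => h3 y hy s ⟨hs.1, hs.2.trans ht.2⟩) hx⟩

/-- The limit of the monotone iteration solves the integral equation. -/
lemma iSup_duhamelIterate_spec {k A₀ B S : ℝ} (hn : Admissible n ν θ) (hf : Nonlinearity f ν k θ)
    (hA₀ : 0 ≤ A₀) (hφ : ProfBdd ν k A₀ φ) (hφc : ContinuousOn φ {0}ᶜ)
    (hφ0 : ∀ x ≠ 0, 0 ≤ φ x) (hB : 0 < B) (hv : ProfBddOn ν k B S v)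
    (hv' : ∀ x ≠ 0, ∀ t ∈ Icc 0 S, duhamel f φ v x t ≤ v x t) :
    ProfBddOn ν k B S (fun x t => ⨆ j, duhamelIterate f φ j x t) ∧
      ∀ x ≠ 0, ∀ t ∈ Icc 0 S, ⨆ j, duhamelIterate f φ j x t =
        duhamel f φ (fun x t => ⨆ j, duhamelIterate f φ j x t) x t := by
  obtain ⟨K, hK, hlip⟩ := hf.lip B hB
  have spec := duhamelIterate_spec hn hf hA₀ hφ hφc hφ0 hB hv hv'
  set u : EuclideanSpace ℝ (Fin n) → ℝ → ℝ := fun x t => ⨆ j, duhamelIterate f φ j x t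
  have hlim : ∀ x ≠ 0, ∀ t ∈ Icc 0 S,
      Tendsto (fun j => duhamelIterate f φ j x t) atTop (𝓝 (u x t)) := fun x hx t ht =>
    -- The upper solution bounds the iterates, as the conditionally complete supremum in `ℝ`
    -- requires.
    tendsto_atTop_ciSup (monotone_nat_of_le_succ fun j => (spec j).2.2 x hx t ht)
      ⟨v x t, by rintro _ ⟨j, rfl⟩; exact (spec j).2.1 x hx t ht⟩
  have h0 : ∀ x ≠ 0, ∀ t ∈ Icc 0 S, 0 ≤ u x t := fun x hx t ht =>
    ge_of_tendsto (hlim x hx t ht) (Eventually.of_forall fun j => (spec j).1.nonneg x hx t ht)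
  have h1 : ∀ x ≠ 0, ∀ t ∈ Icc 0 S, u x t ≤ B * profile ν k ‖x‖ := fun x hx t ht =>
    le_of_tendsto (hlim x hx t ht) (Eventually.of_forall fun j => (spec j).1.le x hx t ht)
  have hsrc : ∀ j, SourceBdd ν k θ (K * B) (truncSource f (duhamelIterate f φ j) S) := fun j =>
    (spec j).1.sourceBdd hf hB.le hK.le hlip
  have hconv : ∀ y s, Tendsto (fun j => truncSource f (duhamelIterate f φ j) S y s) atTop
      (𝓝 (truncSource f u S y s)) := by
    intro y s
    by_cases hys : y ≠ 0 ∧ s ∈ Icc 0 S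
    · simp only [truncSource_of_mem hys.1 hys.2]
      have hr : 0 < ‖y‖ := norm_pos_iff.2 hys.1
      have hc := hf.cont (u y s, ‖y‖) ⟨h0 y hys.1 s hys.2, hr⟩
      refine hc.tendsto.comp (tendsto_nhdsWithin_iff.2 ⟨(hlim y hys.1 s hys.2).prodMk_nhds
        tendsto_const_nhds, Eventually.of_forall fun j => ⟨(spec j).1.nonneg y hys.1 s hys.2, hr⟩⟩)
    · simp only [truncSource_of_notMem hys]
      exact tendsto_const_nhds
  have husrc := SourceBdd.of_tendsto hsrc hconv
  have heq : ∀ x ≠ 0, ∀ t ∈ Icc 0 S, u x t = duhamel f φ u x t := by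
    intro x hx t ht
    refine tendsto_nhds_unique ((hlim x hx t ht).comp (tendsto_add_atTop_nat 1)) ?_
    have h2 := (tendsto_duhamelIntegral hn (by positivity) hsrc hconv ht.1 hx).const_add
      (heatSemigroup t φ x)
    rw [← duhamel_eq ht hx] at h2
    refine h2.congr fun j => ?_
    rw [← duhamel_eq ht hx]
    rfl
  refine ⟨⟨?_, h0, h1⟩, heq⟩
  exact (continuousOn_duhamel hn hA₀ (by positivity) hφ hφc husrc).congr fun p hp =>
    heq p.1 hp.1 p.2 hp.2

/-- An upper solution gives rise to a solution on the same time interval. -/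
lemma IsMildUpper.exists_isMildSolution (hn : Admissible n ν θ) (hf : Nonlinearity f ν (ℓ / δ) θ)
    (hφ : InCS (weight ν ℓ δ) φ) (hv : IsMildUpper f (weight ν ℓ δ) φ T v) :
    ∃ u, IsMildSolution f (weight ν ℓ δ) φ T u := by
  obtain ⟨A₀, hA₀, hφb⟩ := hφ.exists_profBdd hn
  -- The iterates involve neither `S` nor the upper solution, so one and the same limit works for
  -- every `S < T`.
  have key : ∀ S : ℝ, 0 < S → (S : EReal) < T → ∃ B > 0,
      ProfBddOn ν (ℓ / δ) B S (fun x t => ⨆ j, duhamelIterate f φ j x t) ∧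
      ∀ x ≠ 0, ∀ t ∈ Icc 0 S, ⨆ j, duhamelIterate f φ j x t =
        duhamel f φ (fun x t => ⨆ j, duhamelIterate f φ j x t) x t := by
    intro S hS hST
    obtain ⟨B, hB, hvB⟩ := hv.mem.exists_profBddOn hS hST
    exact ⟨B, hB, iSup_duhamelIterate_spec hn hf hA₀.le hφb hφ.cont hφ.nonneg hB hvB
      fun x hx t ht => hv.ge x hx t ht.1 (coe_lt_of_mem_Icc ht hST)⟩
  refine ⟨fun x t => ⨆ j, duhamelIterate f φ j x t, inCSTime_of_profBddOn fun S hS hST => ?_,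
    fun x hx t ht htT => ?_⟩
  · obtain ⟨B, hB, h, -⟩ := key S hS hST
    exact ⟨B, hB, h⟩
  · obtain ⟨S, hS1, hS2⟩ := exists_real_between htT
    obtain ⟨B, hB, -, h⟩ := key S (ht.trans_lt hS1) hS2
    exact h x hx t ⟨ht, hS1.le⟩

/-- A large multiple of the profile is an upper solution for a short time. -/
lemma exists_isMildUpper (hn : Admissible n ν θ) (hf : Nonlinearity f ν (ℓ / δ) θ)
    (hφ : InCS (weight ν ℓ δ) φ) :
    ∃ (T : EReal) (v : EuclideanSpace ℝ (Fin n) → ℝ → ℝ), 0 < T ∧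
      IsMildUpper f (weight ν ℓ δ) φ T v := by
  obtain ⟨A₀, hA₀, hφb⟩ := hφ.exists_profBdd hn
  set k := ℓ / δ
  obtain ⟨C, hC⟩ := hn.exists_heatConst k 1
  have hC0 := hC.pos
  -- Half of `A` covers `e^{tΔ}φ`, by `C A₀` for `t > 0` and by `A₀` for `t = 0`; the other half is
  -- left for the source. `K` depends on `A`, and the time `S` is chosen last so that `C K
  -- S^(θ/2)/(θ/2) < 1/2`.
  set A := 2 * (C * A₀ + A₀)
  have hA : 0 < A := by positivity
  obtain ⟨K, hK, hlip⟩ := hf.lip A hA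
  have hθ := hn.pos
  have hlim : Tendsto (fun t : ℝ => C * K * (t ^ (θ / 2) / (θ / 2))) (𝓝[>] 0) (𝓝 0) := by
    have h1 : Tendsto (fun ε : ℝ => ε ^ (θ / 2)) (𝓝 0) (𝓝 (0 ^ (θ / 2))) :=
      (Real.continuousAt_rpow_const 0 (θ / 2) (Or.inr (by positivity))).tendsto
    rw [Real.zero_rpow (by positivity)] at h1
    have := (h1.div_const (θ / 2)).const_mul (C * K)
    simp only [zero_div, mul_zero] at this
    exact this.mono_left nhdsWithin_le_nhds
  obtain ⟨S, ⟨hS, hS1⟩, hS0⟩ := ((hlim.eventually (gt_mem_nhds one_half_pos)).and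
    (mem_nhdsWithin_of_mem_nhds (gt_mem_nhds one_pos)) |>.and self_mem_nhdsWithin).exists
  have hS0' : 0 < S := hS0
  have hv : ∀ R : ℝ, ProfBddOn (n := n) ν k A R fun x _ => A * profile ν k ‖x‖ := fun R =>
    ⟨(continuousOn_profile_norm.const_mul A |>.comp continuousOn_fst fun p hp => hp.1),
      fun x hx t ht => (mul_pos hA (profile_pos (norm_pos_iff.2 hx))).le,
      fun x hx t ht => le_rfl⟩
  refine ⟨S, fun x _ => A * profile ν k ‖x‖, by exact_mod_cast hS0',
    inCSTime_of_profBddOn fun R _ _ => ⟨A, hA, hv R⟩, fun x hx t ht htS => ?_⟩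
  have htS' : t < S := EReal.coe_lt_coe_iff.1 htS
  have hp := profile_pos (ν := ν) (k := k) (norm_pos_iff.2 hx)
  have hsrc := (hv S).sourceBdd hf hA.le hK.le hlip
  rw [duhamel_eq (T := S) ⟨ht, htS'.le⟩ hx]
  have hS1' : S < 1 := hS1
  have e1 : heatSemigroup t φ x ≤ A / 2 * profile ν k ‖x‖ := by
    have h1 : 0 ≤ C * A₀ * profile ν k ‖x‖ := by positivity
    have h2 : 0 ≤ A₀ * profile ν k ‖x‖ := by positivity
    simp only [A]
    rcases ht.eq_or_lt with rfl | ht0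
    · rw [heatSemigroup_zero]
      linarith [(le_abs_self _).trans (hφb.bound x hx)]
    · linarith [(le_abs_self _).trans (hC.prof A₀ hA₀.le φ hφb t ⟨ht0, by linarith⟩ x hx)]
  have e2 : duhamelIntegral (truncSource f (fun x _ => A * profile ν k ‖x‖) S) x t ≤
      A / 2 * profile ν k ‖x‖ := by
    refine (le_abs_self _).trans ((hsrc.abs_integral_le hn hC (by positivity) ht (by linarith)
      hx).trans ?_)
    rw [sub_zero]
    have h3 : t ^ (θ / 2) / (θ / 2) ≤ S ^ (θ / 2) / (θ / 2) := by gcongr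
    have h4 : C * K * (S ^ (θ / 2) / (θ / 2)) ≤ 1 / 2 := le_of_lt hS
    calc C * (K * A) * profile ν k ‖x‖ * (t ^ (θ / 2) / (θ / 2))
        ≤ C * (K * A) * profile ν k ‖x‖ * (S ^ (θ / 2) / (θ / 2)) := by gcongr
      _ = (C * K * (S ^ (θ / 2) / (θ / 2))) * (A * profile ν k ‖x‖) := by ring
      _ ≤ 1 / 2 * (A * profile ν k ‖x‖) := by gcongr
      _ = _ := by ring
  linarith

lemma IsMildSolution.unique {T' : EReal} (hn : Admissible n ν θ)
    (hf : Nonlinearity f ν (ℓ / δ) θ) (hu : IsMildSolution f (weight ν ℓ δ) φ T u)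
    (hv : IsMildSolution f (weight ν ℓ δ) φ T' v) {x : EuclideanSpace ℝ (Fin n)} (hx : x ≠ 0)
    {t : ℝ} (ht : 0 ≤ t) (htT : (t : EReal) < T) (htT' : (t : EReal) < T') : u x t = v x t := by
  have hu' : IsMildSolution f (weight ν ℓ δ) φ (min T T') u :=
    ⟨hu.mem.mono (min_le_left _ _), fun x hx t ht h => hu.eq x hx t ht (lt_min_iff.1 h).1⟩
  have hv' : IsMildSolution f (weight ν ℓ δ) φ (min T T') v :=
    ⟨hv.mem.mono (min_le_right _ _), fun x hx t ht h => hv.eq x hx t ht (lt_min_iff.1 h).2⟩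
  exact le_antisymm
    (hu'.isMildLower.le_upper hn hf hv'.isMildUpper x hx t ht (lt_min htT htT'))
    (hv'.isMildLower.le_upper hn hf hu'.isMildUpper x hx t ht (lt_min htT htT'))

lemma ProfBddOn.congr {k B S : ℝ} (h : ProfBddOn ν k B S u)
    (huv : ∀ x ≠ 0, ∀ t ∈ Icc 0 S, v x t = u x t) : ProfBddOn ν k B S v :=
  ⟨h.cont.congr fun p hp => huv p.1 hp.1 p.2 hp.2,
    fun x hx t ht => by rw [huv x hx t ht]; exact h.nonneg x hx t ht,
    fun x hx t ht => by rw [huv x hx t ht]; exact h.le x hx t ht⟩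

lemma duhamel_congr {t : ℝ} (ht : 0 ≤ t) (huv : ∀ x ≠ 0, ∀ s ∈ Icc 0 t, u x s = v x s)
    {x : EuclideanSpace ℝ (Fin n)} (hx : x ≠ 0) : duhamel f φ u x t = duhamel f φ v x t := by
  unfold duhamel
  congr 1
  refine intervalIntegral.integral_congr fun s hs => ?_
  rw [uIcc_of_le ht] at hs
  exact heatSemigroup_congr (fun y hy => by rw [huv y hy s hs]) _ hx

/-- Existence and uniqueness of the maximal solution. -/
theorem exists_isUniqueMaximalSolution (hn : Admissible n ν θ)
    (hf : Nonlinearity f ν (ℓ / δ) θ) (hφ : InCS (weight ν ℓ δ) φ) :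
    ∃ (T : EReal) (u : EuclideanSpace ℝ (Fin n) → ℝ → ℝ),
      IsUniqueMaximalSolution f (weight ν ℓ δ) φ T u := by
  classical
  -- The maximal time is the supremum of all existence times. The solution chosen at each `t` may
  -- vary with `t`, but uniqueness makes the choices agree.
  set 𝒯 : Set EReal := {T | ∃ v, IsMildSolution f (weight ν ℓ δ) φ T v}
  obtain ⟨T₀, v₀, hT₀, hv₀⟩ := exists_isMildUpper hn hf hφ
  have hT₀' : T₀ ∈ 𝒯 := hv₀.exists_isMildSolution hn hf hφ
  have hex : ∀ t : ℝ, (t : EReal) < sSup 𝒯 → ∃ v T, (t : EReal) < T ∧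
      IsMildSolution f (weight ν ℓ δ) φ T v := by
    intro t ht
    obtain ⟨T, ⟨v, hv⟩, htT⟩ := lt_sSup_iff.1 ht
    exact ⟨v, T, htT, hv⟩
  set u : EuclideanSpace ℝ (Fin n) → ℝ → ℝ := fun x t =>
    if h : (t : EReal) < sSup 𝒯 then (hex t h).choose x t else 0
  have hu : ∀ T v, IsMildSolution f (weight ν ℓ δ) φ T v → ∀ x ≠ 0, ∀ t : ℝ, 0 ≤ t →
      (t : EReal) < T → v x t = u x t := by
    intro T v hv x hx t ht htT
    have h : (t : EReal) < sSup 𝒯 := htT.trans_le (le_sSup ⟨v, hv⟩)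
    obtain ⟨T', htT', hT'⟩ := (hex t h).choose_spec
    simp only [u, dif_pos h]
    exact hv.unique hn hf hT' hx ht htT htT'
  refine ⟨sSup 𝒯, u, hT₀.trans_le (le_sSup hT₀'), ⟨inCSTime_of_profBddOn fun S hS hST => ?_,
    fun x hx t ht htT => ?_⟩, fun T v hv => ⟨le_sSup ⟨v, hv⟩, hu T v hv⟩⟩
  · obtain ⟨v, T, hST', hv⟩ := hex S hST
    obtain ⟨B, hB, hvB⟩ := hv.mem.exists_profBddOn hS hST'
    exact ⟨B, hB, hvB.congr fun x hx t ht =>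
      (hu T v hv x hx t ht.1 (coe_lt_of_mem_Icc ht hST')).symm⟩
  · obtain ⟨v, T, htT', hv⟩ := hex t htT
    rw [← hu T v hv x hx t ht htT', hv.eq x hx t ht htT']
    exact duhamel_congr ht (fun y hy s hs => hu T v hv y hy s hs.1 (coe_lt_of_mem_Icc hs htT')) hx

/-- Lebesgue measure and the Gaussian are invariant under linear isometries. -/
lemma heatSemigroup_comp_isometry (R : EuclideanSpace ℝ (Fin n) ≃ₗᵢ[ℝ] EuclideanSpace ℝ (Fin n))
    (ψ : EuclideanSpace ℝ (Fin n) → ℝ) (τ : ℝ) (x : EuclideanSpace ℝ (Fin n)) :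
    heatSemigroup τ ψ (R x) = heatSemigroup τ (fun y => ψ (R y)) x := by
  unfold heatSemigroup
  split_ifs
  · congr 1
    rw [← R.measurePreserving.integral_comp R.toHomeomorph.measurableEmbedding]
    refine integral_congr_ae (ae_of_all _ fun y => ?_)
    simp only [← map_sub, LinearIsometryEquiv.norm_map]
  · rfl

lemma duhamel_comp_isometry (R : EuclideanSpace ℝ (Fin n) ≃ₗᵢ[ℝ] EuclideanSpace ℝ (Fin n))
    (x : EuclideanSpace ℝ (Fin n)) (t : ℝ) :
    duhamel f φ u (R x) t = duhamel f (fun y => φ (R y)) (fun y s => u (R y) s) x t := by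
  unfold duhamel
  simp only [heatSemigroup_comp_isometry, LinearIsometryEquiv.norm_map]

/-- The solution with a radial datum is radial. -/
lemma IsMildSolution.radial (hn : Admissible n ν θ) (hf : Nonlinearity f ν (ℓ / δ) θ)
    (hu : IsMildSolution f (weight ν ℓ δ) φ T u)
    (hφ : ∀ x y, x ≠ 0 → y ≠ 0 → ‖x‖ = ‖y‖ → φ x = φ y) {x y : EuclideanSpace ℝ (Fin n)}
    (hx : x ≠ 0) (hxy : ‖x‖ = ‖y‖) {t : ℝ} (ht : 0 ≤ t) (htT : (t : EReal) < T) :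
    u x t = u y t := by
  -- The reflection in the hyperplane orthogonal to `x - y` takes `x` to `y` because their norms
  -- agree; the reflected solution has the same datum, and uniqueness applies.
  set R := (Submodule.reflection (ℝ ∙ (x - y))ᗮ)
  have hR : R x = y := Submodule.reflection_sub hxy
  have hne : ∀ z ≠ 0, R z ≠ 0 := fun z hz => by simpa using hz
  have hsol : IsMildSolution f (weight ν ℓ δ) φ T fun z s => u (R z) s := by
    refine ⟨inCSTime_of_profBddOn fun S hS hST => ?_, fun z hz s hs hsT => ?_⟩
    · obtain ⟨B, hB, hB'⟩ := hu.mem.exists_profBddOn hS hST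
      refine ⟨B, hB, ?_, fun z hz s hs => hB'.nonneg _ (hne z hz) s hs, fun z hz s hs => ?_⟩
      · have hc : Continuous fun p : EuclideanSpace ℝ (Fin n) × ℝ => (R p.1, p.2) := by fun_prop
        exact hB'.cont.comp hc.continuousOn fun p hp => ⟨hne p.1 hp.1, hp.2⟩
      · simpa using hB'.le _ (hne z hz) s hs
    · rw [hu.eq _ (hne z hz) s hs hsT, duhamel_comp_isometry]
      unfold duhamel
      rw [heatSemigroup_congr (fun y hy => hφ (R y) y (hne y hy) hy (by simp)) s hz]
  have := hu.unique hn hf hsol hx ht htT htT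
  rw [this, hR]

end Existence

/-! ### Logarithmic cutoff functions -/

/-- A smooth bump function on the line, equal to one on `[-1, 1]` and supported in `[-2, 2]`. -/
def unitBump : ContDiffBump (0 : ℝ) := ⟨1, 2, one_pos, one_lt_two⟩

/-- A cutoff function on `(0, ∞)`, in logarithmic scale. -/
def logCutoff (R s : ℝ) : ℝ := if s ≤ 0 then 0 else unitBump (Real.log s / R)

section Cutoff

lemma logCutoff_of_pos {R s : ℝ} (hs : 0 < s) : logCutoff R s = unitBump (Real.log s / R) :=
  if_neg (not_le.2 hs)

lemma logCutoff_nonneg (R s : ℝ) : 0 ≤ logCutoff R s := by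
  unfold logCutoff
  split_ifs
  · exact le_rfl
  · exact unitBump.nonneg

lemma logCutoff_le_one (R s : ℝ) : logCutoff R s ≤ 1 := by
  unfold logCutoff
  split_ifs
  · exact zero_le_one
  · exact unitBump.le_one

lemma unitBump_eq_zero {s : ℝ} (hs : 2 ≤ |s|) : unitBump s = 0 := by
  refine unitBump.zero_of_le_dist ?_
  simpa [unitBump, Real.dist_eq] using hs

lemma unitBump_eq_one {s : ℝ} (hs : |s| ≤ 1) : unitBump s = 1 := by
  refine unitBump.one_of_mem_closedBall ?_
  simpa [unitBump, Real.dist_eq] using hs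

lemma logCutoff_eq_zero_of_le {R s : ℝ} (hR : 0 < R) (hs : s ≤ Real.exp (-(2 * R))) :
    logCutoff R s = 0 := by
  rcases le_or_gt s 0 with h | h
  · exact if_pos h
  · rw [logCutoff_of_pos h]
    refine unitBump_eq_zero ?_
    have h1 : Real.log s ≤ -(2 * R) := (Real.log_le_iff_le_exp h).2 hs
    rw [abs_div, abs_of_pos hR, le_div_iff₀ hR, abs_of_nonpos (by linarith)]
    linarith

lemma logCutoff_eq_zero_of_ge {R s : ℝ} (hR : 0 < R) (hs : Real.exp (2 * R) ≤ s) :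
    logCutoff R s = 0 := by
  have h : 0 < s := (Real.exp_pos _).trans_le hs
  rw [logCutoff_of_pos h]
  refine unitBump_eq_zero ?_
  have h1 : 2 * R ≤ Real.log s := (Real.le_log_iff_exp_le h).2 hs
  rw [abs_div, abs_of_pos hR, le_div_iff₀ hR]
  exact h1.trans (le_abs_self _)

lemma logCutoff_eq_one {R s : ℝ} (hR : 0 < R) (hs : 0 < s) (h : |Real.log s| ≤ R) :
    logCutoff R s = 1 := by
  rw [logCutoff_of_pos hs]
  refine unitBump_eq_one ?_
  rwa [abs_div, abs_of_pos hR, div_le_one hR]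

lemma contDiff_logCutoff {R : ℝ} (hR : 0 < R) (m : ℕ∞) : ContDiff ℝ m (logCutoff R) := by
  rw [contDiff_iff_contDiffAt]
  intro s
  rcases le_or_gt s 0 with h | h
  · refine (contDiffAt_const (c := (0 : ℝ))).congr_of_eventuallyEq ?_
    filter_upwards [gt_mem_nhds (h.trans_lt (Real.exp_pos (-(2 * R))))] with t ht
    exact logCutoff_eq_zero_of_le hR (le_of_lt ht)
  · have h1 : ContDiffAt ℝ m (fun t => unitBump (Real.log t / R)) s :=
      unitBump.contDiff.contDiffAt.comp s ((Real.contDiffAt_log.2 h.ne').div_const R)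
    refine h1.congr_of_eventuallyEq ?_
    filter_upwards [lt_mem_nhds h] with t ht
    exact logCutoff_of_pos ht

lemma hasDerivAt_logCutoff {R s : ℝ} (hs : 0 < s) :
    HasDerivAt (logCutoff R) (deriv unitBump (Real.log s / R) * (s⁻¹ / R)) s := by
  have h1 : HasDerivAt unitBump (deriv unitBump (Real.log s / R)) (Real.log s / R) :=
    (unitBump.contDiff (n := 1)).differentiable one_ne_zero _ |>.hasDerivAt
  have h2 := h1.comp s ((Real.hasDerivAt_log hs.ne').div_const R)
  refine h2.congr_of_eventuallyEq ?_
  filter_upwards [lt_mem_nhds hs] with t ht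
  exact logCutoff_of_pos ht

lemma deriv_deriv_logCutoff {R s : ℝ} (hs : 0 < s) :
    deriv (deriv (logCutoff R)) s =
      deriv (deriv unitBump) (Real.log s / R) * (s⁻¹ / R) * (s⁻¹ / R) +
        deriv unitBump (Real.log s / R) * (-(s ^ 2)⁻¹ / R) := by
  have h1 : HasDerivAt (deriv unitBump) (deriv (deriv unitBump) (Real.log s / R))
      (Real.log s / R) := by
    have : ContDiff ℝ 1 (deriv unitBump) :=
      ((contDiff_succ_iff_deriv (n := 1)).1 (unitBump.contDiff (n := 2))).2.2
    exact this.differentiable one_ne_zero _ |>.hasDerivAt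
  have h2 := h1.comp s ((Real.hasDerivAt_log hs.ne').div_const R)
  have h3 := h2.mul ((hasDerivAt_inv hs.ne').div_const R)
  refine HasDerivAt.deriv (h3.congr_of_eventuallyEq ?_)
  filter_upwards [lt_mem_nhds hs] with t ht
  exact (hasDerivAt_logCutoff ht).deriv

/-- Each derivative of a function of `log s / R` costs `s⁻¹`, and at least one factor `1/R` appears.
Hence the cutoff error tends to zero at both ends at once, with only the scale-invariant loss
`|y|^(-2)` in the Laplacian of `logCutoff R (|y|²)`. -/
lemma exists_deriv_logCutoff_le : ∃ M > 0, ∀ R ≥ 1, ∀ s > 0,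
    |deriv (logCutoff R) s| ≤ M * s⁻¹ / R ∧ |deriv (deriv (logCutoff R)) s| ≤ M * (s ^ 2)⁻¹ / R := by
  have c2 : ContDiff ℝ 1 (deriv unitBump) :=
    ((contDiff_succ_iff_deriv (n := 1)).1 (unitBump.contDiff (n := 2))).2.2
  have hs1 : HasCompactSupport (deriv unitBump) := unitBump.hasCompactSupport.deriv
  obtain ⟨M₁, hM₁⟩ := hs1.exists_bound_of_continuous c2.continuous
  obtain ⟨M₂, hM₂⟩ := hs1.deriv.exists_bound_of_continuous (c2.continuous_deriv le_rfl)
  have p1 : 0 ≤ M₁ := (norm_nonneg _).trans (hM₁ 0)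
  have p2 : 0 ≤ M₂ := (norm_nonneg _).trans (hM₂ 0)
  refine ⟨M₁ + M₂ + 1, by positivity, fun R hR s hs => ⟨?_, ?_⟩⟩
  · have hR0 : 0 < R := by linarith
    rw [(hasDerivAt_logCutoff hs).deriv, abs_mul, abs_of_pos (by positivity : 0 < s⁻¹ / R),
      mul_div_assoc]
    gcongr
    have := hM₁ (Real.log s / R)
    rw [Real.norm_eq_abs] at this
    linarith
  · have hR0 : 0 < R := by linarith
    rw [deriv_deriv_logCutoff hs]
    have h1 := hM₁ (Real.log s / R)
    have h2 := hM₂ (Real.log s / R)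
    rw [Real.norm_eq_abs] at h1 h2
    have e1 : |deriv (deriv unitBump) (Real.log s / R) * (s⁻¹ / R) * (s⁻¹ / R)| ≤
        M₂ * (s ^ 2)⁻¹ / R := by
      rw [mul_assoc, abs_mul, abs_of_pos (by positivity : 0 < s⁻¹ / R * (s⁻¹ / R))]
      have : s⁻¹ / R * (s⁻¹ / R) ≤ (s ^ 2)⁻¹ / R := by
        have e : s⁻¹ / R * (s⁻¹ / R) = (s ^ 2)⁻¹ / R * R⁻¹ := by field_simp
        rw [e]
        exact mul_le_of_le_one_right (by positivity) (inv_le_one_of_one_le₀ hR)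
      rw [mul_div_assoc]
      gcongr
    have e2 : |deriv unitBump (Real.log s / R) * (-(s ^ 2)⁻¹ / R)| ≤ M₁ * (s ^ 2)⁻¹ / R := by
      rw [abs_mul, neg_div, abs_neg, abs_of_pos (by positivity : 0 < (s ^ 2)⁻¹ / R),
        mul_div_assoc]
      gcongr
    refine (abs_add_le _ _).trans ((add_le_add e2 e1).trans_eq' (add_comm _ _) |>.trans ?_)
    rw [mul_div_assoc, mul_div_assoc, mul_div_assoc, ← add_mul]
    exact mul_le_mul_of_nonneg_right (by linarith) (by positivity)

end Cutoff

/-! ### The Laplacian of the cut-off heat kernel -/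

section Laplacian

variable {n : ℕ}

/-- Reduces the Laplacian to one-variable calculus on coordinate lines, where the heat kernel and
`|y|²` are explicit. -/
lemma laplacian_eq_sum_deriv {η : EuclideanSpace ℝ (Fin n) → ℝ} (hη : ContDiff ℝ 2 η)
    (y : EuclideanSpace ℝ (Fin n)) :
    Laplacian.laplacian η y = ∑ i, deriv (deriv fun s : ℝ =>
      η (y + s • EuclideanSpace.basisFun (Fin n) ℝ i)) 0 := by
  rw [InnerProductSpace.laplacian_eq_iteratedFDeriv_orthonormalBasis η
    (EuclideanSpace.basisFun (Fin n) ℝ)]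
  refine Finset.sum_congr rfl fun i _ => ?_
  set e := EuclideanSpace.basisFun (Fin n) ℝ i
  have hline : ∀ s : ℝ, HasDerivAt (fun s : ℝ => y + s • e) e s := fun s => by
    simpa using ((hasDerivAt_id s).smul_const e).const_add y
  have h1 : (deriv fun s : ℝ => η (y + s • e)) = fun s => fderiv ℝ η (y + s • e) e := by
    funext s
    exact ((hη.differentiable two_ne_zero _).hasFDerivAt.comp_hasDerivAt s (hline s)).deriv
  have h2 : ContDiff ℝ 1 (fderiv ℝ η) := hη.fderiv_right (by norm_num)
  have h3 : HasDerivAt (fun s : ℝ => fderiv ℝ η (y + s • e)) (fderiv ℝ (fderiv ℝ η) y e) 0 := by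
    have := (h2.differentiable one_ne_zero (y + (0 : ℝ) • e)).hasFDerivAt.comp_hasDerivAt 0 (hline 0)
    rw [zero_smul, add_zero] at this
    exact this
  rw [h1, iteratedFDeriv_two_apply]
  have h4 := (h3.clm_apply (hasDerivAt_const (0 : ℝ) e)).deriv
  simpa using h4.symm

lemma contDiff_heatKernel_mul_radial (τ : ℝ) (x : EuclideanSpace ℝ (Fin n))
    {ρ : ℝ → ℝ} (hρ : ContDiff ℝ 2 ρ) : ContDiff ℝ 2 fun y : EuclideanSpace ℝ (Fin n) =>
      heatKernel τ (x - y) * ρ (‖y‖ ^ 2) := by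
  unfold heatKernel
  have h1 : ContDiff ℝ 2 fun y : EuclideanSpace ℝ (Fin n) => ‖x - y‖ ^ 2 :=
    (contDiff_norm_sq ℝ).comp (contDiff_const.sub contDiff_id)
  have h2 : ContDiff ℝ 2 fun y : EuclideanSpace ℝ (Fin n) => ‖y‖ ^ 2 := contDiff_norm_sq ℝ
  exact (contDiff_const.mul (h1.div_const _).neg.exp).mul (hρ.comp h2)

/-- The Laplacian of the heat kernel times a radial cutoff. -/
lemma laplacian_heatKernel_mul_radial {τ : ℝ} (hτ : 0 < τ) (x : EuclideanSpace ℝ (Fin n))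
    {ρ : ℝ → ℝ} (hρ : ContDiff ℝ 2 ρ) (y : EuclideanSpace ℝ (Fin n)) :
    Laplacian.laplacian (fun y : EuclideanSpace ℝ (Fin n) =>
      heatKernel τ (x - y) * ρ (‖y‖ ^ 2)) y =
      heatKernelDeriv τ (x - y) * ρ (‖y‖ ^ 2) +
        heatKernel τ (x - y) * (2 / τ * inner ℝ (x - y) y * deriv ρ (‖y‖ ^ 2) +
          4 * ‖y‖ ^ 2 * deriv (deriv ρ) (‖y‖ ^ 2) + 2 * n * deriv ρ (‖y‖ ^ 2)) := by
  have hsmooth := contDiff_heatKernel_mul_radial τ x hρ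
  rw [laplacian_eq_sum_deriv hsmooth]
  set c := (4 * Real.pi * τ) ^ (-((n : ℝ) / 2))
  have hρ1 : ∀ t, HasDerivAt ρ (deriv ρ t) t := fun t =>
    (hρ.differentiable two_ne_zero t).hasDerivAt
  have hρ2 : ∀ t, HasDerivAt (deriv ρ) (deriv (deriv ρ) t) t := fun t =>
    (((contDiff_succ_iff_deriv (n := 1)).1 hρ).2.2.differentiable one_ne_zero t).hasDerivAt
  have hterm : ∀ i, deriv (deriv fun s : ℝ =>
      heatKernel τ (x - (y + s • EuclideanSpace.basisFun (Fin n) ℝ i)) *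
        ρ (‖y + s • EuclideanSpace.basisFun (Fin n) ℝ i‖ ^ 2)) 0 =
      heatKernel τ (x - y) * (((x i - y i) ^ 2 / (4 * τ ^ 2) - 1 / (2 * τ)) * ρ (‖y‖ ^ 2) +
        2 / τ * ((x i - y i) * y i) * deriv ρ (‖y‖ ^ 2) +
        4 * y i ^ 2 * deriv (deriv ρ) (‖y‖ ^ 2) + 2 * deriv ρ (‖y‖ ^ 2)) := by
    intro i
    set e := EuclideanSpace.basisFun (Fin n) ℝ i
    have he : ‖e‖ = 1 := (EuclideanSpace.basisFun (Fin n) ℝ).orthonormal.1 i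
    have hin : ∀ z : EuclideanSpace ℝ (Fin n), inner ℝ z e = z i := fun z => by
      rw [real_inner_comm]
      simp [e, EuclideanSpace.inner_single_left]
    have n1 : ∀ s : ℝ, ‖x - (y + s • e)‖ ^ 2 = ‖x - y‖ ^ 2 - 2 * s * (x i - y i) + s ^ 2 := by
      intro s
      rw [← sub_sub, norm_sub_sq_real, inner_smul_right, hin, norm_smul, he]
      simp
      ring
    have n2 : ∀ s : ℝ, ‖y + s • e‖ ^ 2 = ‖y‖ ^ 2 + 2 * s * y i + s ^ 2 := by
      intro s
      rw [norm_add_sq_real, inner_smul_right, hin, norm_smul, he]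
      simp
      ring
    -- Along the line through `y` in direction `e_i` both squared norms are quadratic polynomials in
    -- `s`.
    set P : ℝ → ℝ := fun s => c * Real.exp (-((‖x - y‖ ^ 2 - 2 * s * (x i - y i) + s ^ 2) / (4 * τ)))
    set q : ℝ → ℝ := fun s => ‖y‖ ^ 2 + 2 * s * y i + s ^ 2
    have hfun : (fun s : ℝ => heatKernel τ (x - (y + s • e)) * ρ (‖y + s • e‖ ^ 2)) =
        fun s => P s * ρ (q s) := by
      funext s
      simp only [heatKernel, n1, n2, P, q, c]
    have hq : ∀ s, HasDerivAt q (2 * y i + 2 * s) s := by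
      intro s
      have h1 := (((hasDerivAt_id s).const_mul 2).mul_const (y i)).const_add (‖y‖ ^ 2)
      have h2 := h1.add ((hasDerivAt_id s).pow 2)
      refine h2.congr_deriv ?_
      simp
    have hP : ∀ s, HasDerivAt P (P s * ((x i - y i - s) / (2 * τ))) s := by
      intro s
      have h1 := (((hasDerivAt_id s).const_mul 2).mul_const (x i - y i)).const_sub (‖x - y‖ ^ 2)
      have h2 := (((h1.add ((hasDerivAt_id s).pow 2)).div_const (4 * τ)).neg).exp.const_mul c
      refine h2.congr_deriv ?_
      simp only [P, id, Pi.add_apply, Pi.pow_apply]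
      field_simp
      simp
      ring_nf
    have hd1 : deriv (fun s => P s * ρ (q s)) = fun s =>
        P s * ((x i - y i - s) / (2 * τ)) * ρ (q s) +
          P s * (deriv ρ (q s) * (2 * y i + 2 * s)) := by
      funext s
      exact ((hP s).mul ((hρ1 (q s)).comp s (hq s))).deriv
    rw [hfun, hd1]
    have hl : HasDerivAt (fun s : ℝ => (x i - y i - s) / (2 * τ)) (-1 / (2 * τ)) 0 := by
      simpa using ((hasDerivAt_id (0 : ℝ)).const_sub (x i - y i)).div_const (2 * τ)
    have hl2 : HasDerivAt (fun s : ℝ => 2 * y i + 2 * s) 2 0 := by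
      simpa using ((hasDerivAt_id (0 : ℝ)).const_mul 2).const_add (2 * y i)
    have hd2 := ((((hP 0).mul hl).mul ((hρ1 (q 0)).comp 0 (hq 0))).add
      ((hP 0).mul (((hρ2 (q 0)).comp 0 (hq 0)).mul hl2))).deriv
    refine hd2.trans ?_
    have hP0 : P 0 = heatKernel τ (x - y) := by simp [P, c, heatKernel]
    have hq0 : q 0 = ‖y‖ ^ 2 := by simp [q]
    simp only [Function.comp_def, Pi.mul_apply, hP0, hq0, sub_zero, mul_zero, add_zero]
    field_simp
    ring
  rw [Finset.sum_congr rfl fun i _ => hterm i, ← Finset.mul_sum]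
  have s1 : ∑ i, (x i - y i) ^ 2 = ‖x - y‖ ^ 2 := by
    rw [EuclideanSpace.real_norm_sq_eq]; simp
  have s2 : ∑ i, (x i - y i) * y i = inner ℝ (x - y) y := by
    rw [PiLp.inner_apply]; simp [mul_comm]
  have s3 : ∑ i, y i ^ 2 = ‖y‖ ^ 2 := by rw [EuclideanSpace.real_norm_sq_eq]
  simp only [Finset.sum_add_distrib, ← Finset.sum_mul, ← Finset.mul_sum, Finset.sum_sub_distrib,
    ← Finset.sum_div, s1, s2, s3, Finset.sum_const, Finset.card_univ, Fintype.card_fin,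
    nsmul_eq_mul]
  unfold heatKernelDeriv
  ring

end Laplacian

/-! ### Testing the weak inequality with the heat kernel -/

section Pairing

variable {n : ℕ} {f : ℝ → ℝ → ℝ} {φ η ζ ψ : EuclideanSpace ℝ (Fin n) → ℝ}

/-- The singularity of `ψ` at the origin is invisible to functions vanishing near it, so the
pairings integrate continuous, compactly supported functions. -/
lemma continuous_mul_of_zero_notMem_tsupport (hψ : ContinuousOn ψ {0}ᶜ) (hζ : Continuous ζ)
    (h0 : (0 : EuclideanSpace ℝ (Fin n)) ∉ tsupport ζ) : Continuous fun y => ψ y * ζ y := by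
  rw [continuous_iff_continuousAt]
  intro y
  rcases eq_or_ne y 0 with rfl | hy
  · have h1 : (fun y => ψ y * ζ y) =ᶠ[𝓝 0] fun _ => 0 := by
      filter_upwards [notMem_tsupport_iff_eventuallyEq.1 h0] with y hy
      rw [hy, Pi.zero_apply, mul_zero]
    exact continuousAt_const.congr h1.symm
  · exact (hψ.continuousAt (isOpen_compl_singleton.mem_nhds hy)).mul hζ.continuousAt

lemma integrable_mul_of_zero_notMem_tsupport (hψ : ContinuousOn ψ {0}ᶜ) (hζ : Continuous ζ)
    (h0 : (0 : EuclideanSpace ℝ (Fin n)) ∉ tsupport ζ) (hc : HasCompactSupport ζ) :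
    Integrable fun y => ψ y * ζ y :=
  (continuous_mul_of_zero_notMem_tsupport hψ hζ h0).integrable_of_hasCompactSupport hc.mul_left

lemma tsupport_laplacian_subset : tsupport (Laplacian.laplacian η) ⊆ tsupport η := by
  refine closure_minimal (fun y hy => ?_) (isClosed_tsupport η)
  by_contra h
  refine hy ?_
  have h1 := notMem_tsupport_iff_eventuallyEq.1 h
  rw [InnerProductSpace.laplacian_congr_nhds h1 |>.eq_of_nhds]
  have h2 := InnerProductSpace.laplacian_const (E := EuclideanSpace ℝ (Fin n)) (c := (0 : ℝ))
  exact congrFun h2 y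

lemma continuous_laplacian (hη : ContDiff ℝ 2 η) : Continuous (Laplacian.laplacian η) := by
  rw [InnerProductSpace.laplacian_eq_iteratedFDeriv_stdOrthonormalBasis η]
  refine continuous_finsetSum _ fun i _ => ?_
  have h1 := hη.continuous_iteratedFDeriv (m := 2) le_rfl
  fun_prop

lemma IsTest.integrable_pairing (hφ : ContinuousOn φ {0}ᶜ)
    (hF : ContinuousOn (fun y => f (φ y) ‖y‖) {0}ᶜ) (hη : IsTest η) :
    Integrable fun x => φ x * Laplacian.laplacian η x + f (φ x) ‖x‖ * η x :=
  (integrable_mul_of_zero_notMem_tsupport hφ (continuous_laplacian hη.smooth)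
      (fun h => hη.zero_notMem (tsupport_laplacian_subset h))
      (hη.compact.mono' (subset_closure.trans tsupport_laplacian_subset))).add
    (integrable_mul_of_zero_notMem_tsupport hF hη.smooth.continuous hη.zero_notMem hη.compact)

/-- The linear combination needed later: a multiple of the cut-off kernel minus a given test
function. -/
lemma ellipticPairing_smul_sub (hφ : ContinuousOn φ {0}ᶜ)
    (hF : ContinuousOn (fun y => f (φ y) ‖y‖) {0}ᶜ) (hη : IsTest η) (hζ : IsTest ζ) (c : ℝ) :
    ellipticPairing f φ (fun y => c * η y - ζ y) =
      c * ellipticPairing f φ η - ellipticPairing f φ ζ := by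
  unfold ellipticPairing
  rw [← integral_const_mul, ← integral_sub ((hη.integrable_pairing hφ hF).const_mul c)
    (hζ.integrable_pairing hφ hF)]
  congr 1
  funext y
  have h1 : Laplacian.laplacian (fun y => c * η y - ζ y) y =
      c * Laplacian.laplacian η y - Laplacian.laplacian ζ y := by
    have e : (fun y => c * η y - ζ y) = c • η - ζ := rfl
    have hs : ContDiffAt ℝ 2 (c • η) y := (contDiff_const.smul hη.smooth).contDiffAt
    rw [e, hs.laplacian_sub hζ.smooth.contDiffAt,
      InnerProductSpace.laplacian_smul c hη.smooth.contDiffAt, smul_eq_mul]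
  rw [h1]
  ring

/-- The heat kernel cut off near the origin and near infinity. -/
lemma isTest_heatKernel_mul_logCutoff {τ : ℝ} (hτ : 0 < τ) (x : EuclideanSpace ℝ (Fin n)) {R : ℝ}
    (hR : 0 < R) : IsTest fun y => heatKernel τ (x - y) * logCutoff R (‖y‖ ^ 2) := by
  refine ⟨contDiff_heatKernel_mul_radial τ x (contDiff_logCutoff hR 2), ?_, ?_, fun y =>
    mul_nonneg (heatKernel_nonneg hτ _) (logCutoff_nonneg _ _)⟩
  · refine HasCompactSupport.intro (isCompact_closedBall 0 (Real.exp R)) fun y hy => ?_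
    rw [mem_closedBall_zero_iff, not_le] at hy
    rw [logCutoff_eq_zero_of_ge hR, mul_zero]
    rw [two_mul, Real.exp_add, ← sq]
    gcongr
  · rw [notMem_tsupport_iff_eventuallyEq]
    have h1 : Tendsto (fun y : EuclideanSpace ℝ (Fin n) => ‖y‖ ^ 2) (𝓝 0) (𝓝 0) := by
      have : Continuous fun y : EuclideanSpace ℝ (Fin n) => ‖y‖ ^ 2 := by fun_prop
      simpa using this.tendsto 0
    filter_upwards [h1.eventually (ge_mem_nhds (Real.exp_pos (-(2 * R))))] with y hy
    rw [logCutoff_eq_zero_of_le hR hy, mul_zero, Pi.zero_apply]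

/-- The Laplacian of the cut off heat kernel approximates the time derivative of the kernel. -/
lemma exists_abs_laplacian_heatKernel_mul_logCutoff_le {τ : ℝ} (hτ : 0 < τ)
    (x : EuclideanSpace ℝ (Fin n)) : ∃ D > 0, ∀ R ≥ 1, ∀ y ≠ 0,
      |Laplacian.laplacian (fun y : EuclideanSpace ℝ (Fin n) =>
        heatKernel τ (x - y) * logCutoff R (‖y‖ ^ 2)) y -
        heatKernelDeriv τ (x - y) * logCutoff R (‖y‖ ^ 2)| ≤
        D / R * (heatKernel (2 * τ) (x - y) * (1 + (‖y‖ ^ 2)⁻¹)) := by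
  obtain ⟨M, hM, hcut⟩ := exists_deriv_logCutoff_le
  obtain ⟨C, hC, hker⟩ := exists_norm_rpow_mul_heatKernel_le n (p := 1) zero_le_one
  refine ⟨2 / τ * M * (C * τ ^ ((1 : ℝ) / 2)) + (4 + 2 * n) * M * 2 ^ ((n : ℝ) / 2),
    by positivity, fun R hR y hy => ?_⟩
  have hR0 : 0 < R := by linarith
  have hr : 0 < ‖y‖ := norm_pos_iff.2 hy
  have hK := heatKernel_nonneg hτ (x - y)
  have hK2 := heatKernel_nonneg (n := n) (τ := 2 * τ) (by positivity) (x - y)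
  have k1 := hker τ hτ (x - y)
  rw [Real.rpow_one] at k1
  have k2 := heatKernel_le_of_le hτ (by linarith : τ ≤ 2 * τ) (x - y)
  rw [mul_div_cancel_right₀ _ hτ.ne'] at k2
  obtain ⟨c1, c2⟩ := hcut R hR (‖y‖ ^ 2) (by positivity)
  rw [laplacian_heatKernel_mul_radial hτ x (contDiff_logCutoff hR0 2), add_sub_cancel_left,
    abs_mul, abs_of_nonneg hK]
  have hinn : |inner ℝ (x - y) y| ≤ ‖x - y‖ * ‖y‖ := abs_real_inner_le_norm _ _
  have b1 : |2 / τ * inner ℝ (x - y) y * deriv (logCutoff R) (‖y‖ ^ 2)| ≤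
      2 / τ * (‖x - y‖ * ‖y‖) * (M * (‖y‖ ^ 2)⁻¹ / R) := by
    rw [abs_mul, abs_mul, abs_of_pos (by positivity : 0 < 2 / τ)]
    gcongr
  have b2 : |4 * ‖y‖ ^ 2 * deriv (deriv (logCutoff R)) (‖y‖ ^ 2)| ≤
      4 * ‖y‖ ^ 2 * (M * ((‖y‖ ^ 2) ^ 2)⁻¹ / R) := by
    rw [abs_mul, abs_of_pos (by positivity : 0 < 4 * ‖y‖ ^ 2)]
    gcongr
  have b3 : |2 * n * deriv (logCutoff R) (‖y‖ ^ 2)| ≤ 2 * n * (M * (‖y‖ ^ 2)⁻¹ / R) := by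
    rw [abs_mul, abs_of_nonneg (by positivity : (0 : ℝ) ≤ 2 * n)]
    gcongr
  have i1 : ‖y‖ * (‖y‖ ^ 2)⁻¹ ≤ 1 + (‖y‖ ^ 2)⁻¹ := by
    have e : ‖y‖ * (‖y‖ ^ 2)⁻¹ = ‖y‖⁻¹ := by field_simp
    have : 0 ≤ (‖y‖⁻¹ - 1) ^ 2 := sq_nonneg _
    have : 0 < ‖y‖⁻¹ := by positivity
    rw [e, ← inv_pow]
    nlinarith
  have i2 : (‖y‖ ^ 2)⁻¹ ≤ 1 + (‖y‖ ^ 2)⁻¹ := by linarith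
  calc _ ≤ heatKernel τ (x - y) * (2 / τ * (‖x - y‖ * ‖y‖) * (M * (‖y‖ ^ 2)⁻¹ / R) +
        4 * ‖y‖ ^ 2 * (M * ((‖y‖ ^ 2) ^ 2)⁻¹ / R) + 2 * n * (M * (‖y‖ ^ 2)⁻¹ / R)) := by
        gcongr
        refine (abs_add_le _ _).trans (add_le_add ((abs_add_le _ _).trans (add_le_add b1 b2)) b3)
    _ = 2 / τ * M / R * (‖x - y‖ * heatKernel τ (x - y)) * (‖y‖ * (‖y‖ ^ 2)⁻¹) +
        (4 + 2 * n) * M / R * heatKernel τ (x - y) * (‖y‖ ^ 2)⁻¹ := by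
        field_simp
        ring
    _ ≤ 2 / τ * M / R * (C * τ ^ ((1 : ℝ) / 2) * heatKernel (2 * τ) (x - y)) *
          (1 + (‖y‖ ^ 2)⁻¹) +
        (4 + 2 * n) * M / R * (2 ^ ((n : ℝ) / 2) * heatKernel (2 * τ) (x - y)) *
          (1 + (‖y‖ ^ 2)⁻¹) := by gcongr
    _ = _ := by ring

variable {ν k θ A A' : ℝ}

/-- The cutoff error loses the full power `|y|^(-2)`, without the gain `θ`; this is integrable
against the profile precisely because `ν + 2 < n`. -/
lemma Admissible.integrable_heatKernel_mul_profile_div (hn : Admissible n ν θ) (k : ℝ) {τ : ℝ}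
    (hτ : 0 < τ) {x : EuclideanSpace ℝ (Fin n)} (hx : x ≠ 0) :
    Integrable fun y => heatKernel τ (x - y) * ((1 + (‖y‖ ^ 2)⁻¹) * profile ν k ‖y‖) := by
  have hn0 : NeZero n := ⟨by
    rintro rfl
    have h1 := hn.lt
    have h2 := hn.nonneg
    norm_num at h1
    linarith⟩
  obtain ⟨C, _, hb⟩ := exists_integral_heatKernel_weight_le (n := n) (a := ν + 2) (ν := ν)
    (ν - k + 2) hn.nonneg (by linarith) hn.lt τ
  refine (hb τ ⟨hτ, le_rfl⟩ x hx).1.mono' ?_ ((ae_ne_zero hx).mono fun y hy => ?_)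
  · refine aestronglyMeasurable_heatKernel_mul ?_ x
    refine Measurable.aestronglyMeasurable ?_
    have := (measurable_profile ν k).comp (measurable_norm (α := EuclideanSpace ℝ (Fin n)))
    have h2 : Measurable fun y : EuclideanSpace ℝ (Fin n) => 1 + (‖y‖ ^ 2)⁻¹ := by fun_prop
    exact h2.mul this
  · have hr : 0 < ‖y‖ := norm_pos_iff.2 hy
    have hK := heatKernel_nonneg hτ (x - y)
    have hp := profile_pos (ν := ν) (k := k) hr
    rw [Real.norm_of_nonneg (by positivity)]
    refine mul_le_mul_of_nonneg_left ?_ hK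
    unfold profile
    have e1 : ‖y‖ ^ (-(ν + 2)) = ‖y‖ ^ (-ν) * (‖y‖ ^ 2)⁻¹ := by
      rw [neg_add, Real.rpow_add hr, Real.rpow_neg hr.le 2, Real.rpow_two]
    have e2 : (1 + ‖y‖) ^ (ν - k + 2) = (1 + ‖y‖) ^ (ν - k) * (1 + ‖y‖) ^ 2 := by
      rw [Real.rpow_add (by positivity), Real.rpow_two]
    rw [e1, e2]
    have e3 : 1 + (‖y‖ ^ 2)⁻¹ ≤ (‖y‖ ^ 2)⁻¹ * (1 + ‖y‖) ^ 2 := by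
      rw [inv_mul_eq_div, le_div_iff₀ (by positivity), add_mul, inv_mul_cancel₀ (by positivity)]
      nlinarith
    calc _ ≤ (‖y‖ ^ 2)⁻¹ * (1 + ‖y‖) ^ 2 * (‖y‖ ^ (-ν) * (1 + ‖y‖) ^ (ν - k)) := by gcongr
      _ = _ := by ring

/-- The rate of change at time `τ` of `e^{τΔ} φ + ∫_0^τ e^{sΔ} f(φ, |·|) ds`. -/
def parabolicRate (f : ℝ → ℝ → ℝ) (φ : EuclideanSpace ℝ (Fin n) → ℝ) (τ : ℝ)
    (x : EuclideanSpace ℝ (Fin n)) : ℝ :=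
  (∫ y, heatKernelDeriv τ (x - y) * φ y) + heatSemigroup τ (fun y => f (φ y) ‖y‖) x

/-- By the heat equation `ΔK = ∂_τ K`, the Laplacian falling on the kernel alone yields the time
derivative of the heat flow. The remaining terms are `O(1/R)` times an integrable function, and
dominated convergence removes the cutoff. -/
lemma tendsto_ellipticPairing_heatKernel (hn : Admissible n ν θ) (hA : 0 ≤ A)
    (hφb : ProfBdd ν k A φ) (hFb : SingBdd ν k θ A' fun y => f (φ y) ‖y‖)
    {τ : ℝ} (hτ : 0 < τ) {x : EuclideanSpace ℝ (Fin n)} (hx : x ≠ 0) :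
    Tendsto (fun R : ℝ => ellipticPairing f φ
      fun y => heatKernel τ (x - y) * logCutoff R (‖y‖ ^ 2)) atTop (𝓝 (parabolicRate f φ τ x)) := by
  obtain ⟨D, hD, hlap⟩ := exists_abs_laplacian_heatKernel_mul_logCutoff_le hτ x
  obtain ⟨i1, -⟩ := (hφb.singBdd (θ := θ) hA).hasDerivAt_heatSemigroup hn hτ hx
  have i2 := hFb.integrable hn hτ hx
  have i3 := hn.integrable_heatKernel_mul_profile_div k (τ := 2 * τ) (by positivity) hx
  rw [parabolicRate, heatSemigroup_of_pos hτ, ← integral_add i1 i2]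
  refine tendsto_integral_filter_of_dominated_convergence (fun y =>
    ‖heatKernelDeriv τ (x - y) * φ y‖ + ‖heatKernel τ (x - y) * f (φ y) ‖y‖‖ +
      D * A * (heatKernel (2 * τ) (x - y) * ((1 + (‖y‖ ^ 2)⁻¹) * profile ν k ‖y‖))) ?_ ?_
    ((i1.norm.add i2.norm).add (i3.const_mul _)) ?_
  · filter_upwards [eventually_gt_atTop 0] with R hR
    have hη := isTest_heatKernel_mul_logCutoff hτ x hR
    exact (hφb.meas.mul (continuous_laplacian hη.smooth).aestronglyMeasurable).add
      (hFb.meas.mul hη.smooth.continuous.aestronglyMeasurable)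
  · filter_upwards [eventually_ge_atTop 1] with R hR
    filter_upwards [ae_ne_zero hx] with y hy
    have hr : 0 < ‖y‖ := norm_pos_iff.2 hy
    have h1 := hlap R hR y hy
    have h2 := hφb.bound y hy
    have hK2 := heatKernel_nonneg (n := n) (τ := 2 * τ) (by positivity) (x - y)
    have hp := profile_pos (ν := ν) (k := k) hr
    set L := Laplacian.laplacian (fun y : EuclideanSpace ℝ (Fin n) =>
        heatKernel τ (x - y) * logCutoff R (‖y‖ ^ 2)) y
    have c0 := logCutoff_nonneg R (‖y‖ ^ 2)
    have c1 := logCutoff_le_one R (‖y‖ ^ 2)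
    have e : φ y * L + f (φ y) ‖y‖ * (heatKernel τ (x - y) * logCutoff R (‖y‖ ^ 2)) =
        heatKernelDeriv τ (x - y) * φ y * logCutoff R (‖y‖ ^ 2) +
        heatKernel τ (x - y) * f (φ y) ‖y‖ * logCutoff R (‖y‖ ^ 2) +
        (L - heatKernelDeriv τ (x - y) * logCutoff R (‖y‖ ^ 2)) * φ y := by ring
    rw [e]
    refine (norm_add₃_le).trans (add_le_add (add_le_add ?_ ?_) ?_)
    · rw [norm_mul _ (logCutoff R _), Real.norm_of_nonneg c0]
      exact mul_le_of_le_one_right (norm_nonneg _) c1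
    · rw [norm_mul _ (logCutoff R _), Real.norm_of_nonneg c0]
      exact mul_le_of_le_one_right (norm_nonneg _) c1
    · rw [norm_mul, Real.norm_eq_abs, Real.norm_eq_abs]
      have hDR : D / R ≤ D := div_le_self hD.le hR
      calc _ ≤ D / R * (heatKernel (2 * τ) (x - y) * (1 + (‖y‖ ^ 2)⁻¹)) *
            (A * profile ν k ‖y‖) := by gcongr
        _ ≤ D * (heatKernel (2 * τ) (x - y) * (1 + (‖y‖ ^ 2)⁻¹)) *
            (A * profile ν k ‖y‖) := by gcongr
        _ = _ := by ring
  · filter_upwards [ae_ne_zero hx] with y hy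
    have hr : 0 < ‖y‖ := norm_pos_iff.2 hy
    have hcut : ∀ᶠ R : ℝ in atTop, logCutoff R (‖y‖ ^ 2) = 1 := by
      filter_upwards [eventually_ge_atTop |Real.log (‖y‖ ^ 2)|, eventually_gt_atTop 0] with R h1 h2
      exact logCutoff_eq_one h2 (by positivity) h1
    have hlim : Tendsto (fun R : ℝ =>
        D / R * (heatKernel (2 * τ) (x - y) * (1 + (‖y‖ ^ 2)⁻¹))) atTop (𝓝 0) := by
      simpa using ((tendsto_const_nhds (x := D)).div_atTop tendsto_id).mul_const
        (heatKernel (2 * τ) (x - y) * (1 + (‖y‖ ^ 2)⁻¹))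
    have hL : Tendsto (fun R : ℝ => Laplacian.laplacian
        (fun y : EuclideanSpace ℝ (Fin n) => heatKernel τ (x - y) * logCutoff R (‖y‖ ^ 2)) y) atTop
        (𝓝 (heatKernelDeriv τ (x - y))) := by
      rw [tendsto_iff_norm_sub_tendsto_zero]
      refine squeeze_zero' (Eventually.of_forall fun _ => norm_nonneg _) ?_ hlim
      filter_upwards [hcut, eventually_ge_atTop 1] with R h1 h2
      have := hlap R h2 y hy
      rwa [h1, mul_one] at this
    have h3 : Tendsto (fun R : ℝ => heatKernel τ (x - y) * logCutoff R (‖y‖ ^ 2)) atTop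
        (𝓝 (heatKernel τ (x - y))) :=
      tendsto_const_nhds.congr' (hcut.mono fun R h => by simp only [h, mul_one])
    have := (hL.const_mul (φ y)).add (h3.const_mul (f (φ y) ‖y‖))
    rwa [mul_comm (φ y), mul_comm (f (φ y) ‖y‖)] at this

/-- A weak sign condition on `Δφ + f(φ, |x|)` is inherited by the heat kernel pairing, with a
defect controlled by any test function below a multiple of the heat kernel. -/
lemma mul_parabolicRate_le (hn : Admissible n ν θ) (hA : 0 ≤ A)
    (hφ : ContinuousOn φ {0}ᶜ) (hφb : ProfBdd ν k A φ)
    (hF : ContinuousOn (fun y => f (φ y) ‖y‖) {0}ᶜ)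
    (hFb : SingBdd ν k θ A' fun y => f (φ y) ‖y‖) {σ : ℝ}
    (hσ : ∀ η, IsTest η → σ * ellipticPairing f φ η ≤ 0) (hζ : IsTest ζ)
    {τ c : ℝ} (hτ : 0 < τ) {x : EuclideanSpace ℝ (Fin n)} (hx : x ≠ 0) (hc : 0 ≤ c)
    (hζc : ∀ y, ζ y ≤ c * heatKernel τ (x - y)) :
    σ * (c * parabolicRate f φ τ x) ≤ σ * ellipticPairing f φ ζ := by
  have hlim := ((tendsto_ellipticPairing_heatKernel hn hA hφb hFb hτ hx).const_mul c).const_mul σ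
  refine le_of_tendsto hlim ?_
  -- The support of `ζ` is compact and avoids the origin, so `log |y|²` is bounded on it and the
  -- cutoff is eventually `1` there.
  have hcut : ∀ᶠ R : ℝ in atTop, ∀ y ∈ tsupport ζ, logCutoff R (‖y‖ ^ 2) = 1 := by
    have hcont : ContinuousOn (fun y : EuclideanSpace ℝ (Fin n) => Real.log (‖y‖ ^ 2))
        (tsupport ζ) := by
      refine ContinuousOn.log (by fun_prop) fun y hy => ?_
      have : y ≠ 0 := fun h => hζ.zero_notMem (h ▸ hy)
      positivity
    obtain ⟨M, hM⟩ := IsCompact.exists_bound_of_continuousOn hζ.compact hcont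
    filter_upwards [eventually_ge_atTop M, eventually_gt_atTop 0] with R h1 h2 y hy
    have : y ≠ 0 := fun h => hζ.zero_notMem (h ▸ hy)
    exact logCutoff_eq_one h2 (by positivity) ((hM y hy).trans h1)
  filter_upwards [hcut, eventually_gt_atTop 0] with R h1 hR
  have hη := isTest_heatKernel_mul_logCutoff hτ x hR
  -- Nonnegativity is the domination hypothesis on the support of `ζ`, and is clear elsewhere.
  -- Applying the sign condition to this difference transfers the defect from `ζ` to the kernel.
  have htest : IsTest fun y => c * (heatKernel τ (x - y) * logCutoff R (‖y‖ ^ 2)) - ζ y := by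
    refine ⟨(contDiff_const.mul hη.smooth).sub hζ.smooth, ?_, fun h0 => ?_, fun y => ?_⟩
    · exact HasCompactSupport.sub hη.compact.mul_left hζ.compact
    · have e1 := notMem_tsupport_iff_eventuallyEq.1 hη.zero_notMem
      have e2 := notMem_tsupport_iff_eventuallyEq.1 hζ.zero_notMem
      refine notMem_tsupport_iff_eventuallyEq.2 ?_ h0
      filter_upwards [e1, e2] with y h1 h2
      simp only [Pi.zero_apply] at h1 h2 ⊢
      rw [h1, h2, mul_zero, sub_zero]
    · by_cases hy : y ∈ tsupport ζ
      · rw [h1 y hy, mul_one]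
        exact sub_nonneg.2 (hζc y)
      · rw [image_eq_zero_of_notMem_tsupport hy, sub_zero]
        exact mul_nonneg hc (hη.nonneg y)
  have := hσ _ htest
  rw [ellipticPairing_smul_sub hφ hF hη hζ, mul_sub] at this
  linarith

end Pairing

/-! ### Sign of the rate and of the increments of the stationary flow -/

section Increment

variable {n : ℕ} {f : ℝ → ℝ → ℝ} {φ ζ ψ : EuclideanSpace ℝ (Fin n) → ℝ} {ν k θ A A' : ℝ}

/-- The heat kernel is positive everywhere, so a fixed multiple of it, uniform for `τ ∈ [t, t+1]`,
dominates the compactly supported `ζ`. A strict inequality detected by one test function thus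
spreads at once to every point `x ≠ 0`, in place of a strong maximum principle. -/
lemma exists_mul_parabolicRate_le_neg (hn : Admissible n ν θ) (hA : 0 ≤ A)
    (hφ : ContinuousOn φ {0}ᶜ) (hφb : ProfBdd ν k A φ)
    (hF : ContinuousOn (fun y => f (φ y) ‖y‖) {0}ᶜ)
    (hFb : SingBdd ν k θ A' fun y => f (φ y) ‖y‖) {σ : ℝ}
    (hσ : ∀ η, IsTest η → σ * ellipticPairing f φ η ≤ 0) (hζ : IsTest ζ)
    (hζσ : σ * ellipticPairing f φ ζ < 0) {t : ℝ} (ht : 0 < t)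
    {x : EuclideanSpace ℝ (Fin n)} (hx : x ≠ 0) :
    ∃ c > 0, ∀ τ ∈ Icc t (t + 1), σ * parabolicRate f φ τ x ≤ -c := by
  have hcont : Continuous fun y => ζ y / heatKernel t (x - y) :=
    hζ.smooth.continuous.div (by fun_prop) fun y => (heatKernel_pos ht _).ne'
  have hcomp : HasCompactSupport fun y => ζ y / heatKernel t (x - y) := by
    simp only [div_eq_mul_inv]
    exact hζ.compact.mul_right
  obtain ⟨M, hM⟩ := hcomp.exists_bound_of_continuous hcont
  have hM0 : 0 ≤ M := (norm_nonneg _).trans (hM 0)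
  set c₀ := (M + 1) * ((t + 1) / t) ^ ((n : ℝ) / 2)
  have hc₀ : 0 < c₀ := by positivity
  refine ⟨-(σ * ellipticPairing f φ ζ) / c₀, div_pos (by linarith) hc₀, fun τ hτ => ?_⟩
  have hτ0 : 0 < τ := ht.trans_le hτ.1
  have hle : ∀ y, ζ y ≤ c₀ * heatKernel τ (x - y) := by
    intro y
    have hKt := heatKernel_pos ht (x - y)
    have hKτ := heatKernel_pos hτ0 (x - y)
    have h1 := (le_abs_self _).trans (hM y)
    rw [div_le_iff₀ hKt] at h1
    have h2 := heatKernel_le_of_le ht hτ.1 (x - y)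
    calc ζ y ≤ M * heatKernel t (x - y) := h1
      _ ≤ (M + 1) * ((τ / t) ^ ((n : ℝ) / 2) * heatKernel τ (x - y)) := by
          gcongr
          linarith
      _ ≤ (M + 1) * (((t + 1) / t) ^ ((n : ℝ) / 2) * heatKernel τ (x - y)) := by
          gcongr
          exact hτ.2
      _ = _ := by ring
  have key := mul_parabolicRate_le hn hA hφ hφb hF hFb hσ hζ hτ0 hx hc₀.le hle
  rw [neg_div, neg_neg, le_div_iff₀ hc₀]
  linarith

/-- The case `ζ = 0`, `c = 1` of `mul_parabolicRate_le`. -/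
lemma mul_parabolicRate_nonpos (hn : Admissible n ν θ) (hA : 0 ≤ A)
    (hφ : ContinuousOn φ {0}ᶜ) (hφb : ProfBdd ν k A φ)
    (hF : ContinuousOn (fun y => f (φ y) ‖y‖) {0}ᶜ)
    (hFb : SingBdd ν k θ A' fun y => f (φ y) ‖y‖) {σ : ℝ}
    (hσ : ∀ η, IsTest η → σ * ellipticPairing f φ η ≤ 0) {τ : ℝ} (hτ : 0 < τ)
    {x : EuclideanSpace ℝ (Fin n)} (hx : x ≠ 0) : σ * parabolicRate f φ τ x ≤ 0 := by
  have hz : IsTest fun _ : EuclideanSpace ℝ (Fin n) => (0 : ℝ) :=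
    ⟨contDiff_const, HasCompactSupport.zero, by simp, fun _ => le_rfl⟩
  have key := mul_parabolicRate_le hn hA hφ hφb hF hFb hσ hz hτ hx zero_le_one
    (fun y => by rw [one_mul]; exact heatKernel_nonneg hτ _)
  rw [one_mul] at key
  exact key.trans (hσ _ hz)

lemma SingBdd.intervalIntegrable_heatSemigroup (hn : Admissible n ν θ) (hA : 0 ≤ A)
    (h : SingBdd ν k θ A ψ) {a b : ℝ} (ha : 0 ≤ a) (hab : a ≤ b)
    {x : EuclideanSpace ℝ (Fin n)} (hx : x ≠ 0) :
    IntervalIntegrable (fun r => heatSemigroup r ψ x) volume a b := by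
  obtain ⟨C, hC⟩ := hn.exists_heatConst k b
  have hθ := hn.pos
  have hi : IntervalIntegrable (fun r : ℝ => C * A * profile ν k ‖x‖ * r ^ (θ / 2 - 1)) volume a b :=
    (intervalIntegral.intervalIntegrable_rpow' (by linarith)).const_mul _
  rw [intervalIntegrable_iff_integrableOn_Ioc_of_le hab] at hi ⊢
  refine hi.mono' (ContinuousOn.aestronglyMeasurable (fun r hr => ?_) measurableSet_Ioc) ?_
  · have h1 := h.continuousAt_heatSemigroup hn (ha.trans_lt hr.1) hx
    have h2 : ContinuousAt (fun r : ℝ => (x, r)) r := by fun_prop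
    exact (ContinuousAt.comp (f := fun r : ℝ => (x, r)) h1 h2).continuousWithinAt
  · filter_upwards [ae_restrict_mem measurableSet_Ioc] with r hr
    exact hC.sing A hA ψ h r ⟨ha.trans_lt hr.1, hr.2⟩ x hx

/-- The increment over `[a, b]` of `t ↦ e^{tΔ} φ + ∫_0^t e^{sΔ} f(φ, |·|) ds`. -/
def heatIncrement (f : ℝ → ℝ → ℝ) (φ : EuclideanSpace ℝ (Fin n) → ℝ)
    (x : EuclideanSpace ℝ (Fin n)) (a b : ℝ) : ℝ :=
  heatSemigroup b φ x - heatSemigroup a φ x +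
    ∫ r in a..b, heatSemigroup r (fun y => f (φ y) ‖y‖) x

/-- `parabolicRate` is the derivative of the increment in its right endpoint. Continuity down to
time zero allows `a = 0` in the mean value inequality. -/
lemma mul_heatIncrement_le (hn : Admissible n ν θ) (hA : 0 ≤ A) (hA' : 0 ≤ A')
    (hφ : ContinuousOn φ {0}ᶜ) (hφb : ProfBdd ν k A φ)
    (hFb : SingBdd ν k θ A' fun y => f (φ y) ‖y‖) {σ c a b : ℝ} (ha : 0 ≤ a) (hab : a ≤ b)
    {x : EuclideanSpace ℝ (Fin n)} (hx : x ≠ 0)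
    (h : ∀ τ ∈ Ioo a b, σ * parabolicRate f φ τ x ≤ -c) :
    σ * heatIncrement f φ x a b ≤ -c * (b - a) := by
  set F : EuclideanSpace ℝ (Fin n) → ℝ := fun y => f (φ y) ‖y‖
  set G : ℝ → ℝ := fun s => σ * (heatSemigroup s φ x + ∫ r in a..s, heatSemigroup r F x)
  have hint := hFb.intervalIntegrable_heatSemigroup hn hA' ha hab hx
  have hderiv : ∀ s ∈ Ioo a b, HasDerivAt G (σ * parabolicRate f φ s x) s := by
    intro s hs
    have hs0 : 0 < s := ha.trans_lt hs.1
    have h1 := ((hφb.singBdd (θ := θ) hA).hasDerivAt_heatSemigroup hn hs0 hx).2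
    have hc : ∀ r > 0, ContinuousAt (fun r => heatSemigroup r F x) r := fun r hr =>
      ContinuousAt.comp (f := fun r : ℝ => (x, r))
        (g := fun p : EuclideanSpace ℝ (Fin n) × ℝ => heatSemigroup p.2 F p.1)
        (hFb.continuousAt_heatSemigroup hn hr hx) (by fun_prop)
    have h2 : HasDerivAt (fun s => ∫ r in a..s, heatSemigroup r F x) (heatSemigroup s F x) s := by
      refine intervalIntegral.integral_hasDerivAt_right
        (hFb.intervalIntegrable_heatSemigroup hn hA' ha hs.1.le hx) ?_ (hc s hs0)
      refine ContinuousOn.stronglyMeasurableAtFilter isOpen_Ioi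
        (fun r hr => (hc r hr).continuousWithinAt) s (mem_Ioi.2 hs0)
    exact (h1.add h2).const_mul σ
  have hcont : ContinuousOn G (Icc a b) := by
    refine ContinuousOn.const_mul (ContinuousOn.add ?_ ?_) _
    · exact (hφb.continuousOn_heatSemigroup hn hA hφ).comp (f := fun s : ℝ => (x, s))
        (by fun_prop) fun s hs => ⟨hx, ha.trans hs.1⟩
    · have := intervalIntegral.continuousOn_primitive_interval' hint left_mem_uIcc
      rwa [uIcc_of_le hab] at this
  have key := (convex_Icc a b).image_sub_le_mul_sub_of_deriv_le hcont (C := -c)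
    (fun s hs => by
      rw [interior_Icc] at hs
      exact (hderiv s hs).differentiableAt.differentiableWithinAt)
    (fun s hs => by
      rw [interior_Icc] at hs
      rw [(hderiv s hs).deriv]
      exact h s hs) a ⟨le_rfl, hab⟩ b ⟨hab, le_rfl⟩ hab
  simp only [G, intervalIntegral.integral_same] at key
  unfold heatIncrement
  linarith

end Increment

/-! ### Comparison with time translates and differentiability in time -/

section Monotone

variable {n : ℕ} {ν k θ B S : ℝ} {f : ℝ → ℝ → ℝ} {φ : EuclideanSpace ℝ (Fin n) → ℝ}
  {u v : EuclideanSpace ℝ (Fin n) → ℝ → ℝ}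

lemma ProfBddOn.intervalIntegrable (hn : Admissible n ν θ) (hf : Nonlinearity f ν k θ)
    (hB : 0 < B) (hu : ProfBddOn ν k B S u) {a b t : ℝ} (ha : 0 ≤ a) (hab : a ≤ b) (hbt : b ≤ t)
    (hbS : b ≤ S) {x : EuclideanSpace ℝ (Fin n)} (hx : x ≠ 0) :
    IntervalIntegrable (fun s => heatSemigroup (t - s) (fun y => f (u y s) ‖y‖) x) volume a b := by
  obtain ⟨K, hK, hlip⟩ := hf.lip B hB
  refine ((hu.sourceBdd hf hB.le hK.le hlip).intervalIntegrable hn (by positivity) hab hbt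
    hx).congr fun s hs => ?_
  rw [uIoc_of_le hab] at hs
  exact heatSemigroup_congr
    (fun y hy => truncSource_of_mem hy ⟨ha.trans hs.1.le, hs.2.trans hbS⟩) _ hx

lemma ProfBddOn.integral_mono (hn : Admissible n ν θ) (hf : Nonlinearity f ν k θ)
    (hB : 0 < B) (hu : ProfBddOn ν k B S u) (hv : ProfBddOn ν k B S v) {b t : ℝ} (hb : 0 ≤ b)
    (hbt : b ≤ t) (hbS : b ≤ S) (huv : ∀ y ≠ 0, ∀ s ∈ Icc 0 b, u y s ≤ v y s)
    {x : EuclideanSpace ℝ (Fin n)} (hx : x ≠ 0) :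
    ∫ s in (0 : ℝ)..b, heatSemigroup (t - s) (fun y => f (u y s) ‖y‖) x ≤
      ∫ s in (0 : ℝ)..b, heatSemigroup (t - s) (fun y => f (v y s) ‖y‖) x := by
  obtain ⟨K, hK, hlip⟩ := hf.lip B hB
  refine intervalIntegral.integral_mono_on hb
    (hu.intervalIntegrable hn hf hB le_rfl hb hbt hbS hx)
    (hv.intervalIntegrable hn hf hB le_rfl hb hbt hbS hx) fun s hs => ?_
  have hsS : s ∈ Icc 0 S := ⟨hs.1, hs.2.trans hbS⟩
  rw [heatSemigroup_congr (fun y hy => (truncSource_of_mem (f := f) (u := u) hy hsS).symm) _ hx,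
    heatSemigroup_congr (fun y hy => (truncSource_of_mem (f := f) (u := v) hy hsS).symm) _ hx]
  refine heatSemigroup_mono hn ((hu.sourceBdd hf hB.le hK.le hlip).singBdd s)
    ((hv.sourceBdd hf hB.le hK.le hlip).singBdd s) (fun y hy => ?_) _ hx
  rw [truncSource_of_mem hy hsS, truncSource_of_mem hy hsS]
  exact hf.mono _ (norm_pos_iff.2 hy) (hu.nonneg y hy s hsS) (hv.nonneg y hy s hsS) (huv y hy s hs)

lemma ProfBddOn.shift (hu : ProfBddOn ν k B S u) {h : ℝ} (hh : 0 ≤ h) :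
    ProfBddOn ν k B (S - h) fun y s => u y (s + h) := by
  have hmem : ∀ s ∈ Icc 0 (S - h), s + h ∈ Icc 0 S := fun s hs =>
    ⟨by linarith [hs.1], by linarith [hs.2]⟩
  exact ⟨hu.cont.comp (f := fun p : EuclideanSpace ℝ (Fin n) × ℝ => (p.1, p.2 + h))
      (by fun_prop) fun p hp => ⟨hp.1, hmem p.2 hp.2⟩,
    fun x hx t ht => hu.nonneg x hx _ (hmem t ht), fun x hx t ht => hu.le x hx _ (hmem t ht)⟩

lemma ProfBddOn.mono_time (hu : ProfBddOn ν k B S u) {S' : ℝ} (hS : S' ≤ S) :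
    ProfBddOn ν k B S' u :=
  ⟨hu.cont.mono (prod_mono_right (Icc_subset_Icc_right hS)),
    fun x hx t ht => hu.nonneg x hx t ⟨ht.1, ht.2.trans hS⟩,
    fun x hx t ht => hu.le x hx t ⟨ht.1, ht.2.trans hS⟩⟩

lemma integral_heatSemigroup_stationary (x : EuclideanSpace ℝ (Fin n)) (t h : ℝ) :
    ∫ s in (0 : ℝ)..h, heatSemigroup (t + h - s) (fun y => f (φ y) ‖y‖) x =
      ∫ r in t..(t + h), heatSemigroup r (fun y => f (φ y) ‖y‖) x := by
  rw [intervalIntegral.integral_comp_sub_left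
    (fun r => heatSemigroup r (fun y => f (φ y) ‖y‖) x) (t + h)]
  simp

/-- Hence the stationary function `φ` is a mild upper (lower) solution as soon as the increments
starting at time zero are nonpositive (nonnegative). -/
lemma duhamel_stationary (x : EuclideanSpace ℝ (Fin n)) (t : ℝ) :
    duhamel f φ (fun y _ => φ y) x t = φ x + heatIncrement f φ x 0 t := by
  have := integral_heatSemigroup_stationary (f := f) (φ := φ) x 0 t
  simp only [zero_add] at this
  rw [duhamel, this, heatIncrement, heatSemigroup_zero]
  ring

/-- The translate `u(· + h)` satisfies the Duhamel equation with datum `φ` up to a defect: the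
change of the free flow plus the source of the first strip `[0, h]`. -/
lemma ProfBddOn.duhamel_add (hn : Admissible n ν θ) (hf : Nonlinearity f ν k θ) (hB : 0 < B)
    (hu : ProfBddOn ν k B S u) {t h : ℝ} (ht : 0 ≤ t) (hh : 0 ≤ h) (hS : t + h ≤ S)
    {x : EuclideanSpace ℝ (Fin n)} (hx : x ≠ 0) :
    duhamel f φ u x (t + h) = duhamel f φ (fun y s => u y (s + h)) x t +
      (heatSemigroup (t + h) φ x - heatSemigroup t φ x +
        ∫ s in (0 : ℝ)..h, heatSemigroup (t + h - s) (fun y => f (u y s) ‖y‖) x) := by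
  have h1 := intervalIntegral.integral_comp_add_right (a := 0) (b := t)
    (fun s => heatSemigroup (t + h - s) (fun y => f (u y s) ‖y‖) x) h
  simp only [add_sub_add_right_eq_sub, zero_add] at h1
  have h2 := intervalIntegral.integral_add_adjacent_intervals
    (hu.intervalIntegrable hn hf hB le_rfl hh (by linarith) (by linarith) hx (t := t + h))
    (hu.intervalIntegrable hn hf hB hh (by linarith) le_rfl hS hx)
  rw [duhamel, duhamel, h1, ← h2]
  ring

/-- Comparison with the stationary upper solution gives `u ≤ φ`. Replacing `u` by `φ` in the first
strip bounds the defect of the translate by `heatIncrement`, which is nonpositive; so the translate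
is a lower solution and lies below `u`. -/
lemma ProfBddOn.le_add_heatIncrement (hn : Admissible n ν θ) (hf : Nonlinearity f ν k θ)
    (hB : 0 < B) (hφ : ProfBddOn ν k B S fun y _ => φ y) (hu : ProfBddOn ν k B S u)
    (hsol : ∀ x ≠ 0, ∀ t ∈ Icc 0 S, u x t = duhamel f φ u x t)
    (hinc : ∀ x ≠ 0, ∀ a b, 0 ≤ a → a ≤ b → heatIncrement f φ x a b ≤ 0)
    {t h : ℝ} (ht : 0 ≤ t) (hh : 0 ≤ h) (hS : t + h ≤ S)
    {x : EuclideanSpace ℝ (Fin n)} (hx : x ≠ 0) :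
    u x (t + h) ≤ u x t + heatIncrement f φ x t (t + h) := by
  have hle : ∀ x ≠ 0, ∀ t ∈ Icc 0 S, u x t ≤ φ x :=
    ProfBddOn.comparison hn hf hB hu hφ (fun x hx t ht => (hsol x hx t ht).le) fun x hx t ht => by
      rw [duhamel_stationary]
      linarith [hinc x hx 0 t le_rfl ht.1]
  have hstep : ∀ x ≠ 0, ∀ t ∈ Icc 0 (S - h), u x (t + h) ≤
      duhamel f φ (fun y s => u y (s + h)) x t + heatIncrement f φ x t (t + h) := by
    intro x hx t ht
    have htS : t + h ≤ S := by linarith [ht.2]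
    rw [hsol x hx _ ⟨by linarith [ht.1], htS⟩, hu.duhamel_add hn hf hB ht.1 hh htS hx,
      heatIncrement, ← integral_heatSemigroup_stationary]
    gcongr
    exact hu.integral_mono hn hf hB hφ hh (by linarith [ht.1]) (by linarith [ht.1])
      (fun y hy s hs => hle y hy s ⟨hs.1, by linarith [hs.2, ht.1]⟩) hx
  have hu' := hu.mono_time (S' := S - h) (by linarith)
  have hmono := ProfBddOn.comparison (φ := φ) hn hf hB (hu.shift hh) hu'
    (fun x hx t ht => (hstep x hx t ht).trans
      (by linarith [hinc x hx t (t + h) ht.1 (by linarith)]))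
    (fun x hx t ht => (hsol x hx t ⟨ht.1, by linarith [ht.2]⟩).ge)
  have htS : t ∈ Icc 0 (S - h) := ⟨ht, by linarith⟩
  -- The order just obtained is fed back into the integral inequality, now keeping the increment
  -- instead of discarding it.
  refine (hstep x hx t htS).trans ?_
  rw [hsol x hx t ⟨ht, by linarith⟩]
  gcongr
  exact (hu.shift hh).duhamel_mono hn hf hB hu' htS
    (fun s hs y hy => hmono y hy s ⟨hs.1, hs.2.trans htS.2⟩) hx

/-- The same argument with inequalities reversed: `φ` is a stationary lower solution and the
translate an upper one. -/
lemma ProfBddOn.add_heatIncrement_le (hn : Admissible n ν θ) (hf : Nonlinearity f ν k θ)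
    (hB : 0 < B) (hφ : ProfBddOn ν k B S fun y _ => φ y) (hu : ProfBddOn ν k B S u)
    (hsol : ∀ x ≠ 0, ∀ t ∈ Icc 0 S, u x t = duhamel f φ u x t)
    (hinc : ∀ x ≠ 0, ∀ a b, 0 ≤ a → a ≤ b → 0 ≤ heatIncrement f φ x a b)
    {t h : ℝ} (ht : 0 ≤ t) (hh : 0 ≤ h) (hS : t + h ≤ S)
    {x : EuclideanSpace ℝ (Fin n)} (hx : x ≠ 0) :
    u x t + heatIncrement f φ x t (t + h) ≤ u x (t + h) := by
  have hle : ∀ x ≠ 0, ∀ t ∈ Icc 0 S, φ x ≤ u x t :=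
    ProfBddOn.comparison (φ := φ) hn hf hB hφ hu (fun x hx t ht => by
      rw [duhamel_stationary]
      linarith [hinc x hx 0 t le_rfl ht.1]) fun x hx t ht => (hsol x hx t ht).ge
  have hstep : ∀ x ≠ 0, ∀ t ∈ Icc 0 (S - h),
      duhamel f φ (fun y s => u y (s + h)) x t + heatIncrement f φ x t (t + h) ≤ u x (t + h) := by
    intro x hx t ht
    have htS : t + h ≤ S := by linarith [ht.2]
    rw [hsol x hx _ ⟨by linarith [ht.1], htS⟩, hu.duhamel_add hn hf hB ht.1 hh htS hx,
      heatIncrement, ← integral_heatSemigroup_stationary]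
    gcongr
    exact hφ.integral_mono hn hf hB hu hh (by linarith [ht.1]) (by linarith [ht.1])
      (fun y hy s hs => hle y hy s ⟨hs.1, by linarith [hs.2, ht.1]⟩) hx
  have hu' := hu.mono_time (S' := S - h) (by linarith)
  have hmono := ProfBddOn.comparison (φ := φ) hn hf hB hu' (hu.shift hh)
    (fun x hx t ht => (hsol x hx t ⟨ht.1, by linarith [ht.2]⟩).le)
    (fun x hx t ht => le_trans (by linarith [hinc x hx t (t + h) ht.1 (by linarith)])
      (hstep x hx t ht))
  have htS : t ∈ Icc 0 (S - h) := ⟨ht, by linarith⟩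
  refine le_trans ?_ (hstep x hx t htS)
  rw [hsol x hx t ⟨ht, by linarith⟩]
  gcongr
  exact hu'.duhamel_mono hn hf hB (hu.shift hh) htS
    (fun s hs y hy => hmono y hy s ⟨hs.1, hs.2.trans htS.2⟩) hx

/-- Mild solutions are differentiable in time. -/
lemma ProfBddOn.differentiableAt (hn : Admissible n ν θ) (hf : Nonlinearity f ν k θ)
    (hB : 0 < B) {A : ℝ} (hA : 0 ≤ A) (hφ : ProfBdd ν k A φ) (hu : ProfBddOn ν k B S u)
    (hsol : ∀ x ≠ 0, ∀ t ∈ Icc 0 S, u x t = duhamel f φ u x t) {t : ℝ} (ht : t ∈ Ioo 0 S)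
    {x : EuclideanSpace ℝ (Fin n)} (hx : x ≠ 0) : DifferentiableAt ℝ (u x) t := by
  obtain ⟨K, hK, hlip⟩ := hf.lip B hB
  obtain ⟨C, hC⟩ := hn.exists_heatConst k S
  obtain ⟨D, hD, hduh⟩ := hn.exists_abs_duhamelIntegral_sub_le k S
  have hC0 := hC.pos
  have hθ := hn.pos
  have hθ1 := hn.le_one
  have ht0 : 0 < t := ht.1
  have hS0 : 0 < S := ht.1.trans ht.2
  have hsrc := hu.sourceBdd hf hB.le hK.le hlip
  -- A Hölder constant on `[t/2, S]`: the first term comes from the Lipschitz bound for the free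
  -- flow, converted to exponent `θ/4` by `b - a ≤ S`, the second from the Duhamel integral. The
  -- Lipschitz estimate for `f` carries it over to the source.
  set H := C * A * (t / 2) ^ (θ / 2 - 2) * S ^ (1 - θ / 4) + D * (K * B)
  have hH : 0 ≤ H := by positivity
  have hhol : ∀ y ≠ 0, ∀ a b, t / 2 ≤ a → a ≤ b → b ≤ S →
      |u y b - u y a| ≤ H * (b - a) ^ (θ / 4) * profile ν k ‖y‖ := by
    intro y hy a b ha hab hb
    have hp := profile_pos (ν := ν) (k := k) (norm_pos_iff.2 hy)
    have ha0 : 0 < a := by linarith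
    rw [hsol y hy b ⟨by linarith, hb⟩, hsol y hy a ⟨ha0.le, hab.trans hb⟩,
      duhamel_eq ⟨by linarith, hb⟩ hy, duhamel_eq ⟨ha0.le, hab.trans hb⟩ hy]
    have h1 := (hφ.singBdd (θ := θ) hA).abs_heatSemigroup_sub_le hn hC hA ha0 hab hb hy
    have h2 := hduh (K * B) (by positivity) _ hsrc a b ha0.le hab hb y hy
    have h3 : a ^ (θ / 2 - 2) ≤ (t / 2) ^ (θ / 2 - 2) :=
      Real.rpow_le_rpow_of_nonpos (by positivity) ha (by linarith)
    have hba : 0 ≤ b - a := sub_nonneg.2 hab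
    have h4 : b - a ≤ S ^ (1 - θ / 4) * (b - a) ^ (θ / 4) := by
      rcases hba.eq_or_lt with h0 | h0
      · rw [← h0]; positivity
      · calc b - a = (b - a) ^ (1 - θ / 4) * (b - a) ^ (θ / 4) := by
              rw [← Real.rpow_add h0]; simp
          _ ≤ _ := by
              gcongr
              · linarith
              · linarith
    have h5 : 0 ≤ a ^ (θ / 2 - 2) := by positivity
    rw [add_sub_add_comm]
    refine (abs_add_le _ _).trans ((add_le_add h1 h2).trans ?_)
    calc _ ≤ C * A * profile ν k ‖y‖ * (t / 2) ^ (θ / 2 - 2) *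
          (S ^ (1 - θ / 4) * (b - a) ^ (θ / 4)) +
          D * (K * B) * profile ν k ‖y‖ * (b - a) ^ (θ / 4) := by gcongr
      _ = _ := by simp only [H]; ring
  have hhol' : ∀ y ≠ 0, ∀ s ∈ Icc (t / 2) S,
      |u y s - u y t| ≤ H * |s - t| ^ (θ / 4) * profile ν k ‖y‖ := by
    intro y hy s hs
    rcases le_total s t with h | h
    · rw [abs_sub_comm (u y s), abs_sub_comm s, abs_of_nonneg (sub_nonneg.2 h)]
      exact hhol y hy s t hs.1 h ht.2.le
    · rw [abs_of_nonneg (sub_nonneg.2 h)]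
      exact hhol y hy t s (by linarith) h hs.2
  have hlip' : ∀ r > 0, ∀ a b, 0 ≤ a → 0 ≤ b → a ≤ B * profile ν k r → b ≤ B * profile ν k r →
      |f a r - f b r| ≤ K * (1 + r ^ (θ - 2)) * |a - b| := by
    intro r hr a b ha hb haB hbB
    rcases le_total a b with h | h
    · have := hf.mono r hr (mem_Ici.2 ha) (mem_Ici.2 hb) h
      rw [abs_sub_comm, abs_sub_comm a, abs_of_nonneg (sub_nonneg.2 this),
        abs_of_nonneg (sub_nonneg.2 h)]
      exact hlip r hr a b ha h hbB
    · have := hf.mono r hr (mem_Ici.2 hb) (mem_Ici.2 ha) h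
      rw [abs_of_nonneg (sub_nonneg.2 this), abs_of_nonneg (sub_nonneg.2 h)]
      exact hlip r hr b a hb h haB
  have hdiff : DifferentiableAt ℝ (duhamelIntegral (truncSource f u S) x) t := by
    refine hsrc.differentiableAt_duhamelIntegral hn (by positivity) (t₀ := t / 2) (t₁ := S)
      (α := θ / 4) (H := K * H) (by positivity) (by linarith) ht.2 (by positivity) (by positivity)
      (fun s hs y hy => ?_) hx
    have hr : 0 < ‖y‖ := norm_pos_iff.2 hy
    have hsS : s ∈ Icc 0 S := ⟨by linarith [hs.1], hs.2⟩
    have htS : t ∈ Icc 0 S := ⟨ht.1.le, ht.2.le⟩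
    rw [truncSource_of_mem hy hsS, truncSource_of_mem hy htS]
    refine (hlip' _ hr _ _ (hu.nonneg y hy s hsS) (hu.nonneg y hy t htS) (hu.le y hy s hsS)
      (hu.le y hy t htS)).trans ?_
    unfold singProfile
    calc _ ≤ K * (1 + ‖y‖ ^ (θ - 2)) * (H * |s - t| ^ (θ / 4) * profile ν k ‖y‖) := by
          gcongr; exact hhol' y hy s hs
      _ = _ := by ring
  have hheat := ((hφ.singBdd (θ := θ) hA).hasDerivAt_heatSemigroup hn ht0 hx).2.differentiableAt
  refine (hheat.add hdiff).congr_of_eventuallyEq ?_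
  filter_upwards [Ioo_mem_nhds ht.1 ht.2] with s hs
  have hs' : s ∈ Icc 0 S := ⟨hs.1.le, hs.2.le⟩
  rw [hsol x hx s hs', duhamel_eq hs' hx, Pi.add_apply]

end Monotone

/-! ### Monotonicity and strict monotonicity of mild solutions -/

section TimeMonotone

variable {n : ℕ} {ν ℓ δ θ : ℝ} {f : ℝ → ℝ → ℝ} {φ ζ : EuclideanSpace ℝ (Fin n) → ℝ} {T : EReal}
  {u : EuclideanSpace ℝ (Fin n) → ℝ → ℝ}

lemma InCS.continuousOn_source {k : ℝ} {w : EuclideanSpace ℝ (Fin n) → ℝ}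
    (hf : Nonlinearity f ν k θ) (hφ : InCS w φ) :
    ContinuousOn (fun y => f (φ y) ‖y‖) {0}ᶜ :=
  hf.cont.comp (f := fun y : EuclideanSpace ℝ (Fin n) => (φ y, ‖y‖))
    (hφ.cont.prodMk (by fun_prop)) fun y hy => ⟨hφ.nonneg y hy, norm_pos_iff.2 hy⟩

lemma ProfBdd.exists_singBdd_source {k A : ℝ} {w : EuclideanSpace ℝ (Fin n) → ℝ}
    (hn : Admissible n ν θ) (hf : Nonlinearity f ν k θ) (hφ : InCS w φ) (hA : 0 < A)
    (h : ProfBdd ν k A φ) : ∃ A' ≥ 0, SingBdd ν k θ A' fun y => f (φ y) ‖y‖ := by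
  obtain ⟨K, hK, hlip⟩ := hf.lip A hA
  obtain ⟨x, hx⟩ := hn.exists_ne_zero
  refine ⟨K * A, by positivity, aestronglyMeasurable_of_continuousOn hx
    (hφ.continuousOn_source hf), fun y hy => ?_⟩
  have hr : 0 < ‖y‖ := norm_pos_iff.2 hy
  rw [abs_of_nonneg (hf.nonneg hr (hφ.nonneg y hy))]
  exact le_singProfile_of_lip hf hK.le hlip hr (hφ.nonneg y hy)
    ((le_abs_self _).trans (h.bound y hy))

lemma ProfBdd.profBddOn_stationary {k A : ℝ} {w : EuclideanSpace ℝ (Fin n) → ℝ}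
    (hφ : InCS w φ) (h : ProfBdd ν k A φ) (S : ℝ) : ProfBddOn ν k A S fun y _ => φ y :=
  ⟨hφ.cont.comp (f := fun p : EuclideanSpace ℝ (Fin n) × ℝ => p.1) (by fun_prop) fun _ hp => hp.1,
    fun x hx _ _ => hφ.nonneg x hx, fun x hx _ _ => (le_abs_self _).trans (h.bound x hx)⟩

/-- The factor `σ` is taken to be `1` for weak upper and `-1` for weak lower solutions, so that one
argument serves both. -/
lemma InCS.mul_heatIncrement_nonpos (hn : Admissible n ν θ) (hf : Nonlinearity f ν (ℓ / δ) θ)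
    (hφ : InCS (weight ν ℓ δ) φ) {σ : ℝ} (hσ : ∀ η, IsTest η → σ * ellipticPairing f φ η ≤ 0)
    {x : EuclideanSpace ℝ (Fin n)} (hx : x ≠ 0) {a b : ℝ} (ha : 0 ≤ a) (hab : a ≤ b) :
    σ * heatIncrement f φ x a b ≤ 0 := by
  obtain ⟨A, hA, hφb⟩ := hφ.exists_profBdd hn
  obtain ⟨A', hA', hFb⟩ := hφb.exists_singBdd_source hn hf hφ hA
  have := mul_heatIncrement_le hn hA.le hA' hφ.cont hφb hFb (σ := σ) (c := 0) ha hab hx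
    fun τ hτ => by
      rw [neg_zero]
      exact mul_parabolicRate_nonpos hn hA.le hφ.cont hφb (hφ.continuousOn_source hf) hFb hσ
        (ha.trans_lt hτ.1) hx
  simpa using this

lemma InCS.exists_mul_heatIncrement_le (hn : Admissible n ν θ)
    (hf : Nonlinearity f ν (ℓ / δ) θ) (hφ : InCS (weight ν ℓ δ) φ) {σ : ℝ}
    (hσ : ∀ η, IsTest η → σ * ellipticPairing f φ η ≤ 0) (hζ : IsTest ζ)
    (hζσ : σ * ellipticPairing f φ ζ < 0) {t : ℝ} (ht : 0 < t)
    {x : EuclideanSpace ℝ (Fin n)} (hx : x ≠ 0) :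
    ∃ c > 0, ∀ h ∈ Icc (0 : ℝ) 1, σ * heatIncrement f φ x t (t + h) ≤ -c * h := by
  obtain ⟨A, hA, hφb⟩ := hφ.exists_profBdd hn
  obtain ⟨A', hA', hFb⟩ := hφb.exists_singBdd_source hn hf hφ hA
  obtain ⟨c, hc, hrate⟩ := exists_mul_parabolicRate_le_neg hn hA.le hφ.cont hφb
    (hφ.continuousOn_source hf) hFb hσ hζ hζσ ht hx
  refine ⟨c, hc, fun h hh => ?_⟩
  have := mul_heatIncrement_le hn hA.le hA' hφ.cont hφb hFb (σ := σ) (c := c) ht.le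
    (by linarith [hh.1] : t ≤ t + h) hx fun τ hτ => hrate τ ⟨hτ.1.le, by linarith [hτ.2, hh.2]⟩
  simpa using this

/-- On a compact time interval, the solution and its datum satisfy a common bound. -/
lemma IsMildSolution.exists_profBddOn (hn : Admissible n ν θ) (hφ : InCS (weight ν ℓ δ) φ)
    (hu : IsMildSolution f (weight ν ℓ δ) φ T u) {t : ℝ} (ht : 0 ≤ t) (htT : (t : EReal) < T) :
    ∃ S > t, ∃ B > 0, ProfBddOn ν (ℓ / δ) B S (fun y _ => φ y) ∧ ProfBddOn ν (ℓ / δ) B S u ∧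
      ProfBdd ν (ℓ / δ) B φ ∧ ∀ x ≠ 0, ∀ s ∈ Icc 0 S, u x s = duhamel f φ u x s := by
  obtain ⟨S, hS1, hS2⟩ := exists_real_between htT
  obtain ⟨A, hA, hφb⟩ := hφ.exists_profBdd hn
  obtain ⟨B, hB, huB⟩ := hu.mem.exists_profBddOn (ht.trans_lt hS1) hS2
  refine ⟨S, hS1, max A B, lt_max_of_lt_left hA,
    (hφb.profBddOn_stationary hφ S).mono_const (le_max_left _ _), huB.mono_const (le_max_right _ _),
    ⟨hφb.meas, fun y hy => (hφb.bound y hy).trans ?_⟩,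
    fun x hx s hs => hu.eq x hx s hs.1 (coe_lt_of_mem_Icc hs hS2)⟩
  have := profile_pos (ν := ν) (k := ℓ / δ) (norm_pos_iff.2 hy)
  gcongr
  exact le_max_left _ _

lemma IsMildSolution.le_add_heatIncrement (hn : Admissible n ν θ)
    (hf : Nonlinearity f ν (ℓ / δ) θ) (hφ : InCS (weight ν ℓ δ) φ)
    (hu : IsMildSolution f (weight ν ℓ δ) φ T u) (hw : IsWeakUpper f φ)
    {x : EuclideanSpace ℝ (Fin n)} (hx : x ≠ 0) {s t : ℝ} (hs : 0 ≤ s) (hst : s ≤ t)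
    (htT : (t : EReal) < T) :
    u x t ≤ u x s + heatIncrement f φ x s t ∧ heatIncrement f φ x s t ≤ 0 := by
  obtain ⟨S, hS, B, hB, hφB, huB, -, hsol⟩ := hu.exists_profBddOn hn hφ (hs.trans hst) htT
  have hinc : ∀ x ≠ 0, ∀ a b, 0 ≤ a → a ≤ b → heatIncrement f φ x a b ≤ 0 := fun x hx a b ha hab => by
    have := hφ.mul_heatIncrement_nonpos hn hf (σ := 1)
      (fun η hη => by rw [one_mul]; exact hw.2 η hη) hx ha hab
    rwa [one_mul] at this
  have := hφB.le_add_heatIncrement hn hf hB huB hsol hinc hs (sub_nonneg.2 hst)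
    (by linarith) hx
  rw [add_sub_cancel] at this
  exact ⟨this, hinc x hx s t hs hst⟩

lemma IsMildSolution.add_heatIncrement_le (hn : Admissible n ν θ)
    (hf : Nonlinearity f ν (ℓ / δ) θ) (hφ : InCS (weight ν ℓ δ) φ)
    (hu : IsMildSolution f (weight ν ℓ δ) φ T u) (hw : IsWeakLower f φ)
    {x : EuclideanSpace ℝ (Fin n)} (hx : x ≠ 0) {s t : ℝ} (hs : 0 ≤ s) (hst : s ≤ t)
    (htT : (t : EReal) < T) :
    u x s + heatIncrement f φ x s t ≤ u x t ∧ 0 ≤ heatIncrement f φ x s t := by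
  obtain ⟨S, hS, B, hB, hφB, huB, -, hsol⟩ := hu.exists_profBddOn hn hφ (hs.trans hst) htT
  have hinc : ∀ x ≠ 0, ∀ a b, 0 ≤ a → a ≤ b → 0 ≤ heatIncrement f φ x a b := fun x hx a b ha hab => by
    have := hφ.mul_heatIncrement_nonpos hn hf (σ := -1)
      (fun η hη => by linarith [hw.2 η hη]) hx ha hab
    linarith
  have := hφB.add_heatIncrement_le hn hf hB huB hsol hinc hs (sub_nonneg.2 hst)
    (by linarith) hx
  rw [add_sub_cancel] at this
  exact ⟨this, hinc x hx s t hs hst⟩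

lemma IsMildSolution.differentiableAt (hn : Admissible n ν θ)
    (hf : Nonlinearity f ν (ℓ / δ) θ) (hφ : InCS (weight ν ℓ δ) φ)
    (hu : IsMildSolution f (weight ν ℓ δ) φ T u) {x : EuclideanSpace ℝ (Fin n)} (hx : x ≠ 0)
    {t : ℝ} (ht : 0 < t) (htT : (t : EReal) < T) : DifferentiableAt ℝ (u x) t := by
  obtain ⟨S, hS, B, hB, -, huB, hφb, hsol⟩ := hu.exists_profBddOn hn hφ ht.le htT
  exact huB.differentiableAt hn hf hB hB.le hφb hsol ⟨ht, hS⟩ hx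

lemma HasDerivAt.le_of_forall_sub_le {g : ℝ → ℝ} {d c t ε : ℝ} (hg : HasDerivAt g d t)
    (hε : 0 < ε) (h : ∀ s ∈ Ioo 0 ε, g (t + s) - g t ≤ c * s) : d ≤ c := by
  have h1 := (hasDerivAt_iff_tendsto_slope_zero.1 hg).mono_left
    (nhdsWithin_mono 0 (s := Ioi 0) fun s hs => (mem_Ioi.1 hs).ne')
  refine le_of_tendsto h1 ?_
  filter_upwards [Ioo_mem_nhdsGT hε] with s hs
  rw [smul_eq_mul, inv_mul_eq_div, div_le_iff₀ hs.1]
  exact h s hs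

/-- The solution drops by at least the increment of the stationary flow, hence by `c s` over a short
time `s`; right difference quotients suffice since the derivative is known to exist. -/
lemma IsMildSolution.exists_hasDerivAt_neg (hn : Admissible n ν θ)
    (hf : Nonlinearity f ν (ℓ / δ) θ) (hφ : InCS (weight ν ℓ δ) φ)
    (hu : IsMildSolution f (weight ν ℓ δ) φ T u) (hw : IsWeakUpper f φ) (hw' : ¬ IsWeakSol f φ)
    {x : EuclideanSpace ℝ (Fin n)} (hx : x ≠ 0) {t : ℝ} (ht : 0 < t) (htT : (t : EReal) < T) :
    ∃ d < 0, HasDerivAt (fun τ => u x τ) d t := by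
  have hd := (hu.differentiableAt hn hf hφ hx ht htT).hasDerivAt
  refine ⟨_, ?_, hd⟩
  obtain ⟨ζ, hζ, hζ0⟩ : ∃ ζ, IsTest ζ ∧ ellipticPairing f φ ζ ≠ 0 := by
    by_contra! h
    exact hw' ⟨hw.1, h⟩
  obtain ⟨c, hc, hinc⟩ := hφ.exists_mul_heatIncrement_le hn hf (σ := 1)
    (fun η hη => by rw [one_mul]; exact hw.2 η hη) hζ
    (by rw [one_mul]; exact lt_of_le_of_ne (hw.2 ζ hζ) hζ0) ht hx
  obtain ⟨S, hS1, hS2⟩ := exists_real_between htT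
  refine lt_of_le_of_lt (hd.le_of_forall_sub_le (c := -c) (ε := min (S - t) 1)
    (lt_min (by linarith) one_pos) fun s hs => ?_) (by linarith)
  have hs1 := hs.2.trans_le (min_le_left _ _)
  have hs2 := hs.2.trans_le (min_le_right _ _)
  have h1 := (hu.le_add_heatIncrement hn hf hφ hw hx ht.le (by linarith [hs.1] : t ≤ t + s)
    (coe_lt_of_mem_Icc ⟨by linarith [hs.1], by linarith⟩ hS2)).1
  have h2 := hinc s ⟨hs.1.le, hs2.le⟩
  linarith

lemma IsMildSolution.exists_hasDerivAt_pos (hn : Admissible n ν θ)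
    (hf : Nonlinearity f ν (ℓ / δ) θ) (hφ : InCS (weight ν ℓ δ) φ)
    (hu : IsMildSolution f (weight ν ℓ δ) φ T u) (hw : IsWeakLower f φ) (hw' : ¬ IsWeakSol f φ)
    {x : EuclideanSpace ℝ (Fin n)} (hx : x ≠ 0) {t : ℝ} (ht : 0 < t) (htT : (t : EReal) < T) :
    ∃ d > 0, HasDerivAt (fun τ => u x τ) d t := by
  have hd := (hu.differentiableAt hn hf hφ hx ht htT).hasDerivAt
  refine ⟨_, ?_, hd⟩
  obtain ⟨ζ, hζ, hζ0⟩ : ∃ ζ, IsTest ζ ∧ ellipticPairing f φ ζ ≠ 0 := by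
    by_contra! h
    exact hw' ⟨hw.1, h⟩
  obtain ⟨c, hc, hinc⟩ := hφ.exists_mul_heatIncrement_le hn hf (σ := -1)
    (fun η hη => by linarith [hw.2 η hη]) hζ
    (by linarith [lt_of_le_of_ne (hw.2 ζ hζ) hζ0.symm]) ht hx
  obtain ⟨S, hS1, hS2⟩ := exists_real_between htT
  have h := hd.neg.le_of_forall_sub_le (c := -c) (ε := min (S - t) 1)
    (lt_min (by linarith) one_pos) fun s hs => ?_
  · linarith
  have hs1 := hs.2.trans_le (min_le_left _ _)
  have hs2 := hs.2.trans_le (min_le_right _ _)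
  have h1 := (hu.add_heatIncrement_le hn hf hφ hw hx ht.le (by linarith [hs.1] : t ≤ t + s)
    (coe_lt_of_mem_Icc ⟨by linarith [hs.1], by linarith⟩ hS2)).1
  have h2 := hinc s ⟨hs.1.le, hs2.le⟩
  simp only [Pi.neg_apply]
  linarith

end TimeMonotone

/-- The lower bound on `lu` amounts to `(lu - 2)(n - 2) > 2`, which also forces `lu > 2`. -/
lemma fowlerM_add_two_lt {n : ℕ} (hn : 2 < n) {lu : ℝ}
    (h : 2 * ((n : ℝ) - 1) / ((n : ℝ) - 2) < lu) : fowlerM lu + 2 < n := by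
  have h0 : (0 : ℝ) < (n : ℝ) - 2 := by
    have : (2 : ℝ) < n := by exact_mod_cast hn
    linarith
  rw [div_lt_iff₀ h0] at h
  have h1 : 2 < (lu - 2) * ((n : ℝ) - 2) := by linarith
  have h2 : 0 < lu - 2 := (pos_iff_pos_of_mul_pos (two_pos.trans h1)).2 h0
  have h3 : 2 / (lu - 2) < (n : ℝ) - 2 := by rw [div_lt_iff₀ h2]; linarith
  unfold fowlerM
  linarith

end

theorem theorem3p8 (n : ℕ) (hn : 2 < n) (f : ℝ → ℝ → ℝ) (lu ℓ δ ν : ℝ)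
    (hF0 : HypF0 f) (hFu : HypFu n f lu) (hFs : HypFs f ℓ δ)
    (hν0 : 0 ≤ ν) (hν : ν < fowlerM lu)
    (φ : EuclideanSpace ℝ (Fin n) → ℝ) (hφ : InCS (weight ν ℓ δ) φ) :
    ∃ (Tφ : EReal) (u : EuclideanSpace ℝ (Fin n) → ℝ → ℝ),
      IsUniqueMaximalSolution f (weight ν ℓ δ) φ Tφ u ∧
      -- (i) comparison of upper and lower solutions
      (∀ (T : EReal) (uUp uLow : EuclideanSpace ℝ (Fin n) → ℝ → ℝ),
        IsMildUpper f (weight ν ℓ δ) φ T uUp → IsMildLower f (weight ν ℓ δ) φ T uLow →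
        T ≤ Tφ ∧ ∀ x ≠ 0, ∀ t : ℝ, 0 ≤ t → (t : EReal) < T →
          uLow x t ≤ uUp x t ∧ uLow x t ≤ u x t ∧ u x t ≤ uUp x t) ∧
      -- (ii) monotonicity in time
      (IsWeakUpper f φ → ∀ x ≠ 0, ∀ s t : ℝ, 0 ≤ s → s ≤ t → (t : EReal) < Tφ → u x t ≤ u x s) ∧
      (IsWeakLower f φ → ∀ x ≠ 0, ∀ s t : ℝ, 0 ≤ s → s ≤ t → (t : EReal) < Tφ → u x s ≤ u x t) ∧
      -- (iii) radial symmetry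
      ((∀ x y, x ≠ 0 → y ≠ 0 → ‖x‖ = ‖y‖ → φ x = φ y) →
        ∀ x y, x ≠ 0 → y ≠ 0 → ‖x‖ = ‖y‖ →
          ∀ t : ℝ, 0 ≤ t → (t : EReal) < Tφ → u x t = u y t) ∧
      -- (iv) strict monotonicity in time
      (IsWeakUpper f φ → ¬ IsWeakSol f φ → ∀ x ≠ 0, ∀ t : ℝ, 0 < t → (t : EReal) < Tφ →
        ∃ d < 0, HasDerivAt (fun τ => u x τ) d t) ∧
      (IsWeakLower f φ → ¬ IsWeakSol f φ → ∀ x ≠ 0, ∀ t : ℝ, 0 < t → (t : EReal) < Tφ →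
        ∃ d > 0, HasDerivAt (fun τ => u x τ) d t) := by
  obtain ⟨θ, hθ, hlip⟩ := exists_lipschitz_profile hF0 hFu hFs hν0 hν
  have hm := fowlerM_add_two_lt hn hFu.gu.lu_gt
  have hadm : Admissible n ν θ := ⟨hν0, by linarith, hθ.1, hθ.2⟩
  have hf : Nonlinearity f ν (ℓ / δ) θ := ⟨hF0.locLip.continuousOn, hF0.zero, hF0.mono, hlip⟩
  obtain ⟨Tφ, u, hu⟩ := exists_isUniqueMaximalSolution hadm hf hφ
  refine ⟨Tφ, u, hu, fun T uUp uLow hUp hLow => ?_, fun hw x hx s t hs hst ht => ?_,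
    fun hw x hx s t hs hst ht => ?_,
    fun hrad x y hx _ hxy t ht htT => hu.sol.radial hadm hf hrad hx hxy ht htT,
    fun hw hw' x hx t ht htT => hu.sol.exists_hasDerivAt_neg hadm hf hφ hw hw' hx ht htT,
    fun hw hw' x hx t ht htT => hu.sol.exists_hasDerivAt_pos hadm hf hφ hw hw' hx ht htT⟩
  -- The upper solution yields a solution on its whole interval, so maximality gives `T ≤ Tφ` and
  -- uniqueness identifies that solution with `u`.
  · obtain ⟨v, hv⟩ := hUp.exists_isMildSolution hadm hf hφ
    obtain ⟨hT, hvu⟩ := hu.unique T v hv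
    refine ⟨hT, fun x hx t ht htT => ⟨hLow.le_upper hadm hf hUp x hx t ht htT, ?_, ?_⟩⟩
    · rw [← hvu x hx t ht htT]
      exact hLow.le_upper hadm hf hv.isMildUpper x hx t ht htT
    · rw [← hvu x hx t ht htT]
      exact hv.isMildLower.le_upper hadm hf hUp x hx t ht htT
  · have := hu.sol.le_add_heatIncrement hadm hf hφ hw hx hs hst ht
    linarith [this.1, this.2]
  · have := hu.sol.add_heatIncrement_le hadm hf hφ hw hx hs hst ht
    linarith [this.1, this.2]
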